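/- **Setting.** Consider a chain of $N\ge 1$ spins-$1/2$ with Pauli operators $\sigma_i^{x},\sigma_i^y,\sigma_i^z$, and let $\|\cdot\|$ be the operator norm. Let $\xi>0$ and $q$ be constants. A unitary $W$ is *quasilocal* if $W=\prod_{n=1}^{N}\prod_{j=1}^{n}\prod_{i=0}^{\lfloor (N-n)/n\rfloor}W^{(n)}_{in+j}$, where $W^{(n)}_k$ is a unitary on the sites $k,\dots,k+n-1$ with $\|1-W^{(n)}_k\|^2<q\,e^{-(n-1)/\xi}$ (if $k+n-1>N$, it is a product of a unitary on the sites $k,\dots,N$ and a unitary on the sites $1,\dots,k+n-1-N$). A Hamiltonian $H$ is *MBL* if $H=\sum_{\emptyset\ne I}J_I\prod_{i\in I}\tau_i^z$, where $\tau_i^z=W\sigma_i^zW^\dagger$ for some quasilocal unitary $W$, and the $J_I$ are real with $|J_I|\le e^{-(\max I-\min I)/\xi}$. It is *finite-range in the physical basis*, with range $r$ and strength $K$, if it is a sum of real multiples, with coefficients of absolute value at most $K$, of products of Pauli matrices (or identities) on the sites $k,\dots,k+r-1$ (those that exist), with one coefficient for each $k\in\{1,\dots,N\}$ and each word of $r$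 letters from $\{1,\sigma^x,\sigma^y,\sigma^z\}$. Let $\psi=e^{-iHt}|0\dots0\rangle$, and let $\mathcal D(\sigma)=|\langle\sigma|\psi\rangle|^2$ be the distribution of the outcomes of measuring $\psi$ in the physical basis. A description of $(H,t)$ to $p$ binary digits consists of an integer within $1$ of $2^p x$ for $x=t$ and for each of these coefficients $x$ of $H$. Algorithms are programs for a random access machine with logarithmic (bit) cost; a randomized algorithm receives in addition polynomially many fair coin flips. **Corollary.** Fix $r,K,\xi,q$ and a function $\tau$ with $\tau(N)=O(\log N)$. There are three algorithms that do the following for every $N\ge1$, every MBL Hamiltonian $H$ on $N$ sites that is finite-range in the physical basis (with these constants), every $t$ with $|t|\le\tau(N)$ and every $\varepsilon>0$, given $N$, $m=\lceil1/\varepsilon\rceil$, $p$ and any description of $(H,t)$ to $p$ binary digits. Here $p$ is any number above a fixed polynomial in $N+m$, and the running times are at most a fixed polynomial in $N+m+p$; so they are polynomial in $N$ and $1/\varepsilon$ if $p$ is. 1. (Sampling.) A randomized algorithm outputs a sample from a distribution $\mathcal D_\varepsilon$ with $\frac12\sum_\sigma|\mathcal D_\varepsilon(\sigma)-\mathcal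 D(\sigma)|<\varepsilon$. 2. (Strong simulation, probabilities.) There is a distribution $\mathcal D_\varepsilon$ with $\frac12\sum_\sigma|\mathcal D_\varepsilon(\sigma)-\mathcal D(\sigma)|<\varepsilon$ such that a deterministic algorithm, given outcomes prescribed on two arbitrary sets of sites, outputs, as a fraction, the exact conditional probability under $\mathcal D_\varepsilon$ of the second prescription given the first, whenever the first one has nonzero probability. In particular it computes all marginal probabilities of $\mathcal D_\varepsilon$. 3. (Strong simulation, observables.) A deterministic algorithm, given also the entries of Hermitian $2\times2$ matrices $O_1,\dots,O_N$ with $\|O_i\|\le1$ to $p$ binary digits (real and imaginary parts, in the same sense), outputs as a fraction a number $y$ with $|y-\langle\psi|O_1\otimes\dots\otimes O_N|\psi\rangle|<\varepsilon$. -/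

import Mathlib

open scoped Matrix

noncomputable section

namespace SpinChain

/-! ### A deterministic random access machine with logarithmic cost -/

namespace RAM

/-- The memory: finitely or infinitely many integer arrays `m 0, m 1, …`, each indexed by `ℕ`.
A program is a finite text, so it only names finitely many of the arrays. -/
abbrev Mem := ℕ → ℕ → ℤ

/-- Number of bits of an integer, sign included. -/
def bits (z : ℤ) : ℕ := Nat.size z.natAbs + 1

/-- Integer expressions. -/
inductive Expr where
  | const (z : ℤ)
  | get (a : ℕ) (i : Expr)
  | add (x y : Expr)
  | sub (x y : Expr)
  | mul (x y : Expr)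
  | div (x y : Expr)
  | lt (x y : Expr)

/-- The value of an expression. A negative array index is read as `0`; division is Euclidean
division (with value `0` for divisor `0`); a comparison has value `1` or `0`. -/
def Expr.eval (m : Mem) : Expr → ℤ
  | .const z => z
  | .get a i => m a (i.eval m).toNat
  | .add x y => x.eval m + y.eval m
  | .sub x y => x.eval m - y.eval m
  | .mul x y => x.eval m * y.eval m
  | .div x y => x.eval m / y.eval m
  | .lt x y => if x.eval m < y.eval m then 1 else 0

/-- The bit cost of evaluating an expression: every access is charged the length of the address
and of the value, sums and comparisons the total length of the operands, products and quotients
the product of these lengths. -/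
def Expr.cost (m : Mem) : Expr → ℕ
  | .const z => bits z
  | .get a i => i.cost m + bits (i.eval m) + bits (m a (i.eval m).toNat)
  | .add x y => x.cost m + y.cost m + bits (x.eval m) + bits (y.eval m)
  | .sub x y => x.cost m + y.cost m + bits (x.eval m) + bits (y.eval m)
  | .mul x y => x.cost m + y.cost m + bits (x.eval m) * bits (y.eval m)
  | .div x y => x.cost m + y.cost m + bits (x.eval m) * bits (y.eval m)
  | .lt x y => x.cost m + y.cost m + bits (x.eval m) + bits (y.eval m)

/-- Programs. `assign a i e` is the assignment `a[i] := e`; a test succeeds if its value is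
nonzero. -/
inductive Prog where
  | skip
  | assign (a : ℕ) (i e : Expr)
  | seq (c d : Prog)
  | cond (e : Expr) (c d : Prog)
  | loop (e : Expr) (c : Prog)

/-- The memory after writing `v` into cell `i` of array `a`. -/
def write (m : Mem) (a i : ℕ) (v : ℤ) : Mem :=
  Function.update m a (Function.update (m a) i v)

/-- `Exec c m m' T`: started in memory `m`, the program `c` halts with memory `m'`, and the total
bit cost of the run is `T`. -/
inductive Exec : Prog → Mem → Mem → ℕ → Prop
  | skip (m : Mem) : Exec .skip m m 1
  | assign (m : Mem) (a : ℕ) (i e : Expr) :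
      Exec (.assign a i e) m (write m a (i.eval m).toNat (e.eval m))
        (i.cost m + e.cost m + bits (i.eval m) + bits (e.eval m) + 1)
  | seq {c d : Prog} {m m₁ m₂ : Mem} {S T : ℕ} :
      Exec c m m₁ S → Exec d m₁ m₂ T → Exec (.seq c d) m m₂ (S + T)
  | cond_true {e : Expr} {c d : Prog} {m m₁ : Mem} {T : ℕ} :
      e.eval m ≠ 0 → Exec c m m₁ T → Exec (.cond e c d) m m₁ (e.cost m + 1 + T)
  | cond_false {e : Expr} {c d : Prog} {m m₁ : Mem} {T : ℕ} :
      e.eval m = 0 → Exec d m m₁ T → Exec (.cond e c d) m m₁ (e.cost m + 1 + T)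
  | loop_true {e : Expr} {c : Prog} {m m₁ m₂ : Mem} {S T : ℕ} :
      e.eval m ≠ 0 → Exec c m m₁ S → Exec (.loop e c) m₁ m₂ T →
        Exec (.loop e c) m m₂ (e.cost m + 1 + S + T)
  | loop_false {e : Expr} {c : Prog} {m : Mem} :
      e.eval m = 0 → Exec (.loop e c) m m (e.cost m + 1)

/-- The program halts with memory `m'` within time `B`. -/
def RunsIn (c : Prog) (m : Mem) (B : ℕ) (m' : Mem) : Prop := ∃ T ≤ B, Exec c m m' T

end RAM

/-! ### Operators on a chain of `N` spins (sites are numbered `0, …, N - 1`) -/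

/-- Outcomes of a measurement of all `N` spins: `0` is the eigenvalue `+1` of `σᶻ`, `1` is `-1`. -/
abbrev Cfg (N : ℕ) := Fin N → Fin 2

/-- Operators on the Hilbert space of `N` spins, in the physical basis. -/
abbrev Op (N : ℕ) := Matrix (Cfg N) (Cfg N) ℂ

/-- The operator norm for the Euclidean norm (the largest singular value). -/
def opNorm {n : Type*} [Fintype n] [DecidableEq n] (A : Matrix n n ℂ) : ℝ :=
  ‖Matrix.toEuclideanCLM (n := n) (𝕜 := ℂ) A‖

/-- The tensor product of one operator for each site. -/
def siteTensor {N : ℕ} (A : Fin N → Matrix (Fin 2) (Fin 2) ℂ) : Op N :=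
  Matrix.of fun s s' => ∏ i, A i (s i) (s' i)

/-- The matrices `1, σˣ, σʸ, σᶻ`. -/
def pauli : Fin 4 → Matrix (Fin 2) (Fin 2) ℂ :=
  ![1, !![0, 1; 1, 0], !![0, -Complex.I; Complex.I, 0], !![1, 0; 0, -1]]

/-- `σᶻ` on site `i`. -/
def sigmaZ {N : ℕ} (i : Fin N) : Op N :=
  siteTensor fun l => if l = i then pauli 3 else 1

/-- The operator `A` acts on the sites in `S` only: it is `B ⊗ 1` with `B` acting on `S`. -/
def ActsOn {N : ℕ} (S : Set (Fin N)) (A : Op N) : Prop :=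
  ∃ B : Matrix (S → Fin 2) (S → Fin 2) ℂ, ∀ s s' : Cfg N,
    ((∀ i, i ∉ S → s i = s' i) → A s s' = B (fun i => s i) (fun i => s' i)) ∧
    ((∃ i, i ∉ S ∧ s i ≠ s' i) → A s s' = 0)

/-- Quasilocal unitaries: `W = ∏ₙ ∏ⱼ ∏ᵢ V⁽ⁿ⁾` for `1 ≤ n ≤ N`, `0 ≤ j < n`,
`0 ≤ i ≤ ⌊(N - n) / n⌋`, where the constituent `V n k`, `k = i n + j`, is a unitary on the `n` sites
that start at `k`, with `‖1 - V n k‖² < q exp (-(n - 1) / ξ)`. Where these sites pass the right end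
of the chain, `V n k` is a product of a unitary on the sites from `k` to the end and of a unitary
on the first `k + n - N` sites (otherwise the second set of sites is empty, and the second factor
is a phase). -/
def IsQuasilocal {N : ℕ} (ξ q : ℝ) (W : Op N) : Prop :=
  ∃ V : ℕ → ℕ → Op N,
    (∀ n k, 1 ≤ n → n ≤ N → k < N →
      (∃ A ∈ Matrix.unitaryGroup (Cfg N) ℂ, ∃ B ∈ Matrix.unitaryGroup (Cfg N) ℂ,
        ActsOn {i : Fin N | k ≤ i.val ∧ i.val < k + n} A ∧
        ActsOn {i : Fin N | i.val + N < k + n} B ∧ V n k = A * B) ∧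
      opNorm (1 - V n k) ^ 2 < q * Real.exp (-((n : ℝ) - 1) / ξ)) ∧
    W = ((List.range' 1 N).map fun n =>
          ((List.range n).map fun j =>
            ((List.range ((N - n) / n + 1)).map fun i => V n (i * n + j)).prod).prod).prod

/-- Many-body localized Hamiltonians: `H = ∑_I J_I ∏_{i ∈ I} τᵢ` over the nonempty sets `I` of
sites, with `τᵢ = W σᵢᶻ W†` for a quasilocal unitary `W`, and real couplings
`|J_I| ≤ exp (-(max I - min I) / ξ)`. -/
def IsMBL {N : ℕ} (ξ q : ℝ) (H : Op N) : Prop :=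
  ∃ (W : Op N) (J : Finset (Fin N) → ℝ), IsQuasilocal ξ q W ∧
    (∀ I, ∀ i ∈ I, ∀ j ∈ I, |J I| ≤ Real.exp (-((j.val : ℝ) - (i.val : ℝ)) / ξ)) ∧
    H = ∑ I ∈ (Finset.univ : Finset (Finset (Fin N))).filter (fun I => I.Nonempty),
      (J I : ℂ) •
        (((List.finRange N).filter (fun i => i ∈ I)).map fun i => W * sigmaZ i * Wᴴ).prod

/-- The product of the Pauli matrices `pauli (α 0), …, pauli (α (r - 1))` on the sites
`k, …, k + r - 1` (those of them that exist). -/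
def pauliWindow {N r : ℕ} (k : Fin N) (α : Fin r → Fin 4) : Op N :=
  siteTensor fun i =>
    if h : k.val ≤ i.val ∧ i.val - k.val < r then pauli (α ⟨i.val - k.val, h.2⟩) else 1

/-- The Hamiltonian of range `r` with the given real coefficients in the physical basis. -/
def hamiltonian {N r : ℕ} (c : Fin N → (Fin r → Fin 4) → ℝ) : Op N :=
  ∑ k, ∑ α, (c k α : ℂ) • pauliWindow k α

/-- An instance of the simulation problem: a chain of `N` spins, an MBL Hamiltonian that has range
`r` in the physical basis with coefficients bounded by `K`, and a time `t` with `|t| ≤ τ N`. -/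
structure Inst (r : ℕ) (K ξ q : ℝ) (τ : ℕ → ℝ) where
  N : ℕ
  N_pos : 0 < N
  coeff : Fin N → (Fin r → Fin 4) → ℝ
  coeff_le : ∀ k α, |coeff k α| ≤ K
  mbl : IsMBL ξ q (hamiltonian coeff)
  t : ℝ
  t_le : |t| ≤ τ N

namespace Inst

variable {r : ℕ} {K ξ q : ℝ} {τ : ℕ → ℝ}

/-- The evolved state `exp (-i H t) |0…0⟩`, in the physical basis. -/
def state (P : Inst r K ξ q τ) : Cfg P.N → ℂ :=
  NormedSpace.exp ((-(Complex.I * (P.t : ℂ))) • hamiltonian P.coeff) *ᵥ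
    (Pi.single (fun _ => 0) 1)

/-- The distribution of the outcomes of measuring the evolved state in the physical basis. -/
def dist (P : Inst r K ξ q τ) (s : Cfg P.N) : ℝ := ‖P.state s‖ ^ 2

/-- The expectation value of `⊗ᵢ Oᵢ` in the evolved state. -/
def expectation (P : Inst r K ξ q τ) (O : Fin P.N → Matrix (Fin 2) (Fin 2) ℂ) : ℂ :=
  star P.state ⬝ᵥ (siteTensor O *ᵥ P.state)

end Inst

/-- The integer `a` gives the real number `x` to `p` binary digits. -/
def Approx (p : ℕ) (a : ℤ) (x : ℝ) : Prop := |(a : ℝ) - 2 ^ p * x| ≤ 1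

/-- A description of an instance to `p` binary digits: integers that give the evolution time and
the coefficients of the Hamiltonian in terms of physical operators. -/
structure Desc {r : ℕ} {K ξ q : ℝ} {τ : ℕ → ℝ} (P : Inst r K ξ q τ) (p : ℕ) where
  time : ℤ
  coeff : Fin P.N → (Fin r → Fin 4) → ℤ
  time_approx : Approx p time P.t
  coeff_approx : ∀ k α, Approx p (coeff k α) (P.coeff k α)

/-- The initial memory: array `0` holds `N`, `m`, `p` and the time, array `1` the coefficients, where
that of `k` and `α` is in cell `k * 4 ^ r + ∑ⱼ αⱼ 4 ^ j`; arrays `2` and `3` hold further data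
`x` and `y`; all other arrays are zero. -/
def inputMem {r : ℕ} {K ξ q : ℝ} {τ : ℕ → ℝ} {P : Inst r K ξ q τ} {p : ℕ} (m : ℕ)
    (d : Desc P p) (x y : ℕ → ℤ) : RAM.Mem
  | 0, 0 => P.N
  | 0, 1 => m
  | 0, 2 => p
  | 0, 3 => d.time
  | 1, l => if h : l / 4 ^ r < P.N then
      d.coeff ⟨l / 4 ^ r, h⟩
        (finFunctionFinEquiv.symm ⟨l % 4 ^ r, Nat.mod_lt l (by positivity)⟩)
      else 0
  | 2, l => x l
  | 3, l => y l
  | _, _ => 0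

/-- Array `4` is the output array. A measurement outcome is read off from its first `N` cells. -/
def outCfg (N : ℕ) (m : RAM.Mem) : Cfg N := fun i => if m 4 i.val = 0 then 0 else 1

/-- The first two cells of the output array hold the real number `x` as a fraction. -/
def OutFraction (m : RAM.Mem) (x : ℝ) : Prop := m 4 1 ≠ 0 ∧ (m 4 0 : ℝ) / (m 4 1 : ℝ) = x

/-- Total variation distance. -/
def tvDist {α : Type*} [Fintype α] (D E : α → ℝ) : ℝ := (1 / 2) * ∑ s, |D s - E s|

/-- A probability distribution on a finite type. -/
def IsDist {α : Type*} [Fintype α] (D : α → ℝ) : Prop := (∀ s, 0 ≤ D s) ∧ ∑ s, D s = 1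

/-- The distribution of `f ω` for `R` independent fair coin flips `ω`. -/
def coinDist {R : ℕ} {α : Type*} [DecidableEq α] (f : (Fin R → Fin 2) → α) (s : α) : ℝ :=
  ((Finset.univ.filter fun ω => f ω = s).card : ℝ) / 2 ^ R

/-- The coin flips as an array. -/
def coinArray {R : ℕ} (ω : Fin R → Fin 2) (l : ℕ) : ℤ := if h : l < R then (ω ⟨l, h⟩).val else 0

/-- The outcome `s` agrees with the partial assignment `a` of outcomes to sites. -/
def Agrees {N : ℕ} (a : Fin N → Option (Fin 2)) (s : Cfg N) : Prop := ∀ i, ∀ b ∈ a i, s i = b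

open Classical in
/-- The marginal probability, under `D`, of the outcomes prescribed by `a`. -/
def marginal {N : ℕ} (D : Cfg N → ℝ) (a : Fin N → Option (Fin 2)) : ℝ :=
  ∑ s ∈ Finset.univ.filter (fun s => Agrees a s), D s

open Classical in
/-- The conditional probability, under `D`, of the outcomes prescribed by `b`, given those
prescribed by `a` (for nonzero `marginal D a`). If `a` prescribes nothing, this is the marginal
probability of `b`. -/
def conditional {N : ℕ} (D : Cfg N → ℝ) (a b : Fin N → Option (Fin 2)) : ℝ :=
  (∑ s ∈ Finset.univ.filter (fun s => Agrees a s ∧ Agrees b s), D s) / marginal D a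

/-- A partial assignment as an array: the outcome, or `2` where there is none. -/
def queryArray {N : ℕ} (a : Fin N → Option (Fin 2)) (l : ℕ) : ℤ :=
  if h : l < N then (match a ⟨l, h⟩ with | none => 2 | some b => (b.val : ℤ)) else 0

/-- A list of `N` integer `2 × 2` matrices as an array: the entry `(u, v)` of matrix `i` is in cell
`4 i + 2 u + v`. -/
def matArray {N : ℕ} (o : Fin N → Fin 2 → Fin 2 → ℤ) (l : ℕ) : ℤ :=
  if h : l / 4 < N then
    o ⟨l / 4, h⟩ ⟨l / 2 % 2, Nat.mod_lt _ two_pos⟩ ⟨l % 2, Nat.mod_lt _ two_pos⟩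
  else 0

/-! ### The simulation tasks -/

/-- Sampling is easy: one randomized program, for all instances and all `ε > 0`, outputs a sample from
a distribution that is `ε`-close in total variation to that of the evolved state. Time, coin flips
and required precision of the description are polynomial in `N` and `1 / ε` (and the time, in
the precision that is given). -/
def SamplingEasy (r : ℕ) (K ξ q : ℝ) (τ : ℕ → ℝ) : Prop :=
  ∃ (c : RAM.Prog) (prec coins time : Polynomial ℕ),
    ∀ (P : Inst r K ξ q τ) (ε : ℝ), 0 < ε →
    ∀ p, prec.eval (P.N + ⌈1 / ε⌉₊) ≤ p → ∀ d : Desc P p,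
      ∃ f : (Fin (coins.eval (P.N + ⌈1 / ε⌉₊ + p)) → Fin 2) → Cfg P.N,
        (∀ ω, ∃ m', RAM.RunsIn c (inputMem ⌈1 / ε⌉₊ d (coinArray ω) 0)
            (time.eval (P.N + ⌈1 / ε⌉₊ + p)) m' ∧ outCfg P.N m' = f ω) ∧
        tvDist (coinDist f) P.dist < ε

/-- Strong simulation is easy, for probabilities: one deterministic program computes all marginal
and all conditional probabilities of a distribution that is `ε`-close in total variation to that
of the evolved state. -/
def ProbabilitiesEasy (r : ℕ) (K ξ q : ℝ) (τ : ℕ → ℝ) : Prop :=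
  ∃ (c : RAM.Prog) (prec time : Polynomial ℕ),
    ∀ (P : Inst r K ξ q τ) (ε : ℝ), 0 < ε →
    ∀ p, prec.eval (P.N + ⌈1 / ε⌉₊) ≤ p → ∀ d : Desc P p,
      ∃ D : Cfg P.N → ℝ, IsDist D ∧ tvDist D P.dist < ε ∧
        ∀ a b : Fin P.N → Option (Fin 2),
          ∃ m', RAM.RunsIn c (inputMem ⌈1 / ε⌉₊ d (queryArray a) (queryArray b))
              (time.eval (P.N + ⌈1 / ε⌉₊ + p)) m' ∧
            (marginal D a ≠ 0 → OutFraction m' (conditional D a b))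

/-- Strong simulation is easy, for observables: one deterministic program computes the expectation
value, in the evolved state, of any product of single-site observables of norm at most `1`, up to
`ε`. The entries of the observables are given to the same precision as the instance. -/
def ObservablesEasy (r : ℕ) (K ξ q : ℝ) (τ : ℕ → ℝ) : Prop :=
  ∃ (c : RAM.Prog) (prec time : Polynomial ℕ),
    ∀ (P : Inst r K ξ q τ) (ε : ℝ), 0 < ε →
    ∀ p, prec.eval (P.N + ⌈1 / ε⌉₊) ≤ p → ∀ d : Desc P p,
    ∀ O : Fin P.N → Matrix (Fin 2) (Fin 2) ℂ,
      (∀ i, (O i).IsHermitian ∧ opNorm (O i) ≤ 1) →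
    ∀ re im : Fin P.N → Fin 2 → Fin 2 → ℤ,
      (∀ i u v, Approx p (re i u v) (O i u v).re ∧ Approx p (im i u v) (O i u v).im) →
      ∃ (m' : RAM.Mem) (y : ℝ),
        RAM.RunsIn c (inputMem ⌈1 / ε⌉₊ d (matArray re) (matArray im))
          (time.eval (P.N + ⌈1 / ε⌉₊ + p)) m' ∧
        OutFraction m' y ∧ ‖(y : ℂ) - P.expectation O‖ < ε

end SpinChain

end

open scoped Matrix

noncomputable section

section

namespace SpinChain

open NormedSpace

section LiebRobinson

variable {𝒜 : Type*} [CStarAlgebra 𝒜]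

theorem norm_exp_skewAdjoint_le (X : 𝒜) (hX : star X = -X) : ‖exp X‖ ≤ 1 := by
  let _ : NormedAlgebra ℚ 𝒜 := NormedAlgebra.restrictScalars ℚ ℝ 𝒜
  rcases subsingleton_or_nontrivial 𝒜 with h | h
  · rw [Subsingleton.elim (exp X) 0]; simp
  · exact (CStarRing.norm_of_mem_unitary
      (exp_mem_unitary_of_mem_skewAdjoint (skewAdjoint.mem_iff.2 hX))).le

theorem norm_exp_smul_skewAdjoint_le (X : 𝒜) (hX : star X = -X) (s : ℝ) : ‖exp (s • X)‖ ≤ 1 :=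
  norm_exp_skewAdjoint_le _ (by rw [star_smul, hX]; simp)

theorem exp_smul_mul_exp_smul_neg (X : 𝒜) (s : ℝ) : exp (s • X) * exp (s • -X) = 1 := by
  let _ : NormedAlgebra ℚ 𝒜 := NormedAlgebra.restrictScalars ℚ ℝ 𝒜
  rw [← exp_add_of_commute, smul_neg, add_neg_cancel, exp_zero]
  exact ((Commute.refl X).neg_right.smul_left s).smul_right s

theorem exp_smul_neg_mul_exp_smul (X : 𝒜) (s : ℝ) : exp (s • -X) * exp (s • X) = 1 := by
  simpa using exp_smul_mul_exp_smul_neg (-X) s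

/-- Conjugation of `A` with `exp (s C)`. -/
def evolve (C : 𝒜) (s : ℝ) (A : 𝒜) : 𝒜 := exp (s • C) * A * exp (s • -C)

theorem norm_evolve_le (C : 𝒜) (hC : star C = -C) (s : ℝ) (A : 𝒜) : ‖evolve C s A‖ ≤ ‖A‖ := by
  have h1 := norm_exp_smul_skewAdjoint_le C hC s
  have h2 := norm_exp_smul_skewAdjoint_le (-C) (by rw [star_neg, hC]) s
  calc _ ≤ ‖exp (s • C) * A‖ * ‖exp (s • -C)‖ := norm_mul_le _ _
    _ ≤ (‖exp (s • C)‖ * ‖A‖) * ‖exp (s • -C)‖ := by gcongr; exact norm_mul_le _ _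
    _ ≤ (1 * ‖A‖) * 1 := by gcongr
    _ = _ := by ring

theorem commute_exp_smul {S C : 𝒜} (h : Commute S C) (s : ℝ) : Commute S (exp (s • C)) := by
  let _ : NormedAlgebra ℚ 𝒜 := NormedAlgebra.restrictScalars ℚ ℝ 𝒜
  exact (h.smul_right s).exp_right

theorem commute_evolve {S C A : 𝒜} (hC : Commute S C) (hA : Commute S A) (s : ℝ) :
    Commute S (evolve C s A) :=
  ((commute_exp_smul hC s).mul_right hA).mul_right (commute_exp_smul hC.neg_right s)

theorem hasDerivAt_exp_smul_const_real (X : 𝒜) (s : ℝ) :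
    HasDerivAt (fun u : ℝ => exp (u • X)) (exp (s • X) * X) s := hasDerivAt_exp_smul_const X s

theorem hasDerivAt_exp_smul_const_real' (X : 𝒜) (s : ℝ) :
    HasDerivAt (fun u : ℝ => exp (u • X)) (X * exp (s • X)) s := hasDerivAt_exp_smul_const' X s

theorem norm_evolve_sub_evolve_le {C C' A : 𝒜} (hC' : star C' = -C')
    {B B' : ℝ → ℝ} (hB0 : 0 ≤ B 0) (hB : ∀ x, HasDerivAt B (B' x) x)
    (bound : ∀ x ∈ Set.Ico (0 : ℝ) 1,
      ‖(C - C') * evolve C x A - evolve C x A * (C - C')‖ ≤ B' x)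
    {s : ℝ} (hs : s ∈ Set.Icc (0 : ℝ) 1) : ‖evolve C s A - evolve C' s A‖ ≤ B s := by
  set Y : ℝ → 𝒜 := fun s => exp (s • -C') * evolve C s A * exp (s • C') - A with hY
  have hd : ∀ s, HasDerivAt Y (exp (s • -C') *
      ((C - C') * evolve C s A - evolve C s A * (C - C')) * exp (s • C')) s := by
    intro s
    have h1 := (((hasDerivAt_exp_smul_const_real' C s).mul_const A).mul
      (hasDerivAt_exp_smul_const_real (-C) s))
    have h2 := (((hasDerivAt_exp_smul_const_real (-C') s).mul h1).mul
      (hasDerivAt_exp_smul_const_real' C' s)).sub_const A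
    refine h2.congr_deriv ?_
    simp only [evolve, Pi.mul_apply]
    noncomm_ring
  have key := image_norm_le_of_norm_deriv_right_le_deriv_boundary (f := Y) (a := 0) (b := 1)
    (fun x _ => (hd x).continuousAt.continuousWithinAt) (fun x _ => (hd x).hasDerivWithinAt)
    (B := B) (B' := B') (by simpa [hY, evolve] using hB0) hB (fun x hx => by
      have h1 := norm_exp_smul_skewAdjoint_le C' hC' x
      have h2 := norm_exp_smul_skewAdjoint_le (-C') (by rw [star_neg, hC']) x
      refine le_trans ?_ (bound x hx)
      set Z := (C - C') * evolve C x A - evolve C x A * (C - C')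
      calc _ ≤ ‖exp (x • -C') * Z‖ * ‖exp (x • C')‖ := norm_mul_le _ _
        _ ≤ (‖exp (x • -C')‖ * ‖Z‖) * ‖exp (x • C')‖ := by gcongr; exact norm_mul_le _ _
        _ ≤ (1 * ‖Z‖) * 1 := by gcongr
        _ = _ := by ring) hs
  refine le_trans ?_ key
  have : evolve C s A - evolve C' s A = evolve C' s (Y s) := by
    have e1 := exp_smul_mul_exp_smul_neg C' s
    simp only [hY, evolve, mul_sub, sub_mul]
    rw [show exp (s • C') * (exp (s • -C') * (exp (s • C) * A * exp (s • -C)) * exp (s • C')) *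
      exp (s • -C') = (exp (s • C') * exp (s • -C')) * (exp (s • C) * A * exp (s • -C)) *
        (exp (s • C') * exp (s • -C')) by noncomm_ring, e1]
    simp
  rw [this]
  exact norm_evolve_le _ hC' _ _

/-- Lieb–Robinson bound for an increasing sequence of generators: if `C (i + 1) - C i` commutes with
`A` and with `C (i - 1)`, then the dynamics of `A` generated by `C i` converges superexponentially
fast. -/
theorem norm_evolve_succ_sub_le {C : ℕ → 𝒜} {A : 𝒜} {S : ℝ} (hC : ∀ i, star (C i) = -C i)
    (hS : ∀ i, ‖C (i + 1) - C i‖ ≤ S)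
    (hA : ∀ i, 1 ≤ i → Commute (C (i + 1) - C i) A)
    (hCC : ∀ i, Commute (C (i + 2) - C (i + 1)) (C i)) (i : ℕ) {s : ℝ}
    (hs : s ∈ Set.Icc (0 : ℝ) 1) :
    ‖evolve (C (i + 1)) s A - evolve (C i) s A‖ ≤ 2 * ‖A‖ * ((2 * S * s) ^ i / i.factorial) := by
  induction i generalizing s with
  | zero =>
    refine (norm_sub_le _ _).trans ?_
    have h1 := norm_evolve_le (C 1) (hC 1) s A
    have h2 := norm_evolve_le (C 0) (hC 0) s A
    simp; linarith
  | succ i ih =>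
    rw [← norm_neg, neg_sub]
    refine norm_evolve_sub_evolve_le (hC _)
      (B := fun s => 2 * ‖A‖ * ((2 * S * s) ^ (i + 1) / (i + 1).factorial))
      (B' := fun s => 2 * S * (2 * ‖A‖ * ((2 * S * s) ^ i / i.factorial))) (by simp) ?_ ?_ hs
    · intro x
      have h := ((((hasDerivAt_id x).const_mul (2 * S)).pow (i + 1)).div_const
        ((i + 1).factorial : ℝ)).const_mul (2 * ‖A‖)
      refine h.congr_deriv ?_
      rw [Nat.factorial_succ]
      have : (i.factorial : ℝ) ≠ 0 := by positivity
      push_cast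
      simp
      field_simp
    · intro x hx
      have hx' : x ∈ Set.Icc (0 : ℝ) 1 := ⟨hx.1, hx.2.le⟩
      set D := C (i + 2) - C (i + 1) with hD
      have hc : Commute D (evolve (C i) x A) :=
        commute_evolve (hCC i) (hA (i + 1) (by omega)) x
      have e : (C (i + 1) - C (i + 2)) * evolve (C (i + 1)) x A
          - evolve (C (i + 1)) x A * (C (i + 1) - C (i + 2))
          = (evolve (C (i + 1)) x A - evolve (C i) x A) * D
            - D * (evolve (C (i + 1)) x A - evolve (C i) x A) := by
        rw [show C (i + 1) - C (i + 2) = -D by simp [hD]]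
        have := hc.eq
        simp only [sub_mul, mul_sub, this]
        noncomm_ring
      rw [e]
      set E := evolve (C (i + 1)) x A - evolve (C i) x A
      have hE := ih hx'
      have hDn : ‖D‖ ≤ S := hS (i + 1)
      calc _ ≤ ‖E * D‖ + ‖D * E‖ := norm_sub_le _ _
        _ ≤ ‖E‖ * ‖D‖ + ‖D‖ * ‖E‖ := add_le_add (norm_mul_le _ _) (norm_mul_le _ _)
        _ = 2 * ‖D‖ * ‖E‖ := by ring
        _ ≤ 2 * S * (2 * ‖A‖ * ((2 * S * x) ^ i / i.factorial)) :=
            mul_le_mul (by gcongr) hE (norm_nonneg _)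
              (mul_nonneg two_pos.le ((norm_nonneg _).trans hDn))

theorem sum_pow_div_factorial_le {x : ℝ} (hx : 0 ≤ x) (q n : ℕ) :
    ∑ i ∈ Finset.Ico q n, x ^ i / i.factorial ≤ Real.exp (Real.exp 1 * x - q) := by
  rw [Real.exp_sub, le_div_iff₀ (Real.exp_pos _), Finset.sum_mul]
  calc ∑ i ∈ Finset.Ico q n, x ^ i / i.factorial * Real.exp q
      ≤ ∑ i ∈ Finset.Ico q n, (Real.exp 1 * x) ^ i / i.factorial := by
        refine Finset.sum_le_sum fun i hi => ?_
        have : Real.exp q ≤ Real.exp 1 ^ i := by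
          rw [← Real.exp_nat_mul]
          exact Real.exp_le_exp.2 (by simpa using (Finset.mem_Ico.1 hi).1)
        rw [mul_pow, div_mul_eq_mul_div]
        rw [mul_comm]
        gcongr
    _ ≤ ∑ i ∈ Finset.range n, (Real.exp 1 * x) ^ i / i.factorial := by
        refine Finset.sum_le_sum_of_subset_of_nonneg ?_ (fun i _ _ => by positivity)
        intro i hi; simp at hi ⊢; omega
    _ ≤ _ := Real.sum_le_exp_of_nonneg (by positivity) n

theorem norm_evolve_sub_le {C : ℕ → 𝒜} {A : 𝒜} {S : ℝ} (hC : ∀ i, star (C i) = -C i)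
    (hS : ∀ i, ‖C (i + 1) - C i‖ ≤ S)
    (hA : ∀ i, 1 ≤ i → Commute (C (i + 1) - C i) A)
    (hCC : ∀ i, Commute (C (i + 2) - C (i + 1)) (C i)) {q n : ℕ} (hqn : q ≤ n) {s : ℝ}
    (hs : s ∈ Set.Icc (0 : ℝ) 1) :
    ‖evolve (C n) s A - evolve (C q) s A‖
      ≤ 2 * ‖A‖ * Real.exp (Real.exp 1 * (2 * S) - q) := by
  have hS0 : 0 ≤ S := (norm_nonneg _).trans (hS 0)
  have h : evolve (C n) s A - evolve (C q) s A
      = ∑ i ∈ Finset.Ico q n, (evolve (C (i + 1)) s A - evolve (C i) s A) :=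
    (Finset.sum_Ico_sub (fun i => evolve (C i) s A) hqn).symm
  rw [h]
  calc _ ≤ ∑ i ∈ Finset.Ico q n, 2 * ‖A‖ * ((2 * S) ^ i / i.factorial) := by
        refine norm_sum_le_of_le _ fun i _ => (norm_evolve_succ_sub_le hC hS hA hCC i hs).trans ?_
        have : 2 * S * s ≤ 2 * S := mul_le_of_le_one_right (by positivity) hs.2
        have h0 : 0 ≤ 2 * S * s := mul_nonneg (by positivity) hs.1
        gcongr
    _ ≤ _ := by
        rw [← Finset.mul_sum]
        gcongr
        exact sum_pow_div_factorial_le (by positivity) q n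

/-- The interaction picture propagator depends continuously on the free dynamics of the
interaction. -/
theorem norm_exp_mul_exp_sub_le {C C' A : 𝒜} (hC : star C = -C) (hC' : star C' = -C')
    (hA : star A = -A) {δ : ℝ}
    (h : ∀ s ∈ Set.Icc (0 : ℝ) 1, ‖evolve C s A - evolve C' s A‖ ≤ δ) :
    ‖exp C * exp (-(C + A)) - exp C' * exp (-(C' + A))‖ ≤ δ := by
  have hCA : star (C + A) = -(C + A) := by rw [star_add, hC, hA]; abel
  have hCA' : star (C' + A) = -(C' + A) := by rw [star_add, hC', hA]; abel
  have hneg : ∀ X : 𝒜, star X = -X → star (-X) = -(-X) := fun X hX => by rw [star_neg, hX]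
  set Z : ℝ → 𝒜 := fun s =>
    exp (s • (C' + A)) * exp (s • -C') * (exp (s • C) * exp (s • -(C + A))) with hZ
  have hd : ∀ s, HasDerivAt Z (exp (s • (C' + A)) * exp (s • -C') *
      (evolve C' s A - evolve C s A) * exp (s • C) * exp (s • -(C + A))) s := by
    intro s
    have h2 := ((hasDerivAt_exp_smul_const_real (C' + A) s).mul
      (hasDerivAt_exp_smul_const_real' (-C') s)).mul
      ((hasDerivAt_exp_smul_const_real C s).mul (hasDerivAt_exp_smul_const_real' (-(C + A)) s))
    refine h2.congr_deriv ?_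
    simp only [evolve]
    have e1 := exp_smul_neg_mul_exp_smul C' s
    have e2 := exp_smul_neg_mul_exp_smul C s
    rw [show exp (s • (C' + A)) * exp (s • -C') *
      (exp (s • C') * A * exp (s • -C') - exp (s • C) * A * exp (s • -C)) * exp (s • C) *
      exp (s • -(C + A)) = exp (s • (C' + A)) * (exp (s • -C') * exp (s • C')) * A * exp (s • -C') *
        exp (s • C) * exp (s • -(C + A)) - exp (s • (C' + A)) * exp (s • -C') * exp (s • C) * A *
        (exp (s • -C) * exp (s • C)) * exp (s • -(C + A)) by noncomm_ring, e1, e2]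
    simp only [Pi.mul_apply]
    noncomm_ring
  have key := norm_image_sub_le_of_norm_deriv_le_segment_01' (f := Z) (C := δ)
    (fun x _ => (hd x).hasDerivWithinAt) (fun x hx => by
      have h1 := norm_exp_smul_skewAdjoint_le (C' + A) hCA' x
      have h2 := norm_exp_smul_skewAdjoint_le (-C') (hneg _ hC') x
      have h3 := norm_exp_smul_skewAdjoint_le C hC x
      have h4 := norm_exp_smul_skewAdjoint_le (-(C + A)) (hneg _ hCA) x
      have h5 := h x ⟨hx.1, hx.2.le⟩
      rw [← norm_neg, neg_sub] at h5
      have h0 := (norm_nonneg _).trans h5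
      calc _ ≤ ‖exp (x • (C' + A))‖ * ‖exp (x • -C')‖ * ‖evolve C' x A - evolve C x A‖ *
              ‖exp (x • C)‖ * ‖exp (x • -(C + A))‖ := by
            refine (norm_mul_le _ _).trans ?_
            gcongr
            refine (norm_mul_le _ _).trans ?_
            gcongr
            refine (norm_mul_le _ _).trans ?_
            gcongr
            exact norm_mul_le _ _
        _ ≤ 1 * 1 * δ * 1 * 1 := by gcongr
        _ = δ := by ring)
  have hZ0 : Z 0 = 1 := by simp [hZ]
  have e : exp C * exp (-(C + A)) - exp C' * exp (-(C' + A))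
      = exp C' * exp (-(C' + A)) * (Z 1 - Z 0) := by
    have e1 := exp_smul_neg_mul_exp_smul (C' + A) 1
    have e2 := exp_smul_mul_exp_smul_neg C' 1
    rw [hZ0]
    simp only [hZ, one_smul] at *
    rw [mul_sub, mul_one, show exp C' * exp (-(C' + A)) * (exp (C' + A) * exp (-C') *
      (exp C * exp (-(C + A)))) = exp C' * (exp (-(C' + A)) * exp (C' + A)) * exp (-C') *
      (exp C * exp (-(C + A))) by noncomm_ring, e1, mul_one, e2, one_mul]
  rw [e]
  have h1 := norm_exp_skewAdjoint_le C' hC'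
  have h2 := norm_exp_skewAdjoint_le (-(C' + A)) (hneg _ hCA')
  calc _ ≤ ‖exp C'‖ * ‖exp (-(C' + A))‖ * ‖Z 1 - Z 0‖ := by
        refine (norm_mul_le _ _).trans ?_
        gcongr
        exact norm_mul_le _ _
    _ ≤ 1 * 1 * δ := by gcongr
    _ = δ := by ring

end LiebRobinson

end SpinChain

end

section

namespace SpinChain

open NormedSpace

section OrderedProducts

/-- The ordered product `f (n - 1) * ⋯ * f 1 * f 0`. -/
def oprod {R : Type*} [Monoid R] (f : ℕ → R) : ℕ → R
  | 0 => 1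
  | n + 1 => f n * oprod f n

variable {R : Type*} [Monoid R]

@[simp] theorem oprod_zero (f : ℕ → R) : oprod f 0 = 1 := rfl

theorem oprod_succ (f : ℕ → R) (n : ℕ) : oprod f (n + 1) = f n * oprod f n := rfl

theorem oprod_congr {f g : ℕ → R} {n : ℕ} (h : ∀ i < n, f i = g i) : oprod f n = oprod g n := by
  induction n with
  | zero => rfl
  | succ n ih => rw [oprod_succ, oprod_succ, h n (by omega), ih fun i hi => h i (by omega)]

theorem oprod_add (f : ℕ → R) (a b : ℕ) :
    oprod f (a + b) = oprod (fun j => f (a + j)) b * oprod f a := by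
  induction b with
  | zero => simp
  | succ b ih => rw [← add_assoc, oprod_succ, ih, oprod_succ, mul_assoc]

theorem oprod_mul (f : ℕ → R) (a b : ℕ) :
    oprod f (a * b) = oprod (fun i => oprod (fun j => f (i * b + j)) b) a := by
  induction a with
  | zero => simp
  | succ a ih => rw [Nat.succ_mul, oprod_add, ih, oprod_succ]

theorem oprod_const (x : R) (n : ℕ) : oprod (fun _ => x) n = x ^ n := by
  induction n with
  | zero => simp
  | succ n ih => rw [oprod_succ, ih, pow_succ']

theorem oprod_smul {𝒜 : Type*} [Ring 𝒜] [Algebra ℂ 𝒜] (z : ℂ) (f : ℕ → 𝒜) (n : ℕ) :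
    oprod (fun i => z • f i) n = z ^ n • oprod f n := by
  induction n with
  | zero => simp
  | succ n ih => rw [oprod_succ, oprod_succ, ih, smul_mul_smul_comm, pow_succ']

end OrderedProducts

section Approximation

variable {𝒜 : Type*} [NormedRing 𝒜] [NormOneClass 𝒜]

theorem norm_oprod_le_one {Y : ℕ → 𝒜} {n : ℕ} (hY : ∀ i < n, ‖Y i‖ ≤ 1) : ‖oprod Y n‖ ≤ 1 := by
  induction n with
  | zero => simp
  | succ n ih =>
    rw [oprod_succ]
    calc _ ≤ ‖Y n‖ * ‖oprod Y n‖ := norm_mul_le _ _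
      _ ≤ 1 * 1 := by
        gcongr
        · exact hY n (by omega)
        · exact ih fun i hi => hY i (by omega)
      _ = 1 := by ring

theorem norm_oprod_sub_oprod_le {X Y : ℕ → 𝒜} {δ : ℝ} {n : ℕ} (hY : ∀ i < n, ‖Y i‖ ≤ 1)
    (hXY : ∀ i < n, ‖X i - Y i‖ ≤ δ) : ‖oprod X n - oprod Y n‖ ≤ (1 + δ) ^ n - 1 := by
  induction n with
  | zero => simp
  | succ n ih =>
    have h1 := ih (fun i hi => hY i (by omega)) (fun i hi => hXY i (by omega))
    have h2 := hXY n (by omega)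
    have h3 : ‖oprod Y n‖ ≤ 1 := norm_oprod_le_one fun i hi => hY i (by omega)
    have h4 : ‖X n‖ ≤ 1 + δ := by
      calc ‖X n‖ = ‖Y n + (X n - Y n)‖ := by abel_nf
        _ ≤ 1 + δ := (norm_add_le _ _).trans (add_le_add (hY n (by omega)) h2)
    have hδ : 0 ≤ δ := (norm_nonneg _).trans h2
    rw [oprod_succ, oprod_succ, show X n * oprod X n - Y n * oprod Y n
      = X n * (oprod X n - oprod Y n) + (X n - Y n) * oprod Y n by noncomm_ring]
    calc _ ≤ ‖X n‖ * ‖oprod X n - oprod Y n‖ + ‖X n - Y n‖ * ‖oprod Y n‖ :=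
          (norm_add_le _ _).trans (add_le_add (norm_mul_le _ _) (norm_mul_le _ _))
      _ ≤ (1 + δ) * ((1 + δ) ^ n - 1) + δ * 1 := by gcongr
      _ = _ := by ring

theorem one_add_pow_sub_one_le {δ : ℝ} (hδ : 0 ≤ δ) (n : ℕ) (h : n * δ ≤ 1) :
    (1 + δ) ^ n - 1 ≤ 2 * (n * δ) := by
  have h1 : (1 + δ) ^ n ≤ Real.exp (n * δ) := by
    rw [Real.exp_nat_mul]
    gcongr
    linarith [Real.add_one_le_exp δ]
  have h0 : 0 ≤ n * δ := by positivity
  have h2 := Real.abs_exp_sub_one_le (x := n * δ) (by rwa [abs_of_nonneg h0])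
  rw [abs_of_nonneg h0] at h2
  linarith [le_abs_self (Real.exp (n * δ) - 1)]

omit [NormOneClass 𝒜] in
theorem norm_oprod_one_add_le (a : ℕ → 𝒜) (n : ℕ) :
    ‖oprod (fun i => 1 + a i) n - 1‖ ≤ Real.exp (∑ i ∈ Finset.range n, ‖a i‖) - 1 ∧
    ‖oprod (fun i => 1 + a i) n - 1 - ∑ i ∈ Finset.range n, a i‖
      ≤ Real.exp (∑ i ∈ Finset.range n, ‖a i‖) - 1 - ∑ i ∈ Finset.range n, ‖a i‖ := by
  induction n with
  | zero => simp
  | succ n ih =>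
    obtain ⟨h1, h2⟩ := ih
    rw [oprod_succ, Finset.sum_range_succ, Finset.sum_range_succ]
    set P := oprod (fun i => 1 + a i) n
    set σ := ∑ i ∈ Finset.range n, ‖a i‖
    have h3 : Real.exp σ * (1 + ‖a n‖) ≤ Real.exp (σ + ‖a n‖) := by
      rw [Real.exp_add]
      gcongr
      linarith [Real.add_one_le_exp ‖a n‖]
    constructor
    · calc ‖(1 + a n) * P - 1‖ = ‖(P - 1) + a n * (P - 1) + a n‖ := by congr 1; noncomm_ring
        _ ≤ ‖P - 1‖ + ‖a n‖ * ‖P - 1‖ + ‖a n‖ := by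
          refine (norm_add_le _ _).trans ?_
          gcongr
          refine (norm_add_le _ _).trans ?_
          gcongr
          exact norm_mul_le _ _
        _ ≤ (Real.exp σ - 1) + ‖a n‖ * (Real.exp σ - 1) + ‖a n‖ := by gcongr
        _ ≤ _ := by linarith
    · calc ‖(1 + a n) * P - 1 - (∑ i ∈ Finset.range n, a i + a n)‖
          = ‖(P - 1 - ∑ i ∈ Finset.range n, a i) + a n * (P - 1)‖ := by congr 1; noncomm_ring
        _ ≤ (Real.exp σ - 1 - σ) + ‖a n‖ * (Real.exp σ - 1) := by
          refine (norm_add_le _ _).trans ?_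
          gcongr
          refine (norm_mul_le _ _).trans ?_
          gcongr
        _ ≤ _ := by linarith

theorem norm_exp_sub_one_sub_le [NormedAlgebra ℝ 𝒜] [CompleteSpace 𝒜] (Y : 𝒜) :
    ‖exp Y - 1 - Y‖ ≤ Real.exp ‖Y‖ - 1 - ‖Y‖ := by
  have h1 := (exp_series_hasSum_exp' (𝕂 := ℝ) Y)
  have h2 := (exp_series_hasSum_exp' (𝕂 := ℝ) ‖Y‖)
  rw [← Real.exp_eq_exp_ℝ] at h2
  have h1' := (hasSum_nat_add_iff' 2).2 h1
  have h2' := (hasSum_nat_add_iff' 2).2 h2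
  simp only [Finset.sum_range_succ, Finset.sum_range_zero, Nat.factorial, pow_zero, pow_one, zero_add,
    Nat.cast_one, inv_one, one_smul, mul_one] at h1' h2'
  rw [sub_add_eq_sub_sub] at h1' h2'
  rw [← h1'.tsum_eq, ← h2'.tsum_eq]
  refine tsum_of_norm_bounded h2'.summable.hasSum fun i => ?_
  rw [norm_smul, smul_eq_mul, Real.norm_of_nonneg (by positivity)]
  gcongr
  exact norm_pow_le _ _

theorem norm_oprod_one_add_sub_exp_le [NormedAlgebra ℝ 𝒜] [CompleteSpace 𝒜] {a : ℕ → 𝒜} {n : ℕ}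
    {Y : 𝒜} {σ η : ℝ} (hσ : σ ≤ 1) (ha : ∑ i ∈ Finset.range n, ‖a i‖ ≤ σ) (hY : ‖Y‖ ≤ σ)
    (h : ‖∑ i ∈ Finset.range n, a i - Y‖ ≤ η) :
    ‖oprod (fun i => 1 + a i) n - exp Y‖ ≤ 2 * σ ^ 2 + η := by
  have key : ∀ x : ℝ, 0 ≤ x → x ≤ σ → Real.exp x - 1 - x ≤ σ ^ 2 := by
    intro x h0 hx
    have := Real.abs_exp_sub_one_sub_id_le (x := x) (by rw [abs_of_nonneg h0]; linarith)
    have h2 := le_abs_self (Real.exp x - 1 - x)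
    nlinarith
  have h1 := (norm_oprod_one_add_le a n).2.trans (key _ (by positivity) ha)
  have h2 := (norm_exp_sub_one_sub_le Y).trans (key _ (by positivity) hY)
  calc _ = ‖(oprod (fun i => 1 + a i) n - 1 - ∑ i ∈ Finset.range n, a i) - (exp Y - 1 - Y)
        + (∑ i ∈ Finset.range n, a i - Y)‖ := by congr 1; abel
    _ ≤ (σ ^ 2 + σ ^ 2) + η :=
      (norm_add_le _ _).trans (add_le_add ((norm_sub_le _ _).trans (add_le_add h1 h2)) h)
    _ = _ := by ring

end Approximation

end SpinChain

end

section

namespace SpinChain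

open NormedSpace
open scoped Matrix.Norms.L2Operator

section SiteTensor

variable {N : ℕ}

theorem siteTensor_apply (A : Fin N → Matrix (Fin 2) (Fin 2) ℂ) (s s' : Cfg N) :
    siteTensor A s s' = ∏ i, A i (s i) (s' i) := rfl

theorem siteTensor_mul (A B : Fin N → Matrix (Fin 2) (Fin 2) ℂ) :
    siteTensor A * siteTensor B = siteTensor fun i => A i * B i := by
  ext s s'
  simp only [Matrix.mul_apply, siteTensor_apply, ← Finset.prod_mul_distrib]
  rw [Finset.prod_univ_sum, Fintype.piFinset_univ]

theorem siteTensor_one : siteTensor (fun _ : Fin N => (1 : Matrix (Fin 2) (Fin 2) ℂ)) = 1 := by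
  ext s s'
  rw [siteTensor_apply, Matrix.one_apply]
  split_ifs with h
  · subst h
    exact Finset.prod_eq_one fun i _ => Matrix.one_apply_eq _
  · obtain ⟨i, hi⟩ := Function.ne_iff.1 h
    exact Finset.prod_eq_zero (Finset.mem_univ i) (Matrix.one_apply_ne hi)

theorem star_siteTensor (A : Fin N → Matrix (Fin 2) (Fin 2) ℂ) :
    star (siteTensor A) = siteTensor fun i => star (A i) := by
  ext s s'
  simp [siteTensor_apply, Matrix.star_apply]

theorem norm_siteTensor_le_one_of_mul_self {A : Fin N → Matrix (Fin 2) (Fin 2) ℂ}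
    (h1 : ∀ i, star (A i) = A i) (h2 : ∀ i, A i * A i = 1) : ‖siteTensor A‖ ≤ 1 := by
  have hs : star (siteTensor A) = siteTensor A := by
    rw [star_siteTensor]; congr 1; exact funext h1
  have hm : siteTensor A * siteTensor A = 1 := by
    rw [siteTensor_mul, ← siteTensor_one]; congr 1; exact funext h2
  have : siteTensor A ∈ unitary (Op N) := by
    rw [Unitary.mem_iff, hs]; exact ⟨hm, hm⟩
  exact (CStarRing.norm_of_mem_unitary this).le

/-- The operator `X` on site `i`, as a `*`-homomorphism. -/
def onSite (i : Fin N) : Matrix (Fin 2) (Fin 2) ℂ →⋆ₐ[ℂ] Op N where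
  toFun X := siteTensor fun l => if l = i then X else 1
  map_one' := by simp only [ite_self]; exact siteTensor_one
  map_mul' X Y := by
    rw [siteTensor_mul]; congr 1; funext l; split_ifs <;> simp
  map_zero' := by
    ext s s'
    exact Finset.prod_eq_zero (Finset.mem_univ i) (by simp)
  map_add' X Y := by
    ext s s'
    simp only [siteTensor_apply, Matrix.add_apply]
    rw [← Finset.mul_prod_erase _ _ (Finset.mem_univ i), ← Finset.mul_prod_erase _ _ (Finset.mem_univ i),
      ← Finset.mul_prod_erase _ _ (Finset.mem_univ i)]
    simp only [if_true, Matrix.add_apply, add_mul]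
    have : ∀ Z : Matrix (Fin 2) (Fin 2) ℂ, ∏ x ∈ Finset.univ.erase i,
        (if x = i then Z else 1) (s x) (s' x) = ∏ x ∈ Finset.univ.erase i,
        (1 : Matrix (Fin 2) (Fin 2) ℂ) (s x) (s' x) := fun Z =>
      Finset.prod_congr rfl fun x hx => by rw [if_neg (Finset.ne_of_mem_erase hx)]
    simp only [this]
  commutes' z := by
    ext s s'
    rw [Matrix.algebraMap_eq_diagonal, Matrix.algebraMap_eq_diagonal]
    simp only [siteTensor_apply]
    rw [← Finset.mul_prod_erase _ _ (Finset.mem_univ i)]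
    by_cases h : s = s'
    · subst h
      simp only [if_true, Matrix.diagonal_apply_eq, Pi.algebraMap_apply]
      rw [Finset.prod_eq_one fun x hx => by rw [if_neg (Finset.ne_of_mem_erase hx)]; simp]
      simp
    · rw [Matrix.diagonal_apply_ne _ h]
      obtain ⟨j, hj⟩ := Function.ne_iff.1 h
      by_cases hji : j = i
      · subst hji; simp [Matrix.diagonal_apply_ne _ hj]
      · rw [Finset.prod_eq_zero (i := j) (by simp [hji]) (by simp [hji, hj])]; simp
  map_star' X := by
    rw [star_siteTensor]; congr 1; funext l; split_ifs <;> simp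

theorem norm_onSite_le (i : Fin N) (X : Matrix (Fin 2) (Fin 2) ℂ) : ‖onSite i X‖ ≤ ‖X‖ :=
  NonUnitalStarAlgHom.norm_apply_le (onSite i) X

theorem norm_siteTensor_le_one {A : Fin N → Matrix (Fin 2) (Fin 2) ℂ} (h : ∀ i, ‖A i‖ ≤ 1) :
    ‖siteTensor A‖ ≤ 1 := by
  have key : ∀ S : Finset (Fin N), ‖siteTensor fun i => if i ∈ S then A i else 1‖ ≤ 1 := by
    intro S
    induction S using Finset.induction_on with
    | empty => simp [siteTensor_one]
    | insert i S hi ih =>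
      have e : (siteTensor fun l => if l ∈ insert i S then A l else 1)
          = onSite i (A i) * siteTensor fun l => if l ∈ S then A l else 1 := by
        change _ = (siteTensor fun l => if l = i then A i else 1) * _
        rw [siteTensor_mul]
        congr 1; funext l
        by_cases hl : l = i
        · subst hl; simp [hi]
        · simp [hl]
      rw [e]
      calc _ ≤ ‖onSite i (A i)‖ * ‖siteTensor fun l => if l ∈ S then A l else 1‖ := norm_mul_le _ _
        _ ≤ 1 * 1 := by
          gcongr
          exact (norm_onSite_le _ _).trans (h i)
        _ = 1 := by ring
  simpa using key Finset.univ

end SiteTensor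

section LocalTerms

variable {N : ℕ}

/-- The letter on site `i` of the Pauli word with index `α` (its base `4` digits) at position `k`. -/
def letterAt (r k α i : ℕ) : Fin 4 :=
  if k ≤ i ∧ i - k < r then ⟨α / 4 ^ (i - k) % 4, Nat.mod_lt _ (by norm_num)⟩ else 0

/-- The Pauli word with index `α` at position `k`, truncated to the chain. -/
def pauliWord (N r k α : ℕ) : Op N := siteTensor fun i => pauli (letterAt r k α i)

theorem star_pauli (a : Fin 4) : star (pauli a) = pauli a := by
  rw [Matrix.star_eq_conjTranspose]
  fin_cases a <;> ext i j <;> fin_cases i <;> fin_cases j <;> simp [pauli]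

theorem pauli_mul_self (a : Fin 4) : pauli a * pauli a = 1 := by
  fin_cases a <;> ext i j <;> fin_cases i <;> fin_cases j <;>
    simp [pauli, Matrix.mul_apply, Fin.sum_univ_two]

theorem norm_pauliWord_le (r k α : ℕ) : ‖pauliWord N r k α‖ ≤ 1 :=
  norm_siteTensor_le_one_of_mul_self (fun _ => star_pauli _) (fun _ => pauli_mul_self _)

theorem star_pauliWord (r k α : ℕ) : star (pauliWord N r k α) = pauliWord N r k α := by
  rw [pauliWord, star_siteTensor]; congr 1; funext i; exact star_pauli _

theorem commute_pauliWord {r k k' : ℕ} (h : k + r ≤ k') (α β : ℕ) :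
    Commute (pauliWord N r k α) (pauliWord N r k' β) := by
  rw [Commute, SemiconjBy, pauliWord, pauliWord, siteTensor_mul, siteTensor_mul]
  congr 1; funext i
  have : letterAt r k α i = 0 ∨ letterAt r k' β i = 0 := by
    unfold letterAt
    split_ifs with h1 h2
    · omega
    all_goals simp
  have h0 : pauli 0 = 1 := rfl
  rcases this with h | h <;> simp [h, h0]

/-- `i` times the sum over `α` of the terms at position `k`. -/
def localGen (N r : ℕ) (c : ℕ → ℕ → ℝ) (k : ℕ) : Op N :=
  ∑ α ∈ Finset.range (4 ^ r), ((c k α : ℂ) * Complex.I) • pauliWord N r k α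

/-- `i` times the sum of all terms at the positions `a, …, b - 1`. -/
def gen (N r : ℕ) (c : ℕ → ℕ → ℝ) (a b : ℕ) : Op N := ∑ k ∈ Finset.Ico a b, localGen N r c k

theorem star_localGen (r : ℕ) (c : ℕ → ℕ → ℝ) (k : ℕ) :
    star (localGen N r c k) = -localGen N r c k := by
  simp [localGen, star_sum, star_smul, star_pauliWord, ← Finset.sum_neg_distrib]

theorem star_gen (r : ℕ) (c : ℕ → ℕ → ℝ) (a b : ℕ) :
    star (gen N r c a b) = -gen N r c a b := by
  simp [gen, star_sum, star_localGen, ← Finset.sum_neg_distrib]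

theorem norm_localGen_le {r : ℕ} {c : ℕ → ℕ → ℝ} {κ : ℝ} (hc : ∀ k α, |c k α| ≤ κ) (k : ℕ) :
    ‖localGen N r c k‖ ≤ 4 ^ r * κ := by
  refine (norm_sum_le_of_le (Finset.range (4 ^ r)) (f := fun α => ((c k α : ℂ) * Complex.I) • pauliWord N r k α)
    (n := fun _ => κ) fun α _ => ?_).trans (by simp)
  rw [norm_smul]
  calc _ ≤ κ * 1 := by
        gcongr
        · exact (abs_nonneg _).trans (hc k α)
        · simpa using hc k α
        · exact norm_pauliWord_le _ _ _
    _ = κ := by ring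

theorem norm_gen_le {r : ℕ} {c : ℕ → ℕ → ℝ} {κ : ℝ} (hc : ∀ k α, |c k α| ≤ κ) (a b : ℕ) :
    ‖gen N r c a b‖ ≤ (b - a : ℕ) * (4 ^ r * κ) := by
  refine (norm_sum_le_of_le (Finset.Ico a b) (n := fun _ => 4 ^ r * κ) fun k _ =>
    norm_localGen_le hc k).trans (by simp)

theorem commute_localGen {r k k' : ℕ} (c : ℕ → ℕ → ℝ) (h : k + r ≤ k') :
    Commute (localGen N r c k') (localGen N r c k) :=
  Commute.sum_left _ _ _ fun _ _ => Commute.sum_right _ _ _ fun _ _ =>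
    ((commute_pauliWord h _ _).symm.smul_left _).smul_right _

theorem commute_gen {r a b a' b' : ℕ} (c : ℕ → ℕ → ℝ) (h : b + r ≤ a' + 1) :
    Commute (gen N r c a' b') (gen N r c a b) :=
  Commute.sum_left _ _ _ fun k' hk' => Commute.sum_right _ _ _ fun k hk =>
    commute_localGen c (by rw [Finset.mem_Ico] at hk hk'; omega)

theorem gen_add_gen (r : ℕ) (c : ℕ → ℕ → ℝ) {a b d : ℕ} (h : a ≤ b) (h' : b ≤ d) :
    gen N r c a b + gen N r c b d = gen N r c a d :=
  Finset.sum_Ico_consecutive _ h h'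

theorem gen_succ_self (r : ℕ) (c : ℕ → ℕ → ℝ) (k : ℕ) : gen N r c k (k + 1) = localGen N r c k := by
  simp [gen]

theorem gen_eq_of_le {r : ℕ} {c : ℕ → ℕ → ℝ} (hc : ∀ k α, N ≤ k → c k α = 0) {a b : ℕ} (hb : N ≤ b)
    (ha : a ≤ N) : gen N r c a b = gen N r c a N := by
  rw [← gen_add_gen r c ha hb]
  refine add_eq_left.2 (Finset.sum_eq_zero fun k hk => Finset.sum_eq_zero fun α _ => ?_)
  simp [hc k α (Finset.mem_Ico.1 hk).1]

theorem exp_mul_exp_neg (X : Op N) : exp X * exp (-X) = 1 := by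
  simpa using exp_smul_mul_exp_smul_neg X 1

theorem exp_neg_mul_exp (X : Op N) : exp (-X) * exp X = 1 := by
  simpa using exp_smul_neg_mul_exp_smul X 1

theorem exp_gen_eq_oprod (r : ℕ) (c : ℕ → ℕ → ℝ) :
    exp (-gen N r c 0 N)
      = oprod (fun k => exp (gen N r c (k + 1) N) * exp (-gen N r c k N)) N := by
  have : ∀ k, oprod (fun k => exp (gen N r c (k + 1) N) * exp (-gen N r c k N)) k
      = exp (gen N r c k N) * exp (-gen N r c 0 N) := by
    intro k
    induction k with
    | zero => rw [exp_mul_exp_neg]; rfl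
    | succ k ih =>
      rw [oprod_succ, ih, mul_assoc, ← mul_assoc (exp (-gen N r c k N)), exp_neg_mul_exp, one_mul]
  rw [this]
  simp [gen]

theorem norm_propagator_sub_le {r : ℕ} {c : ℕ → ℕ → ℝ} {κ : ℝ} (hc : ∀ k α, |c k α| ≤ κ)
    (hc0 : ∀ k α, N ≤ k → c k α = 0) {k : ℕ} (hk : k < N) (l : ℕ) :
    ‖exp (gen N r c (k + 1) N) * exp (-gen N r c k N)
      - exp (gen N r c (k + 1) (k + 1 + l)) * exp (-gen N r c k (k + 1 + l))‖
      ≤ 2 * (4 ^ r * κ) * Real.exp (Real.exp 1 * (2 * ((r + 1) * (4 ^ r * κ))) - (l / (r + 1) : ℕ)) := by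
  set A := localGen N r c k with hAdef
  have hAg : A = gen N r c k (k + 1) := (gen_succ_self r c k).symm
  set C : ℕ → Op N := fun i => gen N r c (k + 1) (k + 1 + l % (r + 1) + i * (r + 1)) with hCdef
  set q := l / (r + 1) with hq
  have hl : k + 1 + l % (r + 1) + q * (r + 1) = k + 1 + l := by
    rw [hq, add_assoc, Nat.mod_add_div' l (r + 1)]
  have hdiff : ∀ i, C (i + 1) - C i = gen N r c (k + 1 + l % (r + 1) + i * (r + 1))
      (k + 1 + l % (r + 1) + (i + 1) * (r + 1)) := by
    intro i
    rw [sub_eq_iff_eq_add', hCdef]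
    exact (gen_add_gen r c (by omega) (by nlinarith)).symm
  have hκ : 0 ≤ κ := (abs_nonneg _).trans (hc 0 0)
  have hqn : q ≤ N + q := by omega
  have key := fun s (hs : s ∈ Set.Icc (0 : ℝ) 1) => norm_evolve_sub_le (C := C) (A := A)
    (S := (r + 1) * (4 ^ r * κ))
    (fun i => star_gen r c _ _)
    (fun i => by
      rw [hdiff]
      refine (norm_gen_le hc _ _).trans (le_of_eq ?_)
      rw [show k + 1 + l % (r + 1) + (i + 1) * (r + 1) - (k + 1 + l % (r + 1) + i * (r + 1)) = r + 1 by
        rw [Nat.add_mul]; omega]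
      push_cast; ring)
    (fun i hi => by
      rw [hdiff, hAg]
      refine commute_gen c ?_
      nlinarith [Nat.zero_le (l % (r + 1))])
    (fun i => by
      rw [hdiff]
      exact commute_gen c (by rw [Nat.add_mul]; omega)) hqn hs
  have hCN : C (N + q) = gen N r c (k + 1) N := gen_eq_of_le hc0 (by nlinarith) (by omega)
  have hCq : C q = gen N r c (k + 1) (k + 1 + l) := by simp only [hCdef, hl]
  rw [hCN, hCq] at key
  have h1 := norm_exp_mul_exp_sub_le (star_gen r c _ _) (star_gen r c _ _) (star_localGen r c k) key
  have e : ∀ b, k + 1 ≤ b → gen N r c (k + 1) b + A = gen N r c k b := fun b hb => by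
    rw [add_comm, hAg]
    exact gen_add_gen r c (by omega) hb
  rw [e _ (by omega), e _ (by omega)] at h1
  refine h1.trans ?_
  gcongr
  exact norm_localGen_le hc k

end LocalTerms

end SpinChain

end

section

namespace SpinChain

section BitFlips

/-- Bit `i` of `x`. -/
def bitAt (x i : ℕ) : ℤ := ((x / 2 ^ i % 2 : ℕ) : ℤ)

/-- The change of a number when the bits `l + j` with `a j ∈ {1, 2}` are flipped. -/
def flipOffset (l : ℕ) (a : ℕ → ℕ) (r x : ℕ) : ℤ :=
  ∑ j ∈ Finset.range r,
    if a j = 1 ∨ a j = 2 then (1 - 2 * bitAt x (l + j)) * 2 ^ (l + j) else 0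

/-- The mask for the bits `l + j` with `a j ∈ {1, 2}`. -/
def flipMask (l : ℕ) (a : ℕ → ℕ) : ℕ → ℕ
  | 0 => 0
  | r + 1 => if a r = 1 ∨ a r = 2 then flipMask l a r ^^^ 2 ^ (l + r) else flipMask l a r

theorem cast_xor_two_pow (y i : ℕ) :
    ((y ^^^ 2 ^ i : ℕ) : ℤ) = y + (1 - 2 * bitAt y i) * 2 ^ i := by
  induction i generalizing y with
  | zero =>
    have h1 := Nat.xor_div_two (a := y) (b := 1)
    have h2 := Nat.xor_mod_two_eq (m := y) (n := 1)
    simp only [bitAt, pow_zero, Nat.div_one, mul_one]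
    norm_num at h1
    omega
  | succ i ih =>
    have h1 := Nat.xor_div_two (a := y) (b := 2 ^ (i + 1))
    have h2 := Nat.xor_mod_two_eq (m := y) (n := 2 ^ (i + 1))
    have h3 : (2 : ℕ) ^ (i + 1) / 2 = 2 ^ i := by rw [pow_succ]; simp
    have h4 : (2 : ℕ) ^ (i + 1) % 2 = 0 := by rw [pow_succ]; simp
    rw [h3] at h1
    have h5 := ih (y / 2)
    have h6 : bitAt (y / 2) i = bitAt y (i + 1) := by
      rw [bitAt, bitAt, Nat.div_div_eq_div_mul, pow_succ']
    rw [h6, ← h1] at h5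
    have h7 : (y + 2 ^ (i + 1)) % 2 = y % 2 := by omega
    rw [h7] at h2
    have h8 := Nat.div_add_mod (y ^^^ 2 ^ (i + 1)) 2
    rw [h2] at h8
    have h9 := Nat.div_add_mod y 2
    rw [← h8]
    push_cast
    push_cast at h5
    rw [h5, pow_succ']
    have : (y : ℤ) = 2 * (y / 2 : ℤ) + (y % 2 : ℤ) := by omega
    linear_combination -this

theorem flipMask_lt (l : ℕ) (a : ℕ → ℕ) (r : ℕ) : flipMask l a r < 2 ^ (l + r) := by
  induction r with
  | zero => simp [flipMask]
  | succ r ih =>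
    have h := ih.trans (Nat.pow_lt_pow_right one_lt_two (by omega : l + r < l + (r + 1)))
    unfold flipMask
    split_ifs
    · exact Nat.xor_lt_two_pow h (Nat.pow_lt_pow_right one_lt_two (by omega))
    · exact h

theorem bitAt_eq_testBit (x i : ℕ) : bitAt x i = if x.testBit i then 1 else 0 := by
  rw [bitAt, Nat.testBit_eq_decide_div_mod_eq]
  rcases Nat.mod_two_eq_zero_or_one (x / 2 ^ i) with h | h <;> simp [h]

theorem cast_xor_flipMask (l : ℕ) (a : ℕ → ℕ) (r x : ℕ) :
    ((x ^^^ flipMask l a r : ℕ) : ℤ) = x + flipOffset l a r x := by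
  induction r with
  | zero => simp [flipMask, flipOffset]
  | succ r ih =>
    rw [flipOffset, Finset.sum_range_succ, ← flipOffset, ← add_assoc, ← ih, flipMask]
    split_ifs
    · rw [← Nat.xor_assoc, cast_xor_two_pow]
      have : bitAt (x ^^^ flipMask l a r) (l + r) = bitAt x (l + r) := by
        rw [bitAt_eq_testBit, bitAt_eq_testBit, Nat.testBit_xor,
          Nat.testBit_lt_two_pow (flipMask_lt l a r), Bool.xor_false]
      rw [this]
    · simp

theorem toNat_add_flipOffset (l : ℕ) (a : ℕ → ℕ) (r x : ℕ) :
    ((x : ℤ) + flipOffset l a r x).toNat = x ^^^ flipMask l a r := by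
  rw [← cast_xor_flipMask, Int.toNat_natCast]

theorem xor_flipMask_lt {l : ℕ} {a : ℕ → ℕ} {r w x : ℕ} (h : l + r ≤ w) :
    x ^^^ flipMask l a r < 2 ^ w ↔ x < 2 ^ w := by
  have hm := (flipMask_lt l a r).trans_le (Nat.pow_le_pow_right two_pos h)
  refine ⟨fun hx => ?_, fun hx => Nat.xor_lt_two_pow hx hm⟩
  have := Nat.xor_lt_two_pow hx hm
  rwa [Nat.xor_assoc, Nat.xor_self, Nat.xor_zero] at this

end BitFlips

section PauliAction

variable {N : ℕ}

/-- The number whose binary digits are the outcomes on the sites from `k` on. -/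
def tailCode (k : ℕ) (s : Cfg N) : ℕ := ∑ i : Fin N, if k ≤ i.val then (s i).val * 2 ^ (i.val - k) else 0

theorem tailCode_of_le {k : ℕ} (h : N ≤ k) (s : Cfg N) : tailCode k s = 0 :=
  Finset.sum_eq_zero fun i _ => if_neg (by omega)

theorem tailCode_eq {k : ℕ} (h : k < N) (s : Cfg N) :
    tailCode k s = (s ⟨k, h⟩).val + 2 * tailCode (k + 1) s := by
  rw [tailCode, tailCode, ← Finset.add_sum_erase _ _ (Finset.mem_univ (⟨k, h⟩ : Fin N)),
    ← Finset.add_sum_erase (a := (⟨k, h⟩ : Fin N)) (h := Finset.mem_univ _)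
      (f := fun i : Fin N => if k + 1 ≤ i.val then (s i).val * 2 ^ (i.val - (k + 1)) else 0)]
  simp only [le_refl, if_true, Nat.sub_self, pow_zero, mul_one, Nat.not_succ_le_self, if_false,
    zero_add, Finset.mul_sum]
  congr 1
  refine Finset.sum_congr rfl fun i hi => ?_
  have hne : i.val ≠ k := fun h' => Finset.ne_of_mem_erase hi (Fin.ext h')
  by_cases hk : k + 1 ≤ i.val
  · rw [if_pos (by omega), if_pos hk, show i.val - k = i.val - (k + 1) + 1 by omega, pow_succ]
    ring
  · rw [if_neg (by omega), if_neg hk, mul_zero]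

theorem tailCode_div_two (k : ℕ) (s : Cfg N) : tailCode k s / 2 = tailCode (k + 1) s := by
  by_cases h : k < N
  · rw [tailCode_eq h]; have := (s ⟨k, h⟩).isLt; omega
  · rw [tailCode_of_le (by omega), tailCode_of_le (by omega)]

theorem tailCode_div_two_pow (k j : ℕ) (s : Cfg N) : tailCode k s / 2 ^ j = tailCode (k + j) s := by
  induction j with
  | zero => simp
  | succ j ih => rw [pow_succ, ← Nat.div_div_eq_div_mul, ih, tailCode_div_two, add_assoc]

theorem bitAt_tailCode {k j : ℕ} (h : k + j < N) (s : Cfg N) :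
    bitAt (tailCode k s) j = ((s ⟨k + j, h⟩).val : ℤ) := by
  rw [bitAt, tailCode_div_two_pow, tailCode_eq h]
  have := (s ⟨k + j, h⟩).isLt
  congr 1; omega

@[to_additive]
theorem prod_fin_window {M : Type*} [CommMonoid M] (k r : ℕ) (G : ℕ → M) :
    (∏ i : Fin N, if k ≤ i.val ∧ i.val - k < r then G (i.val - k) else 1)
      = ∏ j ∈ Finset.range r, if k + j < N then G j else 1 := by
  have h1 : ∀ i ∈ Finset.range N, (if k ≤ i ∧ i - k < r then G (i - k) else 1)
      = ∏ j ∈ Finset.range r, if i = k + j then G j else 1 := by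
    intro i _
    split_ifs with h
    · rw [Finset.prod_eq_single (i - k)]
      · rw [if_pos (by omega)]
      · intro j _ hj; rw [if_neg (by omega)]
      · intro hj; simp at hj; omega
    · symm
      refine Finset.prod_eq_one fun j hj => if_neg ?_
      simp at hj; omega
  rw [Fin.prod_univ_eq_prod_range (fun i => if k ≤ i ∧ i - k < r then G (i - k) else 1) N,
    Finset.prod_congr rfl h1, Finset.prod_comm]
  refine Finset.prod_congr rfl fun j _ => ?_
  simp [Finset.prod_ite_eq']

/-- The letter of the Pauli word with index `α` at position `k` on site `k + j`, as a number; it is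
`0` where there is no such site. -/
def letter (N k α j : ℕ) : ℕ := if k + j < N then α / 4 ^ j % 4 else 0

/-- Whether a Pauli matrix flips the spin. -/
def flips (a : Fin 4) : Fin 2 := if a = 1 ∨ a = 2 then 1 else 0

/-- The nonzero entry of a Pauli matrix in row `u`. -/
def pauliPhase (a : Fin 4) (u : Fin 2) : ℂ :=
  (if 2 ≤ a.val then 1 - 2 * (u.val : ℂ) else 1) * (-Complex.I) ^ (if a.val = 2 then 1 else 0)

theorem pauli_apply (a : Fin 4) (u v : Fin 2) :
    pauli a u v = if v = u + flips a then pauliPhase a u else 0 := by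
  fin_cases a <;> fin_cases u <;> fin_cases v <;> simp [pauli, flips, pauliPhase] <;> norm_num

/-- The flips of a Pauli word. -/
def wordFlip (N r k α : ℕ) : Cfg N := fun i => flips (letterAt r k α i)

theorem pauliWord_mulVec (r k α : ℕ) (φ : Cfg N → ℂ) (s : Cfg N) :
    (pauliWord N r k α *ᵥ φ) s
      = (∏ i : Fin N, pauliPhase (letterAt r k α i) (s i)) * φ (s + wordFlip N r k α) := by
  rw [Matrix.mulVec, dotProduct, Finset.sum_eq_single (s + wordFlip N r k α)]
  · congr 1
    rw [pauliWord, siteTensor_apply]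
    exact Finset.prod_congr rfl fun i _ => by
      rw [pauli_apply]; exact if_pos rfl
  · intro s' _ hs
    obtain ⟨i, hi⟩ := Function.ne_iff.1 hs
    have : pauliWord N r k α s s' = 0 := by
      rw [pauliWord, siteTensor_apply]
      exact Finset.prod_eq_zero (Finset.mem_univ i) (by
        rw [pauli_apply]; exact if_neg hi)
    rw [this, zero_mul]
  · simp

theorem val_add_flips (u : Fin 2) (a : Fin 4) :
    (((u + flips a : Fin 2).val : ℕ) : ℤ)
      = u.val + if a.val = 1 ∨ a.val = 2 then 1 - 2 * (u.val : ℤ) else 0 := by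
  fin_cases a <;> fin_cases u <;> simp [flips]

theorem letterAt_eq (r k α : ℕ) {i : ℕ} (hi : i < N) (h : k ≤ i ∧ i - k < r) :
    (letterAt r k α i).val = letter N k α (i - k) := by
  rw [letterAt, if_pos h, letter, if_pos (by omega)]

/-- The sign in the action of a Pauli word on a basis state. -/
def signAt (l : ℕ) (a : ℕ → ℕ) (r x : ℕ) : ℤ :=
  ∏ j ∈ Finset.range r, if 2 ≤ a j then 1 - 2 * bitAt x (l + j) else 1

/-- The number of letters `σʸ` of a word. -/
def countY (a : ℕ → ℕ) (r : ℕ) : ℕ := ∑ j ∈ Finset.range r, if a j = 2 then 1 else 0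

theorem tailCode_add_wordFlip (r k l α : ℕ) (s : Cfg N) :
    tailCode k (s + wordFlip N r (k + l) α)
      = tailCode k s ^^^ flipMask l (letter N (k + l) α) r := by
  zify
  rw [cast_xor_flipMask]
  have h1 : flipOffset l (letter N (k + l) α) r (tailCode k s) = ∑ i : Fin N,
      if k + l ≤ i.val ∧ i.val - (k + l) < r then
        (if letter N (k + l) α (i.val - (k + l)) = 1 ∨ letter N (k + l) α (i.val - (k + l)) = 2 then
          (1 - 2 * bitAt (tailCode k s) (l + (i.val - (k + l)))) * 2 ^ (l + (i.val - (k + l)))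
          else 0) else 0 := by
    rw [sum_fin_window (k + l) r (fun j => if letter N (k + l) α j = 1 ∨ letter N (k + l) α j = 2 then
          (1 - 2 * bitAt (tailCode k s) (l + j)) * 2 ^ (l + j) else 0), flipOffset]
    refine Finset.sum_congr rfl fun j _ => ?_
    by_cases hj : k + l + j < N
    · rw [if_pos hj]
    · simp [letter, hj]
  rw [h1]
  generalize hX : tailCode k s = X
  conv_rhs => arg 1; rw [← hX, tailCode]
  rw [tailCode]
  push_cast
  rw [← Finset.sum_add_distrib]
  refine Finset.sum_congr rfl fun i _ => ?_
  by_cases hk : k ≤ i.val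
  · rw [if_pos hk, if_pos hk, Pi.add_apply, wordFlip, val_add_flips]
    by_cases hw : k + l ≤ i.val ∧ i.val - (k + l) < r
    · rw [if_pos hw, letterAt_eq r _ α i.isLt hw]
      have e : l + (i.val - (k + l)) = i.val - k := by omega
      have e' : k + (i.val - k) = i.val := by omega
      rw [e, ← hX, bitAt_tailCode (by omega)]
      simp only [e', Fin.eta]
      split_ifs <;> ring
    · have : letterAt r (k + l) α i = 0 := by rw [letterAt, if_neg hw]
      simp [this, if_neg hw]
  · rw [if_neg hk, if_neg hk, if_neg (by omega), add_zero]

theorem prod_pauliPhase (r k l α : ℕ) (s : Cfg N) :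
    ∏ i : Fin N, pauliPhase (letterAt r (k + l) α i) (s i)
      = (signAt l (letter N (k + l) α) r (tailCode k s) : ℂ)
        * (-Complex.I) ^ countY (letter N (k + l) α) r := by
  set a := letter N (k + l) α with ha
  set G : ℕ → ℂ := fun j => ((if 2 ≤ a j then 1 - 2 * bitAt (tailCode k s) (l + j) else 1 : ℤ) : ℂ)
    * (-Complex.I) ^ (if a j = 2 then 1 else 0) with hG
  have h1 : ∀ i : Fin N, pauliPhase (letterAt r (k + l) α i) (s i)
      = if k + l ≤ i.val ∧ i.val - (k + l) < r then G (i.val - (k + l)) else 1 := by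
    intro i
    by_cases hw : k + l ≤ i.val ∧ i.val - (k + l) < r
    · rw [if_pos hw, pauliPhase, letterAt_eq r _ α i.isLt hw, hG]
      have e : l + (i.val - (k + l)) = i.val - k := by omega
      have e' : k + (i.val - k) = i.val := by omega
      simp only [e]
      rw [bitAt_tailCode (by omega)]
      simp only [e', Fin.eta]
      congr 1
      split_ifs <;> push_cast <;> rfl
    · rw [if_neg hw, letterAt, if_neg hw]; simp [pauliPhase]
  rw [Finset.prod_congr rfl fun i _ => h1 i, prod_fin_window, signAt, countY, Int.cast_prod,
    ← Finset.prod_pow_eq_pow_sum, ← Finset.prod_mul_distrib]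
  refine Finset.prod_congr rfl fun j _ => ?_
  by_cases hj : k + l + j < N
  · rw [if_pos hj]
  · rw [if_neg hj]; simp [ha, letter, hj]

end PauliAction

section Contraction

variable {N : ℕ}

/-- The partial contraction of `⟨χ| O ⊗ ⋯ ⊗ O |φ⟩`: the sites before `k` are contracted, and the
outcomes on the other sites are the binary digits of `x` (in `φ`) and `y` (in `χ`). -/
def contr (O : ℕ → Fin 2 → Fin 2 → ℂ) (k : ℕ) (φ χ : Cfg N → ℂ) (x y : ℕ) : ℂ :=
  ∑ s, ∑ s', if tailCode k s = x ∧ tailCode k s' = y then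
    (∏ i : Fin N, if i.val < k then O i (s' i) (s i) else 1) * φ s * star (χ s') else 0

theorem contr_swap (O : ℕ → Fin 2 → Fin 2 → ℂ) (k : ℕ) (φ χ : Cfg N → ℂ) (x y : ℕ) :
    contr O k φ χ x y = star (contr (fun i u v => star (O i v u)) k χ φ y x) := by
  simp only [contr, star_sum]
  rw [Finset.sum_comm]
  refine Finset.sum_congr rfl fun s _ => Finset.sum_congr rfl fun s' _ => ?_
  by_cases h : tailCode k s' = x ∧ tailCode k s = y
  · rw [if_pos h, if_pos h.symm]
    simp only [star_mul', star_star, star_prod, apply_ite (star : ℂ → ℂ), star_one]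
    ring
  · rw [if_neg h, if_neg (fun h' => h h'.symm), star_zero]

theorem contr_add_left (O : ℕ → Fin 2 → Fin 2 → ℂ) (k : ℕ) (φ φ' χ : Cfg N → ℂ) (x y : ℕ) :
    contr O k (φ + φ') χ x y = contr O k φ χ x y + contr O k φ' χ x y := by
  simp only [contr, ← Finset.sum_add_distrib]
  refine Finset.sum_congr rfl fun s _ => Finset.sum_congr rfl fun s' _ => ?_
  split_ifs
  · simp only [Pi.add_apply]; ring
  · simp

theorem contr_smul_left (O : ℕ → Fin 2 → Fin 2 → ℂ) (k : ℕ) (z : ℂ) (φ χ : Cfg N → ℂ) (x y : ℕ) :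
    contr O k (z • φ) χ x y = z * contr O k φ χ x y := by
  simp only [contr, Finset.mul_sum]
  refine Finset.sum_congr rfl fun s _ => Finset.sum_congr rfl fun s' _ => ?_
  split_ifs
  · simp only [Pi.smul_apply, smul_eq_mul]; ring
  · simp

theorem contr_pauliWord_left (O : ℕ → Fin 2 → Fin 2 → ℂ) (r k l α : ℕ) (φ χ : Cfg N → ℂ) (x y : ℕ) :
    contr O k (pauliWord N r (k + l) α *ᵥ φ) χ x y
      = (signAt l (letter N (k + l) α) r x : ℂ) * (-Complex.I) ^ countY (letter N (k + l) α) r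
        * contr O k φ χ (x ^^^ flipMask l (letter N (k + l) α) r) y := by
  set f := wordFlip N r (k + l) α with hf
  set μ := flipMask l (letter N (k + l) α) r with hμ
  have hflip : ∀ s : Cfg N, tailCode k (s + f) = x ^^^ μ ↔ tailCode k s = x := by
    intro s
    rw [hf, tailCode_add_wordFlip, ← hμ]
    exact ⟨fun h => Nat.xor_left_injective h, fun h => by rw [h]⟩
  have hR : contr O k φ χ (x ^^^ μ) y = ∑ s, ∑ s', if tailCode k (s + f) = x ^^^ μ ∧ tailCode k s' = y then
      (∏ i : Fin N, if i.val < k then O i (s' i) ((s + f) i) else 1) * φ (s + f) * star (χ s')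
      else 0 :=
    (Equiv.sum_comp (Equiv.addRight f) (fun s => ∑ s', if tailCode k s = x ^^^ μ ∧ tailCode k s' = y
      then (∏ i : Fin N, if i.val < k then O i (s' i) (s i) else 1) * φ s * star (χ s')
      else 0)).symm
  simp only [hflip] at hR
  rw [hR, contr, Finset.mul_sum]
  refine Finset.sum_congr rfl fun s _ => ?_
  rw [Finset.mul_sum]
  refine Finset.sum_congr rfl fun s' _ => ?_
  by_cases h : tailCode k s = x ∧ tailCode k s' = y
  · rw [if_pos h, if_pos h, pauliWord_mulVec, prod_pauliPhase, h.1, ← hf]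
    have : ∀ i : Fin N, (if i.val < k then O i (s' i) ((s + f) i) else 1)
        = if i.val < k then O i (s' i) (s i) else 1 := by
      intro i
      by_cases hi : i.val < k
      · have : f i = 0 := by
          rw [hf, wordFlip, letterAt, if_neg (by omega)]; rfl
        rw [if_pos hi, if_pos hi, Pi.add_apply, this, add_zero]
      · rw [if_neg hi, if_neg hi]
    simp only [this]
    ring
  · rw [if_neg h, if_neg h, mul_zero]

theorem contr_pauliWord_right (O : ℕ → Fin 2 → Fin 2 → ℂ) (r k l α : ℕ) (φ χ : Cfg N → ℂ)
    (x y : ℕ) :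
    contr O k φ (pauliWord N r (k + l) α *ᵥ χ) x y
      = (signAt l (letter N (k + l) α) r y : ℂ) * Complex.I ^ countY (letter N (k + l) α) r
        * contr O k φ χ x (y ^^^ flipMask l (letter N (k + l) α) r) := by
  rw [contr_swap, contr_pauliWord_left, contr_swap O k φ χ]
  simp [star_mul']

theorem contr_succ (O : ℕ → Fin 2 → Fin 2 → ℂ) {k : ℕ} (hk : k < N) (φ χ : Cfg N → ℂ) (x y : ℕ) :
    contr O (k + 1) φ χ x y
      = ∑ u : Fin 2, ∑ v : Fin 2, O k v u * contr O k φ χ (2 * x + u.val) (2 * y + v.val) := by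
  simp only [contr, Finset.mul_sum]
  have e1 : ∀ F : Fin 2 → Fin 2 → Cfg N → Cfg N → ℂ, ∑ u, ∑ v, ∑ s, ∑ s', F u v s s'
      = ∑ s, ∑ s', ∑ u, ∑ v, F u v s s' := by
    intro F
    rw [Finset.sum_congr rfl fun u _ => Finset.sum_comm, Finset.sum_comm]
    refine Finset.sum_congr rfl fun s _ => ?_
    rw [Finset.sum_congr rfl fun u _ => Finset.sum_comm, Finset.sum_comm]
  rw [e1]
  refine Finset.sum_congr rfl fun s _ => Finset.sum_congr rfl fun s' _ => ?_
  have hc : ∀ (s : Cfg N) (x : ℕ) (u : Fin 2), tailCode k s = 2 * x + u.val ↔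
      (tailCode (k + 1) s = x ∧ u = s ⟨k, hk⟩) := by
    intro s x u
    rw [tailCode_eq hk, Fin.ext_iff]
    have := u.isLt; have := (s ⟨k, hk⟩).isLt
    omega
  simp only [hc]
  by_cases h : tailCode (k + 1) s = x ∧ tailCode (k + 1) s' = y
  · rw [if_pos h, Finset.sum_eq_single (s ⟨k, hk⟩), Finset.sum_eq_single (s' ⟨k, hk⟩)]
    · rw [if_pos ⟨⟨h.1, rfl⟩, h.2, rfl⟩, ← mul_assoc, ← mul_assoc]
      congr 2
      rw [← Finset.mul_prod_erase _ _ (Finset.mem_univ (⟨k, hk⟩ : Fin N)),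
        ← Finset.mul_prod_erase (a := (⟨k, hk⟩ : Fin N)) (h := Finset.mem_univ _)
          (f := fun i : Fin N => if i.val < k then O i (s' i) (s i) else 1)]
      simp only [lt_add_one, if_true, lt_irrefl, if_false, one_mul]
      congr 1
      refine Finset.prod_congr rfl fun i hi => ?_
      have hne : i.val ≠ k := fun h' => Finset.ne_of_mem_erase hi (Fin.ext h')
      by_cases hik : i.val < k
      · rw [if_pos (by omega), if_pos hik]
      · rw [if_neg (by omega), if_neg hik]
    · intro v _ hv; rw [if_neg (by tauto), mul_zero]
    · simp
    · intro u _ hu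
      refine Finset.sum_eq_zero fun v _ => ?_
      rw [if_neg (by tauto), mul_zero]
    · simp
  · rw [if_neg h]
    symm
    refine Finset.sum_eq_zero fun u _ => Finset.sum_eq_zero fun v _ => ?_
    rw [if_neg (by tauto), mul_zero]

theorem contr_zero (O : ℕ → Fin 2 → Fin 2 → ℂ) (x y : ℕ) :
    contr O 0 (Pi.single (0 : Cfg N) 1) (Pi.single 0 1) x y = if x = 0 ∧ y = 0 then 1 else 0 := by
  have h0 : tailCode 0 (0 : Cfg N) = 0 := Finset.sum_eq_zero fun i _ => by simp
  rw [contr, Finset.sum_eq_single 0, Finset.sum_eq_single 0]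
  · simp [h0, eq_comm]
  · intro s _ hs; simp [hs]
  · simp
  · intro s _ hs
    refine Finset.sum_eq_zero fun s' _ => ?_
    simp [hs]
  · simp

theorem contr_all (O : ℕ → Fin 2 → Fin 2 → ℂ) (φ : Cfg N → ℂ) :
    contr O N φ φ 0 0
      = star φ ⬝ᵥ (siteTensor (fun i : Fin N => Matrix.of (O i)) *ᵥ φ) := by
  simp only [contr, dotProduct, Matrix.mulVec, Finset.mul_sum, tailCode_of_le le_rfl, true_and,
    if_true, Fin.is_lt]
  rw [Finset.sum_comm]
  refine Finset.sum_congr rfl fun s _ => Finset.sum_congr rfl fun s' _ => ?_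
  rw [siteTensor_apply]
  simp only [Matrix.of_apply, Pi.star_apply]
  ring

end Contraction

end SpinChain

end

section

namespace SpinChain

/-- The data of a simulation: `n` Trotter steps for each exponential, windows of `L` terms, and
integers that describe the Hamiltonian, the time and the observables. -/
structure Sim where
  N : ℕ
  r : ℕ
  n : ℕ
  L : ℕ
  scale : ℤ
  coeff : ℕ → ℤ
  time : ℤ
  obs : ℕ → ℤ

namespace Sim

/-- The number of gates per site. -/
def gates (S : Sim) : ℕ := 2 * S.n * S.L * 4 ^ S.r

/-- The number of steps per site: each gate is applied to the ket and to the bra, and then the site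
is contracted. -/
def period (S : Sim) : ℕ := 2 * S.gates + 1

/-- Relative position of the term in gate `h`. -/
def pos (S : Sim) (h : ℕ) : ℕ := h / 4 ^ S.r % S.L

/-- The sign of the exponent in gate `h`; the term of the current site only appears in the first of
the two exponentials. -/
def sgn (S : Sim) (h : ℕ) : ℤ :=
  if h / 4 ^ S.r / S.L < S.n then -1 else if S.pos h = 0 then 0 else 1

/-- The real amplitude of gate `h` of site `k`. -/
def amp (S : Sim) (k h : ℕ) : ℤ :=
  S.sgn h * S.coeff ((k + S.pos h) * 4 ^ S.r + h % 4 ^ S.r) * S.time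

/-- The letters of the Pauli word in gate `h` of site `k`. -/
def letters (S : Sim) (k h : ℕ) : ℕ → ℕ := letter S.N (k + S.pos h) (h % 4 ^ S.r)

/-- Gate `h` of site `k`. -/
def gate (S : Sim) (k h : ℕ) : Op S.N :=
  (S.scale : ℂ) • (1 : Op S.N) + ((S.amp k h : ℂ) * Complex.I) •
    pauliWord S.N S.r (k + S.pos h) (h % 4 ^ S.r)

/-- Real part of `i (-i) ^ y`. -/
def reUnit (y : ℕ) : ℤ := if y % 4 = 1 then 1 else if y % 4 = 3 then -1 else 0

/-- Imaginary part of `i (-i) ^ y`. -/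
def imUnit (y : ℕ) : ℤ := if y % 4 = 0 then 1 else if y % 4 = 2 then -1 else 0

theorem reUnit_add_imUnit (y : ℕ) :
    ((reUnit y : ℤ) : ℂ) + (imUnit y : ℤ) * Complex.I = Complex.I * (-Complex.I) ^ y := by
  have h : (-Complex.I) ^ y = (-Complex.I) ^ (y % 4) := by
    conv_lhs => rw [← Nat.div_add_mod y 4, pow_add, pow_mul]
    have : (-Complex.I) ^ 4 = 1 := by rw [neg_pow, Complex.I_pow_four]; norm_num
    rw [this, one_pow, one_mul]
  rw [h, reUnit, imUnit]
  have h4 : y % 4 < 4 := Nat.mod_lt _ (by norm_num)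
  have h3 : (-Complex.I) ^ 3 = Complex.I := by
    rw [pow_succ, neg_sq, Complex.I_sq]; ring
  interval_cases y % 4 <;> simp [h3]

/-- Row and column of a table entry that enter gate `h`. -/
def flipped (S : Sim) (k h x : ℕ) : ℕ :=
  ((x : ℤ) + flipOffset (S.pos h) (S.letters k h) S.r x).toNat

/-- Application of gate `h` of site `k`, to the ket for `b = 0` and to the bra for `b = 1`. -/
def gateStep (S : Sim) (k h b : ℕ) (T : ℕ → ℕ → ℕ → ℤ) (x y c : ℕ) : ℤ :=
  let z := if b = 0 then x else y
  let a := S.amp k h * signAt (S.pos h) (S.letters k h) S.r z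
  let x' := if b = 0 then S.flipped k h x else x
  let y' := if b = 0 then y else S.flipped k h y
  S.scale * T x y c + a * reUnit (countY (S.letters k h) S.r) * T x' y' c +
    (2 * c - 1) * (1 - 2 * b) * a * imUnit (countY (S.letters k h) S.r) * T x' y' (1 - c)

/-- Contraction of site `k`. -/
def shiftStep (S : Sim) (k : ℕ) (T : ℕ → ℕ → ℕ → ℤ) (x y c : ℕ) : ℤ :=
  ∑ u ∈ Finset.range 2, ∑ v ∈ Finset.range 2,
    (S.obs (2 * (4 * k + 2 * v + u)) * T (2 * x + u) (2 * y + v) c +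
      (2 * c - 1) * S.obs (2 * (4 * k + 2 * v + u) + 1) * T (2 * x + u) (2 * y + v) (1 - c))

/-- The table computed by the simulation: real (`c = 0`) and imaginary (`c = 1`) part of the partial
contractions. -/
def tab (S : Sim) : ℕ → ℕ → ℕ → ℕ → ℤ
  | 0 => fun x y c => if x = 0 ∧ y = 0 ∧ c = 0 then 1 else 0
  | s + 1 => if s % S.period < 2 * S.gates
      then S.gateStep (s / S.period) (s % S.period / 2) (s % S.period % 2) (S.tab s)
      else S.shiftStep (s / S.period) (S.tab s)

/-- The complex number in a table entry. -/
def val (T : ℕ → ℕ → ℕ → ℤ) (x y : ℕ) : ℂ := T x y 0 + T x y 1 * Complex.I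

/-- The observables. -/
def obsC (S : Sim) (k : ℕ) (u v : Fin 2) : ℂ :=
  S.obs (2 * (4 * k + 2 * u.val + v.val)) + S.obs (2 * (4 * k + 2 * u.val + v.val) + 1) * Complex.I

theorem complex_mul_aux (s a re im t0 t1 u0 u1 : ℂ) :
    (s * t0 + a * re * u0 - a * im * u1) + (s * t1 + a * re * u1 + a * im * u0) * Complex.I
      = s * (t0 + t1 * Complex.I) + a * (re + im * Complex.I) * (u0 + u1 * Complex.I) := by
  linear_combination -(a * im * u1) * Complex.I_sq

theorem val_gateStep_zero (S : Sim) (k h : ℕ) (T : ℕ → ℕ → ℕ → ℤ) (x y : ℕ) :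
    val (S.gateStep k h 0 T) x y = S.scale * val T x y
      + (S.amp k h * signAt (S.pos h) (S.letters k h) S.r x) *
        (Complex.I * (-Complex.I) ^ countY (S.letters k h) S.r) * val T (S.flipped k h x) y := by
  rw [← reUnit_add_imUnit]
  simp only [val, gateStep, if_true]
  rw [← complex_mul_aux]
  push_cast
  norm_num
  ring

theorem val_gateStep_one (S : Sim) (k h : ℕ) (T : ℕ → ℕ → ℕ → ℤ) (x y : ℕ) :
    val (S.gateStep k h 1 T) x y = S.scale * val T x y
      + (S.amp k h * signAt (S.pos h) (S.letters k h) S.r y) *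
        star (Complex.I * (-Complex.I) ^ countY (S.letters k h) S.r) * val T x (S.flipped k h y) := by
  rw [← reUnit_add_imUnit]
  have : star (((reUnit (countY (S.letters k h) S.r) : ℤ) : ℂ) +
      (imUnit (countY (S.letters k h) S.r) : ℤ) * Complex.I)
      = ((reUnit (countY (S.letters k h) S.r) : ℤ) : ℂ) +
      (-(imUnit (countY (S.letters k h) S.r) : ℤ)) * Complex.I := by
    simp [star_mul']
  rw [this]
  simp only [val, gateStep, one_ne_zero, if_false]
  rw [← complex_mul_aux]
  push_cast
  ring_nf

theorem val_shiftStep (S : Sim) (k : ℕ) (T : ℕ → ℕ → ℕ → ℤ) (x y : ℕ) :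
    val (S.shiftStep k T) x y
      = ∑ u : Fin 2, ∑ v : Fin 2, S.obsC k v u * val T (2 * x + u.val) (2 * y + v.val) := by
  have h : ∀ o0 o1 t0 t1 : ℂ, (o0 + o1 * Complex.I) * (t0 + t1 * Complex.I)
      = (o0 * t0 - o1 * t1) + (o0 * t1 + o1 * t0) * Complex.I := by
    intro o0 o1 t0 t1; linear_combination o1 * t1 * Complex.I_sq
  simp only [Fin.sum_univ_two, val, obsC, h, shiftStep, Finset.sum_range_succ, Finset.sum_range_zero]
  push_cast
  norm_num
  ring

/-- The operator applied to the ket (`b = 0`) or the bra (`b = 1`) in step `s`. -/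
def stepOp (S : Sim) (b s : ℕ) : Op S.N :=
  if s % S.period < 2 * S.gates ∧ s % S.period % 2 = b then S.gate (s / S.period) (s % S.period / 2)
  else 1

/-- The ket (`b = 0`) or the bra (`b = 1`) before step `s`. -/
def partialState (S : Sim) (b s : ℕ) : Cfg S.N → ℂ := oprod (S.stepOp b) s *ᵥ Pi.single 0 1

theorem partialState_succ (S : Sim) (b s : ℕ) :
    S.partialState b (s + 1) = S.stepOp b s *ᵥ S.partialState b s := by
  rw [partialState, oprod_succ, ← Matrix.mulVec_mulVec, partialState]

theorem contr_add_right {N : ℕ} (O : ℕ → Fin 2 → Fin 2 → ℂ) (k : ℕ) (φ χ χ' : Cfg N → ℂ) (x y : ℕ) :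
    contr O k φ (χ + χ') x y = contr O k φ χ x y + contr O k φ χ' x y := by
  rw [contr_swap, contr_add_left, star_add, ← contr_swap, ← contr_swap]

theorem contr_smul_right {N : ℕ} (O : ℕ → Fin 2 → Fin 2 → ℂ) (k : ℕ) (z : ℂ) (φ χ : Cfg N → ℂ)
    (x y : ℕ) : contr O k φ (z • χ) x y = star z * contr O k φ χ x y := by
  rw [contr_swap, contr_smul_left, star_mul', ← contr_swap]

theorem contr_gate_left (S : Sim) (O : ℕ → Fin 2 → Fin 2 → ℂ) (k h : ℕ) (φ χ : Cfg S.N → ℂ)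
    (x y : ℕ) :
    contr O k (S.gate k h *ᵥ φ) χ x y = S.scale * contr O k φ χ x y
      + (S.amp k h * signAt (S.pos h) (S.letters k h) S.r x) *
        (Complex.I * (-Complex.I) ^ countY (S.letters k h) S.r) *
          contr O k φ χ (S.flipped k h x) y := by
  rw [gate, Matrix.add_mulVec, Matrix.smul_mulVec, Matrix.smul_mulVec, Matrix.one_mulVec,
    contr_add_left, contr_smul_left, contr_smul_left, contr_pauliWord_left, flipped,
    toNat_add_flipOffset, letters]
  ring

theorem contr_gate_right (S : Sim) (O : ℕ → Fin 2 → Fin 2 → ℂ) (k h : ℕ) (φ χ : Cfg S.N → ℂ)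
    (x y : ℕ) :
    contr O k φ (S.gate k h *ᵥ χ) x y = S.scale * contr O k φ χ x y
      + (S.amp k h * signAt (S.pos h) (S.letters k h) S.r y) *
        star (Complex.I * (-Complex.I) ^ countY (S.letters k h) S.r) *
          contr O k φ χ x (S.flipped k h y) := by
  rw [gate, Matrix.add_mulVec, Matrix.smul_mulVec, Matrix.smul_mulVec, Matrix.one_mulVec,
    contr_add_right, contr_smul_right, contr_smul_right, contr_pauliWord_right, flipped,
    toNat_add_flipOffset, letters]
  simp [star_mul']
  ring

theorem period_pos (S : Sim) : 0 < S.period := by simp [period]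

theorem val_tab (S : Sim) {s : ℕ} (hs : s ≤ S.N * S.period) (x y : ℕ) :
    val (S.tab s) x y
      = contr S.obsC (s / S.period) (S.partialState 0 s) (S.partialState 1 s) x y := by
  induction s generalizing x y with
  | zero =>
    rw [Nat.zero_div, partialState, partialState, oprod_zero, oprod_zero, Matrix.one_mulVec, contr_zero]
    simp only [val, tab]
    split_ifs with h1 h2 h3 <;> simp_all
  | succ s ih =>
    have ih' := fun x y => ih (by omega) x y
    have hk : s / S.period < S.N := (Nat.div_lt_iff_lt_mul S.period_pos).2 (by omega)
    rw [tab, partialState_succ, partialState_succ]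
    by_cases hg : s % S.period < 2 * S.gates
    · rw [if_pos hg]
      have hd : (s + 1) / S.period = s / S.period := by
        rw [Nat.succ_div, if_neg, add_zero]
        intro hdvd
        have h0 := Nat.mod_eq_zero_of_dvd hdvd
        rw [Nat.add_mod] at h0
        have h1 : s % S.period + 1 % S.period < S.period := by
          have : 1 % S.period ≤ 1 := Nat.mod_le _ _
          have : S.period = 2 * S.gates + 1 := rfl
          omega
        rw [Nat.mod_eq_of_lt h1] at h0
        have : 1 < S.period := by
          have : S.period = 2 * S.gates + 1 := rfl
          omega
        rw [Nat.mod_eq_of_lt this] at h0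
        omega
      rw [hd]
      rcases Nat.mod_two_eq_zero_or_one (s % S.period) with hb | hb
      · rw [hb, val_gateStep_zero, ih', ih']
        have e0 : S.stepOp 0 s = S.gate (s / S.period) (s % S.period / 2) := if_pos ⟨hg, hb⟩
        have e1 : S.stepOp 1 s = 1 := if_neg (by omega)
        rw [e0, e1, Matrix.one_mulVec, contr_gate_left]
      · rw [hb, val_gateStep_one, ih', ih']
        have e1 : S.stepOp 1 s = S.gate (s / S.period) (s % S.period / 2) := if_pos ⟨hg, hb⟩
        have e0 : S.stepOp 0 s = 1 := if_neg (by omega)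
        rw [e0, e1, Matrix.one_mulVec, contr_gate_right]
    · rw [if_neg hg]
      have hlt := Nat.mod_lt s S.period_pos
      have hp : S.period = 2 * S.gates + 1 := rfl
      have hd : (s + 1) / S.period = s / S.period + 1 := by
        rw [Nat.succ_div, if_pos]
        rw [Nat.dvd_iff_mod_eq_zero, ← Nat.div_add_mod s S.period,
          show s % S.period = 2 * S.gates by omega, add_assoc, ← hp]
        simp
      have e0 : S.stepOp 0 s = 1 := if_neg (by omega)
      have e1 : S.stepOp 1 s = 1 := if_neg (by omega)
      rw [hd, val_shiftStep, e0, e1, Matrix.one_mulVec, Matrix.one_mulVec, contr_succ _ hk]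
      simp only [ih']

/-- The unnormalized state prepared by the simulation. -/
def simState (S : Sim) : Cfg S.N → ℂ :=
  oprod (fun k => oprod (S.gate k) S.gates) S.N *ᵥ Pi.single 0 1

theorem oprod_two_mul {R : Type*} [Monoid R] (f : ℕ → R) (n : ℕ) :
    oprod f (2 * n) = oprod (fun i => f (2 * i + 1) * f (2 * i)) n := by
  induction n with
  | zero => simp
  | succ n ih => rw [show 2 * (n + 1) = 2 * n + 1 + 1 by ring, oprod_succ, oprod_succ, ih, oprod_succ,
      mul_assoc]

theorem partialState_eq_simState (S : Sim) {b : ℕ} (hb : b < 2) :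
    S.partialState b (S.N * S.period) = S.simState := by
  rw [partialState, simState, oprod_mul]
  congr 1
  refine oprod_congr fun k _ => ?_
  have hp : S.period = 2 * S.gates + 1 := rfl
  have hmod : ∀ j < S.period, (k * S.period + j) % S.period = j ∧ (k * S.period + j) / S.period = k := by
    intro j hj
    constructor
    · rw [Nat.mul_add_mod_self_right, Nat.mod_eq_of_lt hj]
    · rw [mul_comm, Nat.mul_add_div S.period_pos, Nat.div_eq_of_lt hj, add_zero]
  conv_lhs => rw [hp]
  rw [oprod_succ, ← hp]
  have e : S.stepOp b (k * S.period + 2 * S.gates) = 1 := by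
    rw [stepOp, (hmod (2 * S.gates) (by omega)).1, if_neg (by omega)]
  rw [e, one_mul, oprod_two_mul]
  refine oprod_congr fun h hh => ?_
  rw [stepOp, stepOp, (hmod (2 * h + 1) (by omega)).1, (hmod (2 * h) (by omega)).1,
    (hmod (2 * h + 1) (by omega)).2, (hmod (2 * h) (by omega)).2]
  rw [show (2 * h + 1) % 2 = 1 by omega, show 2 * h % 2 = 0 by omega,
    show (2 * h + 1) / 2 = h by omega, show 2 * h / 2 = h by omega]
  interval_cases b
  · rw [if_neg (by omega), if_pos (by omega), one_mul]
  · rw [if_pos (by omega), if_neg (by omega), mul_one]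

theorem val_tab_last (S : Sim) :
    val (S.tab (S.N * S.period)) 0 0
      = star S.simState ⬝ᵥ (siteTensor (fun i : Fin S.N => Matrix.of (S.obsC i)) *ᵥ S.simState) := by
  rw [val_tab S le_rfl, Nat.mul_div_cancel _ S.period_pos, S.partialState_eq_simState two_pos,
    S.partialState_eq_simState one_lt_two, contr_all]

/-- Entries outside of the window vanish. -/
theorem tab_eq_zero (S : Sim) {w : ℕ} (hw : S.L + S.r ≤ w) (hL : 0 < S.L) (s : ℕ) {x y : ℕ}
    (h : 2 ^ w ≤ x ∨ 2 ^ w ≤ y) (c : ℕ) : S.tab s x y c = 0 := by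
  induction s generalizing x y c with
  | zero =>
    have : 0 < 2 ^ w := by positivity
    exact if_neg (by omega)
  | succ s ih =>
    rw [tab]
    split_ifs
    · have hf : ∀ k h x, 2 ^ w ≤ x → 2 ^ w ≤ S.flipped k h x := by
        intro k h x hx
        have hpos : S.pos h + S.r ≤ w := by
          have : S.pos h < S.L := Nat.mod_lt _ hL
          omega
        have := xor_flipMask_lt (a := S.letters k h) (x := x) hpos
        rw [flipped, toNat_add_flipOffset]
        omega
      simp only [gateStep]
      have hz : ∀ k h' b c, S.tab s (if b = 0 then S.flipped k h' x else x)
          (if b = 0 then y else S.flipped k h' y) c = 0 := by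
        intro k h' b c
        refine ih ?_ c
        split_ifs
        · exact h.imp (hf _ _ _) id
        · exact h.imp id (hf _ _ _)
      rw [ih h, hz, hz]
      ring
    · refine Finset.sum_eq_zero fun u _ => Finset.sum_eq_zero fun v _ => ?_
      have : 2 ^ w ≤ 2 * x + u ∨ 2 ^ w ≤ 2 * y + v := by omega
      rw [ih this, ih this]; ring

theorem abs_signAt (l : ℕ) (a : ℕ → ℕ) (r x : ℕ) : |signAt l a r x| = 1 := by
  rw [signAt, Finset.abs_prod]
  refine Finset.prod_eq_one fun j _ => ?_
  rw [bitAt_eq_testBit]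
  split_ifs <;> simp

theorem abs_tab_le (S : Sim) {A : ℤ} (hA : ∀ k h, |S.amp k h| ≤ A) {B : ℤ}
    (hB : ∀ i, |S.obs i| ≤ B) (s x y : ℕ) {c : ℕ} (hc : c < 2) :
    |S.tab s x y c| ≤ (|S.scale| + 2 * A + 8 * B) ^ s := by
  have hA0 : 0 ≤ A := (abs_nonneg _).trans (hA 0 0)
  have hB0 : 0 ≤ B := (abs_nonneg _).trans (hB 0)
  have hunit : ∀ y, |reUnit y| ≤ 1 ∧ |imUnit y| ≤ 1 := by
    intro y; unfold reUnit imUnit; constructor <;> split_ifs <;> simp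
  have hc2 : |2 * (c : ℤ) - 1| = 1 := by interval_cases c <;> simp
  induction s generalizing x y c with
  | zero => simp only [tab, pow_zero]; split_ifs <;> simp
  | succ s ih =>
    set V := (|S.scale| + 2 * A + 8 * B) ^ s with hV
    have hV0 : 0 ≤ V := by positivity
    have hmul : ∀ a b t : ℤ, |a| ≤ b → |t| ≤ V → |a * t| ≤ b * V := by
      intro a b t h1 h2
      rw [abs_mul]
      exact mul_le_mul h1 h2 (abs_nonneg _) ((abs_nonneg _).trans h1)
    rw [tab, pow_succ', ← hV]
    split_ifs
    · simp only [gateStep]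
      refine (abs_add_three _ _ _).trans ?_
      set x' := if s % S.period % 2 = 0 then S.flipped (s / S.period) (s % S.period / 2) x else x
      set y' := if s % S.period % 2 = 0 then y else S.flipped (s / S.period) (s % S.period / 2) y
      set z := if s % S.period % 2 = 0 then x else y
      have hb : |1 - 2 * ((s % S.period % 2 : ℕ) : ℤ)| = 1 := by
        rcases Nat.mod_two_eq_zero_or_one (s % S.period) with hb | hb <;> rw [hb] <;> simp
      have h1 := hmul S.scale |S.scale| _ le_rfl (ih x y hc hc2)
      have ha : ∀ k h l a u, |u| ≤ 1 → |S.amp k h * signAt l a S.r z * u| ≤ A := by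
        intro k h l a u hu
        rw [abs_mul, abs_mul, abs_signAt, mul_one]
        exact (mul_le_mul (hA k h) hu (abs_nonneg _) hA0).trans (by rw [mul_one])
      have h2 := hmul _ A _ (ha (s / S.period) (s % S.period / 2) (S.pos (s % S.period / 2))
        (S.letters (s / S.period) (s % S.period / 2)) _
        (hunit (countY (S.letters (s / S.period) (s % S.period / 2)) S.r)).1) (ih x' y' hc hc2)
      have hc' : |2 * ((1 - c : ℕ) : ℤ) - 1| = 1 := by interval_cases c <;> simp
      have h3 := hmul ((2 * (c : ℤ) - 1) * (1 - 2 * ((s % S.period % 2 : ℕ) : ℤ)) *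
        (S.amp (s / S.period) (s % S.period / 2) * signAt (S.pos (s % S.period / 2))
        (S.letters (s / S.period) (s % S.period / 2)) S.r z) *
        imUnit (countY (S.letters (s / S.period) (s % S.period / 2)) S.r)) A _ (by
          rw [mul_assoc (_ * _) _ (imUnit _), abs_mul, abs_mul, hc2, hb, one_mul, one_mul]
          exact ha _ _ _ _ _ (hunit _).2) (ih x' y' (c := 1 - c) (by omega) hc')
      have h4 : 0 ≤ 8 * B * V := by positivity
      linarith
    · have hc' : |2 * ((1 - c : ℕ) : ℤ) - 1| = 1 := by interval_cases c <;> simp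
      have hterm : ∀ i j x y, |S.obs i * S.tab s x y c + (2 * c - 1) * S.obs j * S.tab s x y (1 - c)|
          ≤ 2 * B * V := by
        intro i j x y
        refine (abs_add_le _ _).trans ?_
        have h1 := hmul _ _ _ (hB i) (ih x y hc hc2)
        have h2 := hmul ((2 * c - 1) * S.obs j) B _ (by rw [abs_mul, hc2, one_mul]; exact hB j)
          (ih x y (c := 1 - c) (by omega) hc')
        linarith
      have h3 : |S.shiftStep (s / S.period) (S.tab s) x y c| ≤ 8 * B * V := by
        unfold shiftStep
        refine (Finset.abs_sum_le_sum_abs _ _).trans ?_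
        refine (Finset.sum_le_sum fun u _ => (Finset.abs_sum_le_sum_abs _ _).trans
          (Finset.sum_le_sum fun v _ => hterm _ _ _ _)).trans ?_
        simp; linarith
      have h4 : 0 ≤ (|S.scale| + 2 * A) * V := by positivity
      linarith

end Sim

end SpinChain

end

section

namespace SpinChain

open NormedSpace
open scoped Matrix.Norms.L2Operator

theorem sum_range_mul' {M : Type*} [AddCommMonoid M] (f : ℕ → M) (a b : ℕ) :
    ∑ j ∈ Finset.range (a * b), f j
      = ∑ i ∈ Finset.range a, ∑ j ∈ Finset.range b, f (i * b + j) := by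
  induction a with
  | zero => simp
  | succ a ih => rw [Nat.succ_mul, Finset.sum_range_add, ih, Finset.sum_range_succ]

theorem exp_inv_smul_pow {N : ℕ} (X : Op N) {n : ℕ} (hn : 0 < n) :
    exp ((n : ℝ)⁻¹ • X) ^ n = exp X := by
  let _ : NormedAlgebra ℚ (Op N) := NormedAlgebra.restrictScalars ℚ ℝ (Op N)
  rw [← exp_nsmul, ← Nat.cast_smul_eq_nsmul ℝ, smul_smul, mul_inv_cancel₀ (by positivity), one_smul]

namespace Sim

variable (S : Sim)

/-- The coefficient of the Pauli word in gate `h` of site `k`, for unit scale. -/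
def gateCoeff (k h : ℕ) : ℂ := (S.amp k h : ℂ) * Complex.I / S.scale

theorem gate_eq (hscale : S.scale ≠ 0) (k h : ℕ) :
    S.gate k h = (S.scale : ℂ) • (1 + S.gateCoeff k h •
      pauliWord S.N S.r (k + S.pos h) (h % 4 ^ S.r)) := by
  have : (S.scale : ℂ) ≠ 0 := by exact_mod_cast hscale
  rw [gate, smul_add, smul_smul, gateCoeff, mul_div_cancel₀ _ this]

/-- The product of the gates of one Trotter step at site `k`, for unit scale. -/
def trotterStep (k i : ℕ) : Op S.N :=
  oprod (fun j => 1 + S.gateCoeff k (i * (S.L * 4 ^ S.r) + j) •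
    pauliWord S.N S.r (k + S.pos (i * (S.L * 4 ^ S.r) + j))
      ((i * (S.L * 4 ^ S.r) + j) % 4 ^ S.r)) (S.L * 4 ^ S.r)

theorem oprod_gate_eq (hscale : S.scale ≠ 0) (k : ℕ) :
    oprod (S.gate k) S.gates
      = (S.scale : ℂ) ^ S.gates • oprod (S.trotterStep k) (2 * S.n) := by
  rw [oprod_congr fun h _ => S.gate_eq hscale k h, oprod_smul]
  congr 1
  rw [gates, mul_assoc (2 * S.n), oprod_mul]
  rfl

/-- The generator that Trotter step `i` at site `k` approximates. -/
def trotterGen (c : ℕ → ℕ → ℝ) (k i : ℕ) : Op S.N :=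
  (S.n : ℝ)⁻¹ • if i < S.n then -gen S.N S.r c k (k + S.L) else gen S.N S.r c (k + 1) (k + S.L)

theorem oprod_exp_trotterGen (c : ℕ → ℕ → ℝ) (hn : 0 < S.n) (k : ℕ) :
    oprod (fun i => exp (S.trotterGen c k i)) (2 * S.n)
      = exp (gen S.N S.r c (k + 1) (k + S.L)) * exp (-gen S.N S.r c k (k + S.L)) := by
  rw [two_mul, oprod_add]
  congr 1
  · rw [oprod_congr (g := fun _ => exp ((S.n : ℝ)⁻¹ • gen S.N S.r c (k + 1) (k + S.L)))
      fun i _ => by rw [trotterGen, if_neg (by omega)], oprod_const, exp_inv_smul_pow _ hn]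
  · rw [oprod_congr (g := fun _ => exp ((S.n : ℝ)⁻¹ • -gen S.N S.r c k (k + S.L)))
      fun i hi => by rw [trotterGen, if_pos hi], oprod_const, exp_inv_smul_pow _ hn]

/-- The sign in `sgn`, for the term at relative position `l` in Trotter step `i`. -/
def stepSign (i l : ℕ) : ℤ := if i < S.n then -1 else if l = 0 then 0 else 1

theorem abs_stepSign_le (i l : ℕ) : |(S.stepSign i l : ℝ)| ≤ 1 := by
  unfold stepSign; split_ifs <;> simp

theorem gate_index (hL : 0 < S.L) (i : ℕ) {l α : ℕ} (hl : l < S.L) (hα : α < 4 ^ S.r) :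
    S.pos (i * (S.L * 4 ^ S.r) + (l * 4 ^ S.r + α)) = l ∧
    (i * (S.L * 4 ^ S.r) + (l * 4 ^ S.r + α)) % 4 ^ S.r = α ∧
    S.sgn (i * (S.L * 4 ^ S.r) + (l * 4 ^ S.r + α)) = S.stepSign i l := by
  have e : i * (S.L * 4 ^ S.r) + (l * 4 ^ S.r + α) = 4 ^ S.r * (S.L * i + l) + α := by ring
  have h1 : (i * (S.L * 4 ^ S.r) + (l * 4 ^ S.r + α)) / 4 ^ S.r = S.L * i + l := by
    rw [e, Nat.mul_add_div (by positivity), Nat.div_eq_of_lt hα, add_zero]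
  have h2 : S.pos (i * (S.L * 4 ^ S.r) + (l * 4 ^ S.r + α)) = l := by
    rw [pos, h1, Nat.mul_add_mod, Nat.mod_eq_of_lt hl]
  refine ⟨h2, ?_, ?_⟩
  · rw [e, Nat.mul_add_mod, Nat.mod_eq_of_lt hα]
  · rw [sgn, h2, h1, Nat.mul_add_div hL, Nat.div_eq_of_lt hl, add_zero, stepSign]

theorem trotterGen_eq (c : ℕ → ℕ → ℝ) (k i : ℕ) :
    S.trotterGen c k i = ∑ l ∈ Finset.range S.L, ∑ α ∈ Finset.range (4 ^ S.r),
      ((S.stepSign i l : ℂ) * (c (k + l) α / S.n : ℝ) * Complex.I) •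
        pauliWord S.N S.r (k + l) α := by
  have h0 : ∀ l, ∑ α ∈ Finset.range (4 ^ S.r),
      ((S.stepSign i l : ℂ) * (c (k + l) α / S.n : ℝ) * Complex.I) • pauliWord S.N S.r (k + l) α
      = (S.n : ℝ)⁻¹ • (S.stepSign i l • localGen S.N S.r c (k + l)) := by
    intro l
    rw [localGen, Finset.smul_sum, Finset.smul_sum]
    refine Finset.sum_congr rfl fun α _ => ?_
    rw [← Int.cast_smul_eq_zsmul ℂ, smul_smul, ← Complex.coe_smul, smul_smul]
    congr 1
    push_cast
    ring
  rw [Finset.sum_congr rfl fun l _ => h0 l, ← Finset.smul_sum, trotterGen]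
  congr 1
  split_ifs with hi
  · simp only [stepSign, if_pos hi, gen, Finset.sum_Ico_eq_sum_range, neg_smul, one_smul,
      Finset.sum_neg_distrib, Nat.add_sub_cancel_left]
  · simp only [stepSign, if_neg hi, gen]
    rcases Nat.eq_zero_or_pos S.L with h | h
    · simp [h]
    · obtain ⟨L, hL⟩ := Nat.exists_eq_add_of_le' h
      rw [hL, Finset.sum_range_succ', Finset.sum_Ico_eq_sum_range]
      simp only [Nat.succ_ne_zero, if_false, if_true, one_smul, zero_smul, add_zero]
      rw [show k + (L + 1) - (k + 1) = L by omega]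
      refine Finset.sum_congr rfl fun j _ => ?_
      congr 1; ring

theorem norm_trotterStep_sub_le {c : ℕ → ℕ → ℝ} {κ η : ℝ} (hL : 0 < S.L)
    (hc : ∀ k α, |c k α| ≤ κ)
    (happ : ∀ k, ∀ α < 4 ^ S.r,
      |(S.coeff (k * 4 ^ S.r + α) : ℝ) * S.time / S.scale - c k α / S.n| ≤ η)
    (hσ : S.L * 4 ^ S.r * (κ / S.n + η) ≤ 1) (k i : ℕ) :
    ‖S.trotterStep k i - exp (S.trotterGen c k i)‖
      ≤ 2 * (S.L * 4 ^ S.r * (κ / S.n + η)) ^ 2 + S.L * 4 ^ S.r * η := by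
  set D : ℕ → ℕ → ℝ := fun l α => (S.coeff ((k + l) * 4 ^ S.r + α) : ℝ) * S.time / S.scale with hD
  have hη : 0 ≤ η := (abs_nonneg _).trans (happ 0 0 (by positivity))
  have hκ : 0 ≤ κ := (abs_nonneg _).trans (hc 0 0)
  have hterm : ∀ l < S.L, ∀ α < 4 ^ S.r,
      S.gateCoeff k (i * (S.L * 4 ^ S.r) + (l * 4 ^ S.r + α)) •
        pauliWord S.N S.r (k + S.pos (i * (S.L * 4 ^ S.r) + (l * 4 ^ S.r + α)))
        ((i * (S.L * 4 ^ S.r) + (l * 4 ^ S.r + α)) % 4 ^ S.r)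
      = ((S.stepSign i l : ℂ) * (D l α : ℝ) * Complex.I) • pauliWord S.N S.r (k + l) α := by
    intro l hl α hα
    obtain ⟨h1, h2, h3⟩ := S.gate_index hL i hl hα
    rw [gateCoeff, amp, h1, h2, h3, hD]
    congr 1
    push_cast
    ring
  have hnorm : ∀ (z : ℝ) l α, ‖((S.stepSign i l : ℂ) * (z : ℝ) * Complex.I) •
      pauliWord S.N S.r (k + l) α‖ ≤ |z| := by
    intro z l α
    rw [norm_smul]
    have h1 := S.abs_stepSign_le i l
    have h2 := norm_pauliWord_le (N := S.N) S.r (k + l) α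
    have h3 : ‖(S.stepSign i l : ℂ) * (z : ℝ) * Complex.I‖ = |(S.stepSign i l : ℝ)| * |z| := by
      simp
    rw [h3]
    calc _ ≤ 1 * |z| * 1 := by gcongr
      _ = |z| := by ring
  have hDb : ∀ l, ∀ α < 4 ^ S.r, |D l α| ≤ κ / S.n + η := by
    intro l α hα
    have h1 := happ (k + l) α hα
    have h2 : |c (k + l) α / S.n| ≤ κ / S.n := by
      rw [abs_div, Nat.abs_cast]; gcongr; exact hc _ _
    calc |D l α| = |(D l α - c (k + l) α / S.n) + c (k + l) α / S.n| := by congr 1; ring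
      _ ≤ η + κ / S.n := (abs_add_le _ _).trans (add_le_add h1 h2)
      _ = _ := by ring
  have hcard : ∀ v : ℝ, ∑ _l ∈ Finset.range S.L, ∑ _α ∈ Finset.range (4 ^ S.r), v
      = S.L * 4 ^ S.r * v := by
    intro v; simp; ring
  refine norm_oprod_one_add_sub_exp_le hσ ?_ ?_ ?_
  · rw [sum_range_mul', ← hcard]
    refine Finset.sum_le_sum fun l hl => Finset.sum_le_sum fun α hα => ?_
    rw [hterm l (Finset.mem_range.1 hl) α (Finset.mem_range.1 hα)]
    exact (hnorm _ _ _).trans (hDb _ _ (Finset.mem_range.1 hα))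
  · rw [trotterGen_eq, ← hcard]
    refine norm_sum_le_of_le _ fun l _ => norm_sum_le_of_le _ fun α _ => (hnorm _ _ _).trans ?_
    rw [abs_div, Nat.abs_cast]
    have := div_le_div_of_nonneg_right (hc (k + l) α) (Nat.cast_nonneg (α := ℝ) S.n)
    linarith
  · rw [trotterGen_eq, sum_range_mul', ← hcard, ← Finset.sum_sub_distrib]
    refine norm_sum_le_of_le _ fun l hl => ?_
    rw [← Finset.sum_sub_distrib]
    refine norm_sum_le_of_le _ fun α hα => ?_
    rw [hterm l (Finset.mem_range.1 hl) α (Finset.mem_range.1 hα), ← sub_smul]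
    have := hnorm (D l α - c (k + l) α / S.n) l α
    push_cast at this ⊢
    rw [show (S.stepSign i l : ℂ) * (D l α : ℂ) * Complex.I
      - (S.stepSign i l : ℂ) * ((c (k + l) α : ℂ) / S.n) * Complex.I
      = (S.stepSign i l : ℂ) * ((D l α : ℂ) - (c (k + l) α : ℂ) / S.n) * Complex.I by ring]
    exact this.trans (happ (k + l) α (Finset.mem_range.1 hα))

theorem norm_mulVec_le {N : ℕ} (A : Op N) (v : Cfg N → ℂ) :
    ‖WithLp.toLp 2 (A *ᵥ v)‖ ≤ ‖A‖ * ‖WithLp.toLp 2 v‖ :=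
  (Matrix.toEuclideanCLM (n := Cfg N) (𝕜 := ℂ) A).le_opNorm (WithLp.toLp 2 v)

/-- The state prepared by the simulation approximates the time evolved state. -/
theorem simState_approx {c : ℕ → ℕ → ℝ} {κ η E : ℝ} {l : ℕ} (hL : S.L = l + 1) (hn : 0 < S.n)
    (hscale : S.scale ≠ 0)
    (hc : ∀ k α, |c k α| ≤ κ) (hc0 : ∀ k α, S.N ≤ k → c k α = 0)
    (happ : ∀ k, ∀ α < 4 ^ S.r,
      |(S.coeff (k * 4 ^ S.r + α) : ℝ) * S.time / S.scale - c k α / S.n| ≤ η)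
    (hσ : S.L * 4 ^ S.r * (κ / S.n + η) ≤ 1)
    (hδ : 2 * S.n * (2 * (S.L * 4 ^ S.r * (κ / S.n + η)) ^ 2 + S.L * 4 ^ S.r * η) ≤ 1)
    (hE : S.N * (2 * (2 * S.n * (2 * (S.L * 4 ^ S.r * (κ / S.n + η)) ^ 2 + S.L * 4 ^ S.r * η))
      + 2 * (4 ^ S.r * κ) *
        Real.exp (Real.exp 1 * (2 * ((S.r + 1) * (4 ^ S.r * κ))) - (l / (S.r + 1) : ℕ))) ≤ E)
    (hE1 : E ≤ 1) :
    ∃ ψ : Cfg S.N → ℂ, S.simState = (S.scale : ℂ) ^ (S.gates * S.N) • ψ ∧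
      ‖WithLp.toLp 2 (ψ - exp (-gen S.N S.r c 0 S.N) *ᵥ Pi.single 0 1)‖ ≤ 2 * E := by
  have hη : 0 ≤ η := (abs_nonneg _).trans (happ 0 0 (by positivity))
  have hκ : 0 ≤ κ := (abs_nonneg _).trans (hc 0 0)
  set δ := 2 * (S.L * 4 ^ S.r * (κ / S.n + η)) ^ 2 + S.L * 4 ^ S.r * η with hδdef
  set μ := 2 * (4 ^ S.r * κ) *
        Real.exp (Real.exp 1 * (2 * ((S.r + 1) * (4 ^ S.r * κ))) - (l / (S.r + 1) : ℕ)) with hμ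
  have hδ0 : 0 ≤ δ := by positivity
  have hμ0 : 0 ≤ μ := by positivity
  set X : ℕ → Op S.N := fun k => oprod (S.trotterStep k) (2 * S.n)
  set W : ℕ → Op S.N := fun k => exp (gen S.N S.r c (k + 1) S.N) * exp (-gen S.N S.r c k S.N)
  have hgenneg : ∀ a b, star (-gen S.N S.r c a b) = -(-gen S.N S.r c a b) := fun a b => by
    rw [star_neg, star_gen]
  have hW : ∀ k < S.N, ‖W k‖ ≤ 1 := by
    intro k _
    calc _ ≤ ‖exp (gen S.N S.r c (k + 1) S.N)‖ * ‖exp (-gen S.N S.r c k S.N)‖ := norm_mul_le _ _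
      _ ≤ 1 * 1 := by
        gcongr
        · exact norm_exp_skewAdjoint_le _ (star_gen _ _ _ _)
        · exact norm_exp_skewAdjoint_le _ (hgenneg _ _)
      _ = 1 := by ring
  have hXW : ∀ k < S.N, ‖X k - W k‖ ≤ 2 * (2 * S.n * δ) + μ := by
    intro k hk
    have h1 : ‖X k - oprod (fun i => exp (S.trotterGen c k i)) (2 * S.n)‖ ≤ (1 + δ) ^ (2 * S.n) - 1 := by
      refine norm_oprod_sub_oprod_le (fun i _ => ?_)
        (fun i _ => S.norm_trotterStep_sub_le (by omega) hc happ hσ k i)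
      refine norm_exp_skewAdjoint_le _ ?_
      rw [trotterGen, star_smul, ← smul_neg, star_trivial]
      congr 1
      split_ifs
      · exact hgenneg _ _
      · exact star_gen _ _ _ _
    have h2 := one_add_pow_sub_one_le hδ0 (2 * S.n) (by push_cast; exact hδ)
    rw [oprod_exp_trotterGen S c hn, hL, ← add_assoc k l 1, add_right_comm k l 1] at h1
    have h3 := norm_propagator_sub_le (r := S.r) hc hc0 hk l
    rw [norm_sub_rev] at h3
    calc ‖X k - W k‖ = ‖(X k - exp (gen S.N S.r c (k + 1) (k + 1 + l)) *
          exp (-gen S.N S.r c k (k + 1 + l))) + (exp (gen S.N S.r c (k + 1) (k + 1 + l)) *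
          exp (-gen S.N S.r c k (k + 1 + l)) - W k)‖ := by congr 1; abel
      _ ≤ ((1 + δ) ^ (2 * S.n) - 1) + μ := (norm_add_le _ _).trans (add_le_add h1 h3)
      _ ≤ _ := by push_cast at h2; linarith
  refine ⟨oprod X S.N *ᵥ Pi.single 0 1, ?_, ?_⟩
  · rw [simState, oprod_congr fun k _ => S.oprod_gate_eq hscale k, oprod_smul, ← pow_mul,
      Matrix.smul_mulVec]
  · rw [exp_gen_eq_oprod, ← Matrix.sub_mulVec]
    refine (norm_mulVec_le _ _).trans ?_
    have h0 : ‖WithLp.toLp 2 (Pi.single 0 1 : Cfg S.N → ℂ)‖ = 1 := by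
      simp
    rw [h0, mul_one]
    refine (norm_oprod_sub_oprod_le hW hXW).trans ?_
    refine (one_add_pow_sub_one_le (by positivity) _ (hE.trans hE1)).trans ?_
    linarith

end Sim

end SpinChain

end

section

namespace SpinChain

namespace RAM

theorem one_le_bits (z : ℤ) : 1 ≤ bits z := by simp [bits]

theorem bits_le_iff {z : ℤ} {k : ℕ} : bits z ≤ k + 1 ↔ z.natAbs < 2 ^ k := by
  rw [bits, Nat.add_le_add_iff_right, Nat.size_le]

theorem bits_le_of_abs_lt {z : ℤ} {k : ℕ} (h : |z| < 2 ^ k) : bits z ≤ k + 1 := by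
  rw [bits_le_iff]
  zify
  exact_mod_cast h

theorem natAbs_lt_two_pow_bits (z : ℤ) : z.natAbs < 2 ^ (bits z - 1) := by
  simpa [bits] using Nat.lt_size_self z.natAbs

theorem bits_mono {y z : ℤ} (h : y.natAbs ≤ z.natAbs) : bits y ≤ bits z :=
  Nat.add_le_add_right (Nat.size_le_size h) 1

theorem bits_add_le (x y : ℤ) : bits (x + y) ≤ bits x + bits y := by
  obtain ⟨a, ha⟩ := Nat.exists_eq_add_of_le' (one_le_bits x)
  obtain ⟨b, hb⟩ := Nat.exists_eq_add_of_le' (one_le_bits y)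
  have h1 := natAbs_lt_two_pow_bits x
  have h2 := natAbs_lt_two_pow_bits y
  rw [ha, hb, show a + 1 + (b + 1) = (a + b + 1) + 1 by ring, bits_le_iff]
  rw [ha, Nat.add_sub_cancel] at h1
  rw [hb, Nat.add_sub_cancel] at h2
  have h3 : 2 ^ a ≤ 2 ^ (a + b) := Nat.pow_le_pow_right two_pos (by omega)
  have h4 : 2 ^ b ≤ 2 ^ (a + b) := Nat.pow_le_pow_right two_pos (by omega)
  rw [pow_succ]
  have := Int.natAbs_add_le x y
  omega

theorem bits_sub_le (x y : ℤ) : bits (x - y) ≤ bits x + bits y := by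
  have : bits (-y) = bits y := by simp [bits]
  rw [sub_eq_add_neg, ← this]
  exact bits_add_le _ _

theorem bits_mul_le (x y : ℤ) : bits (x * y) ≤ bits x + bits y := by
  obtain ⟨a, ha⟩ := Nat.exists_eq_add_of_le' (one_le_bits x)
  obtain ⟨b, hb⟩ := Nat.exists_eq_add_of_le' (one_le_bits y)
  have h1 := natAbs_lt_two_pow_bits x
  have h2 := natAbs_lt_two_pow_bits y
  rw [ha, hb, show a + 1 + (b + 1) = (a + b + 1) + 1 by ring, bits_le_iff]
  rw [ha, Nat.add_sub_cancel] at h1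
  rw [hb, Nat.add_sub_cancel] at h2
  rw [Int.natAbs_mul, pow_succ, pow_add]
  have := Nat.mul_lt_mul'' h1 h2
  omega

theorem bits_div_le (x y : ℤ) : bits (x / y) ≤ bits x :=
  bits_mono (Int.natAbs_ediv_le_natAbs x y)

/-- All memory cells have at most `B` bits. -/
def Bounded (B : ℕ) (m : Mem) : Prop := ∀ a i, bits (m a i) ≤ B

theorem Bounded.one_le {B : ℕ} {m : Mem} (h : Bounded B m) : 1 ≤ B :=
  (one_le_bits _).trans (h 0 0)

theorem Bounded.write {B : ℕ} {m : Mem} (h : Bounded B m) {a i : ℕ} {v : ℤ} (hv : bits v ≤ B) :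
    Bounded B (write m a i v) := by
  intro a' i'
  by_cases ha : a' = a
  · subst ha
    by_cases hi : i' = i
    · subst hi; simpa [RAM.write] using hv
    · simpa [RAM.write, hi] using h a' i'
  · simpa [RAM.write, ha] using h a' i'

/-- The value of `e` has at most `e.width * B` bits in a memory bounded by `B`. -/
def Expr.width : Expr → ℕ
  | .const z => bits z
  | .get _ _ => 1
  | .add x y => x.width + y.width
  | .sub x y => x.width + y.width
  | .mul x y => x.width + y.width
  | .div x _ => x.width
  | .lt _ _ => 2

/-- The evaluation of `e` costs at most `e.weight * B ^ 2` in a memory bounded by `B`. -/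
def Expr.weight : Expr → ℕ
  | .const z => bits z
  | .get _ i => i.weight + i.width + 1
  | .add x y => x.weight + y.weight + x.width + y.width
  | .sub x y => x.weight + y.weight + x.width + y.width
  | .mul x y => x.weight + y.weight + x.width * y.width
  | .div x y => x.weight + y.weight + x.width * y.width
  | .lt x y => x.weight + y.weight + x.width + y.width

theorem Expr.bits_eval_le {B : ℕ} {m : Mem} (h : Bounded B m) (e : Expr) :
    bits (e.eval m) ≤ e.width * B := by
  have hB := h.one_le
  induction e with
  | const z => exact Nat.le_mul_of_pos_right _ hB
  | get a i => simpa [Expr.eval, Expr.width] using h _ _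
  | add x y hx hy => rw [Expr.width, add_mul]; exact (bits_add_le _ _).trans (add_le_add hx hy)
  | sub x y hx hy => rw [Expr.width, add_mul]; exact (bits_sub_le _ _).trans (add_le_add hx hy)
  | mul x y hx hy => rw [Expr.width, add_mul]; exact (bits_mul_le _ _).trans (add_le_add hx hy)
  | div x y hx _ => exact (bits_div_le _ _).trans hx
  | lt x y =>
    have h1 : bits 1 = 2 := by simp [bits]
    have h0 : bits 0 = 1 := by simp [bits]
    simp only [Expr.eval, Expr.width]
    split_ifs <;> omega

theorem Expr.cost_le {B : ℕ} {m : Mem} (h : Bounded B m) (e : Expr) :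
    e.cost m ≤ e.weight * B ^ 2 := by
  have hB := h.one_le
  have hBB : B ≤ B ^ 2 := Nat.le_self_pow two_ne_zero B
  have key : ∀ x : Expr, bits (x.eval m) ≤ x.width * B ^ 2 := fun x =>
    (x.bits_eval_le h).trans (Nat.mul_le_mul_left _ hBB)
  have keym : ∀ x y : Expr, bits (x.eval m) * bits (y.eval m) ≤ x.width * y.width * B ^ 2 :=
    fun x y => (Nat.mul_le_mul (x.bits_eval_le h) (y.bits_eval_le h)).trans (le_of_eq (by ring))
  induction e with
  | const z => exact Nat.le_mul_of_pos_right _ (by positivity)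
  | get a i ih =>
    have := key i
    have h2 := (h a (i.eval m).toNat).trans hBB
    simp only [Expr.cost, Expr.weight, add_mul]
    omega
  | add x y hx hy =>
    have := key x; have := key y
    simp only [Expr.cost, Expr.weight, add_mul]
    omega
  | sub x y hx hy =>
    have := key x; have := key y
    simp only [Expr.cost, Expr.weight, add_mul]
    omega
  | mul x y hx hy =>
    have := keym x y
    simp only [Expr.cost, Expr.weight, add_mul]
    omega
  | div x y hx hy =>
    have := keym x y
    simp only [Expr.cost, Expr.weight, add_mul]
    omega
  | lt x y hx hy =>
    have := key x; have := key y
    simp only [Expr.cost, Expr.weight, add_mul]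
    omega

/-- Started in `m`, the program halts in `m'`; if all cells of `m` have at most `B` bits, then so
have those of `m'`, and the cost is at most `n * B ^ 2`. -/
def Run (B : ℕ) (c : Prog) (m : Mem) (n : ℕ) (m' : Mem) : Prop :=
  Bounded B m → Bounded B m' ∧ ∃ T ≤ n * B ^ 2, Exec c m m' T

theorem Run.mono {B : ℕ} {c : Prog} {m m' : Mem} {n n' : ℕ} (h : Run B c m n m') (hn : n ≤ n') :
    Run B c m n' m' := fun hm => by
  obtain ⟨h1, T, hT, h2⟩ := h hm
  exact ⟨h1, T, hT.trans (Nat.mul_le_mul_right _ hn), h2⟩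

theorem Run.seq {B : ℕ} {c d : Prog} {m m₁ m₂ : Mem} {n n' : ℕ} (h : Run B c m n m₁)
    (h' : Run B d m₁ n' m₂) : Run B (.seq c d) m (n + n') m₂ := fun hm => by
  obtain ⟨h1, T, hT, h2⟩ := h hm
  obtain ⟨h1', T', hT', h2'⟩ := h' h1
  exact ⟨h1', T + T', by rw [add_mul]; omega, Exec.seq h2 h2'⟩

/-- The cost of an assignment, in units of the square of the word length. -/
def assignWeight (i e : Expr) : ℕ := i.weight + e.weight + i.width + e.width + 1

theorem run_assign {B : ℕ} {m : Mem} (a : ℕ) (i e : Expr) {j : ℕ} {v : ℤ}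
    (hi : (i.eval m).toNat = j) (he : e.eval m = v) (hv : bits v ≤ B) :
    Run B (.assign a i e) m (assignWeight i e) (write m a j v) := fun hm => by
  subst hi he
  refine ⟨hm.write hv, _, ?_, Exec.assign m a i e⟩
  have h1 := i.cost_le hm
  have h2 := e.cost_le hm
  have hB : B ≤ B ^ 2 := Nat.le_self_pow two_ne_zero B
  have h3 := (i.bits_eval_le hm).trans (Nat.mul_le_mul_left _ hB)
  have h4 := (e.bits_eval_le hm).trans (Nat.mul_le_mul_left _ hB)
  have h5 : 1 ≤ B ^ 2 := hm.one_le.trans hB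
  simp only [assignWeight, add_mul]
  omega

theorem run_cond {B : ℕ} {m m' : Mem} {e : Expr} {c d : Prog} {n n' : ℕ}
    (h : e.eval m ≠ 0 → Run B c m n m') (h' : e.eval m = 0 → Run B d m n' m') :
    Run B (.cond e c d) m (e.weight + 1 + n + n') m' := fun hm => by
  have h1 := e.cost_le hm
  have h5 : 1 ≤ B ^ 2 := hm.one_le.trans (Nat.le_self_pow two_ne_zero B)
  by_cases he : e.eval m = 0
  · obtain ⟨k1, T, hT, k2⟩ := h' he hm
    exact ⟨k1, _, by simp only [add_mul]; omega, Exec.cond_false he k2⟩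
  · obtain ⟨k1, T, hT, k2⟩ := h he hm
    exact ⟨k1, _, by simp only [add_mul]; omega, Exec.cond_true he k2⟩

/-- The scalar variable kept in cell `0` of array `a`. -/
abbrev var (a : ℕ) : Expr := .get a (.const 0)

/-- `for ctr < bound do c`. -/
def forLoop (ctr : ℕ) (bound : Expr) (c : Prog) : Prog :=
  .seq (.assign ctr (.const 0) (.const 0))
    (.loop (.lt (var ctr) bound)
      (.seq c (.assign ctr (.const 0) (.add (var ctr) (.const 1)))))

/-- The cost of one passage of a loop, apart from that of its body. -/
def loopWeight (ctr : ℕ) (bound : Expr) : ℕ :=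
  (Expr.lt (var ctr) bound).weight + 1 +
    assignWeight (.const 0) (.const 0) + assignWeight (.const 0) (.add (var ctr) (.const 1))

theorem run_forLoop {B : ℕ} {ctr : ℕ} {bound : Expr} {c : Prog} {n K : ℕ} {m : Mem}
    (Inv : ℕ → Mem → Prop) (hn : bits n ≤ B) (h0 : Inv 0 (write m ctr 0 0))
    (hctr : ∀ i ≤ n, ∀ m, Inv i m → m ctr 0 = i ∧ bound.eval m = n)
    (step : ∀ i < n, ∀ m, Inv i m →
      ∃ m', Run B c m K m' ∧ m' ctr 0 = i ∧ Inv (i + 1) (write m' ctr 0 (i + 1 : ℕ))) :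
    ∃ m', Run B (forLoop ctr bound c) m ((n + 1) * (K + loopWeight ctr bound)) m' ∧ Inv n m' := by
  have hb : ∀ i ≤ n, bits (i : ℤ) ≤ B := fun i hi => (bits_mono (by simpa using hi)).trans hn
  have key : ∀ k ≤ n, ∀ m, Inv (n - k) m → ∃ m', Run B (.loop (.lt (var ctr) bound)
      (.seq c (.assign ctr (.const 0) (.add (var ctr) (.const 1))))) m
      (k * (K + loopWeight ctr bound) + (Expr.lt (var ctr) bound).weight + 1) m' ∧ Inv n m' := by
    intro k
    induction k with
    | zero =>
      intro _ m hm
      refine ⟨m, fun hB => ⟨hB, _, ?_, Exec.loop_false ?_⟩, hm⟩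
      · have h1 := (Expr.lt (var ctr) bound).cost_le hB
        have h5 : 1 ≤ B ^ 2 := hB.one_le.trans (Nat.le_self_pow two_ne_zero B)
        simp only [add_mul, zero_mul]; omega
      · obtain ⟨h1, h2⟩ := hctr _ (by omega) m hm
        simp [Expr.eval, h1, h2]
    | succ k ih =>
      intro hk m hm
      obtain ⟨h1, h2⟩ := hctr _ (by omega) m hm
      obtain ⟨m', hr, h3, h4⟩ := step (n - (k + 1)) (by omega) m hm
      rw [show n - (k + 1) + 1 = n - k by omega] at h4
      obtain ⟨m'', hr', h5⟩ := ih (by omega) _ h4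
      refine ⟨m'', fun hB => ?_, h5⟩
      have hr2 := (hr.seq (run_assign ctr (.const 0) (.add (var ctr) (.const 1)) (j := 0)
        (v := ((n - k : ℕ) : ℤ)) (by simp [Expr.eval])
        (by simp [Expr.eval, h3]; omega) (hb _ (by omega))))
      obtain ⟨g1, T, hT, g2⟩ := hr2 hB
      obtain ⟨g1', T', hT', g2'⟩ := hr' g1
      refine ⟨g1', _, ?_, Exec.loop_true ?_ g2 g2'⟩
      · have h1 := (Expr.lt (var ctr) bound).cost_le hB
        have h5 : 1 ≤ B ^ 2 := hB.one_le.trans (Nat.le_self_pow two_ne_zero B)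
        calc _ ≤ (Expr.lt (var ctr) bound).weight * B ^ 2 + B ^ 2 +
              (K + assignWeight (.const 0) (.add (var ctr) (.const 1))) * B ^ 2 +
              (k * (K + loopWeight ctr bound) + (Expr.lt (var ctr) bound).weight + 1) * B ^ 2 := by
                omega
          _ = ((Expr.lt (var ctr) bound).weight + 1 + (K + assignWeight (.const 0) (.add (var ctr) (.const 1)))
              + (k * (K + loopWeight ctr bound) + (Expr.lt (var ctr) bound).weight + 1)) * B ^ 2 := by
                ring
          _ ≤ _ := by
            refine Nat.mul_le_mul_right _ ?_
            simp only [loopWeight]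
            rw [add_mul k 1]
            omega
      · simp only [Expr.eval] at h2 ⊢
        simp [h1, h2]
        omega
  obtain ⟨m', hr, hI⟩ := key n le_rfl (write m ctr 0 0) (by simpa using h0)
  refine ⟨m', ((run_assign ctr (.const 0) (.const 0) (by simp [Expr.eval]) rfl
    ((bits_mono (by simp [Expr.eval])).trans hn)).seq hr).mono ?_, hI⟩
  simp only [loopWeight]
  rw [add_mul n 1]
  omega

/-- `for ctr < bound do a[ctr] := e`. -/
def fill (ctr a : ℕ) (bound e : Expr) : Prog := forLoop ctr bound (.assign a (var ctr) e)

/-- The memory `m` after the first `i` cells of array `a` have been set to `f`. -/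
def fillMem (m : Mem) (ctr a : ℕ) (f : ℕ → ℤ) (i : ℕ) : Mem :=
  Function.update (Function.update m a fun j => if j < i then f j else m a j) ctr
    (Function.update (m ctr) 0 (i : ℤ))

theorem fillMem_of_ne {m : Mem} {ctr a : ℕ} {f : ℕ → ℤ} {i b : ℕ} (h1 : b ≠ ctr) (h2 : b ≠ a) :
    fillMem m ctr a f i b = m b := by simp [fillMem, h1, h2]

theorem fillMem_of_lt {m : Mem} {ctr a : ℕ} {f : ℕ → ℤ} {i j : ℕ} (h1 : a ≠ ctr) (h2 : j < i) :
    fillMem m ctr a f i a j = f j := by simp [fillMem, h1, h2]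

theorem fillMem_ctr {m : Mem} {ctr a : ℕ} {f : ℕ → ℤ} {i : ℕ} :
    fillMem m ctr a f i ctr 0 = i := by simp [fillMem]

/-- The cost of one passage of `fill`. -/
def fillWeight (ctr : ℕ) (bound e : Expr) : ℕ :=
  assignWeight (var ctr) e + loopWeight ctr bound

theorem run_fill {B : ℕ} {ctr a : ℕ} {bound e : Expr} {n : ℕ} {m : Mem} {f : ℕ → ℤ}
    (hac : a ≠ ctr) (hn : bits n ≤ B) (hf : ∀ i < n, bits (f i) ≤ B)
    (hbound : ∀ i ≤ n, bound.eval (fillMem m ctr a f i) = n)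
    (he : ∀ i < n, e.eval (fillMem m ctr a f i) = f i) :
    Run B (fill ctr a bound e) m ((n + 1) * fillWeight ctr bound e) (fillMem m ctr a f n) := by
  obtain ⟨m', h1, h2⟩ := run_forLoop (B := B) (ctr := ctr) (bound := bound)
    (c := .assign a (var ctr) e) (K := assignWeight (var ctr) e) (m := m)
    (fun i m' => m' = fillMem m ctr a f i) hn
    (by
      funext b j
      simp only [fillMem, write, Function.update_apply]
      split_ifs <;> simp_all)
    (by
      rintro i hi _ rfl
      exact ⟨fillMem_ctr, hbound i hi⟩)
    (by
      rintro i hi _ rfl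
      refine ⟨_, run_assign a (var ctr) e (j := i) (by simp [Expr.eval, fillMem_ctr]) (he i hi)
        (hf i hi), ?_, ?_⟩
      · simp [write, hac.symm, fillMem_ctr]
      · funext b j
        by_cases hb : b = ctr
        · subst hb
          by_cases hj : j = 0 <;> simp [fillMem, write, hj, hac.symm]
        · by_cases hb' : b = a
          · subst hb'
            rcases lt_trichotomy j i with h | h | h
            · simp [fillMem, write, hb, h, h.ne, h.le]
            · simp [fillMem, write, hb, h]
            · simp [fillMem, write, hb, h.ne', h.not_gt, not_le.2 h]
          · simp [fillMem, write, hb, hb'])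
  rw [← h2]
  exact h1

end RAM

end SpinChain

end

section

namespace SpinChain

namespace RAM

namespace Expr

instance : Add Expr := ⟨.add⟩
instance : Sub Expr := ⟨.sub⟩
instance : Mul Expr := ⟨.mul⟩
instance : Div Expr := ⟨.div⟩
instance (n : ℕ) : OfNat Expr n := ⟨.const n⟩

variable (m : Mem) (x y z : Expr)

@[simp] theorem eval_add : (x + y).eval m = x.eval m + y.eval m := rfl
@[simp] theorem eval_sub : (x - y).eval m = x.eval m - y.eval m := rfl
@[simp] theorem eval_mul : (x * y).eval m = x.eval m * y.eval m := rfl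
@[simp] theorem eval_div : (x / y).eval m = x.eval m / y.eval m := rfl
@[simp] theorem eval_zero : (0 : Expr).eval m = 0 := rfl
@[simp] theorem eval_one : (1 : Expr).eval m = 1 := rfl
@[simp] theorem eval_two : (2 : Expr).eval m = 2 := rfl
@[simp] theorem eval_three : (3 : Expr).eval m = 3 := rfl
@[simp] theorem eval_four : (4 : Expr).eval m = 4 := rfl
@[simp] theorem eval_const (n : ℤ) : (const n).eval m = n := rfl
@[simp] theorem eval_get (a : ℕ) : (get a x).eval m = m a (x.eval m).toNat := rfl
theorem eval_lt : (lt x y).eval m = if x.eval m < y.eval m then 1 else 0 := rfl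

/-- The remainder of the division of `x` by `y`. -/
protected def mod : Expr := x - y * (x / y)

@[simp] theorem eval_mod : (x.mod y).eval m = x.eval m % y.eval m := (Int.emod_def _ _).symm

/-- The value of `y` if `x` has value `1`, and that of `z` if it has value `0`. -/
def ite : Expr := x * y + (1 - x) * z

theorem eval_ite_lt (u v : Expr) :
    (ite (lt u v) y z).eval m = if u.eval m < v.eval m then y.eval m else z.eval m := by
  simp only [ite, eval_add, eval_mul, eval_sub, eval_lt, eval_one]
  split_ifs <;> simp

/-- Sum of `f 0, …, f (r - 1)`. -/
def sum (f : ℕ → Expr) : ℕ → Expr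
  | 0 => 0
  | r + 1 => sum f r + f r

/-- Product of `f 0, …, f (r - 1)`. -/
def prod (f : ℕ → Expr) : ℕ → Expr
  | 0 => 1
  | r + 1 => prod f r * f r

theorem eval_sum (f : ℕ → Expr) (r : ℕ) :
    (sum f r).eval m = ∑ j ∈ Finset.range r, (f j).eval m := by
  induction r with
  | zero => rfl
  | succ r ih => rw [sum, eval_add, ih, Finset.sum_range_succ]

theorem eval_prod (f : ℕ → Expr) (r : ℕ) :
    (prod f r).eval m = ∏ j ∈ Finset.range r, (f j).eval m := by
  induction r with
  | zero => rfl
  | succ r ih => rw [prod, eval_mul, ih, Finset.prod_range_succ]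

end Expr

open SpinChain.RAM.Expr

/-- Expressions for the parameters of a simulation. The table is computed in array `6` from the
Hamiltonian in array `1`, the observables in array `5`, and the powers of `2` in array `7`, with the
loop counter in array `8`. -/
structure TabExpr where
  r : ℕ
  n : Expr
  L : Expr
  D : Expr
  scale : Expr

namespace TabExpr

variable (P : TabExpr)

def fourPow : Expr := .const (4 ^ P.r : ℕ)
def gates : Expr := 2 * P.n * P.L * P.fourPow
def period : Expr := 2 * P.gates + 1
def comp : Expr := (var 8).mod 2
def row : Expr := var 8 / 2 / (P.D * P.D)
def col : Expr := (var 8 / 2).mod (P.D * P.D)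
def x : Expr := P.col / P.D
def y : Expr := P.col.mod P.D
def step : Expr := P.row - 1
def site : Expr := P.step / P.period
def phase : Expr := P.step.mod P.period
def half : Expr := P.phase / 2
def side : Expr := P.phase.mod 2
def word : Expr := P.half.mod P.fourPow
def pos : Expr := (P.half / P.fourPow).mod P.L
def sgn : Expr := ite (lt (P.half / P.fourPow / P.L) P.n) (.const (-1)) (ite (lt P.pos 1) 0 1)
def amp : Expr :=
  P.sgn * get 1 ((P.site + P.pos) * P.fourPow + P.word) * get 0 (.const 3)
def letter (j : ℕ) : Expr :=
  ite (lt (P.site + P.pos + .const j) (get 0 (.const 0)))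
    ((P.word / .const (4 ^ j : ℕ)).mod 4) 0
def z : Expr := ite (lt P.side 1) P.x P.y
def pow (j : ℕ) : Expr := get 7 (P.pos + .const j)
def bit (j : ℕ) : Expr := (P.z / P.pow j).mod 2
def offset : Expr :=
  Expr.sum (fun j => ite (lt 0 (P.letter j))
    (ite (lt (P.letter j) 3) ((1 - 2 * P.bit j) * P.pow j) 0) 0) P.r
def sign : Expr := Expr.prod (fun j => ite (lt 1 (P.letter j)) (1 - 2 * P.bit j) 1) P.r
def countY : Expr :=
  Expr.sum (fun j => ite (lt 1 (P.letter j)) (ite (lt (P.letter j) 3) 1 0) 0) P.r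
def reUnit : Expr :=
  ite (lt (P.countY.mod 4) 2) (lt 0 (P.countY.mod 4)) (ite (lt (P.countY.mod 4) 3) 0 (.const (-1)))
def imUnit : Expr :=
  ite (lt (P.countY.mod 4) 1) 1 (ite (lt (P.countY.mod 4) 2) 0
    (ite (lt (P.countY.mod 4) 3) (.const (-1)) 0))
def x' : Expr := ite (lt P.side 1) (P.x + P.offset) P.x
def y' : Expr := ite (lt P.side 1) P.y (P.y + P.offset)
def cell (x y c : Expr) : Expr := get 6 (2 * (P.step * (P.D * P.D) + x * P.D + y) + c)
def gate : Expr :=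
  P.scale * P.cell P.x P.y comp + P.amp * P.sign * P.reUnit * P.cell P.x' P.y' comp +
    (2 * comp - 1) * (1 - 2 * P.side) * (P.amp * P.sign) * P.imUnit * P.cell P.x' P.y' (1 - comp)
def shiftTerm (u v : ℕ) : Expr :=
  get 5 (2 * (4 * P.site + 2 * .const v + .const u)) *
      P.cell (2 * P.x + .const u) (2 * P.y + .const v) comp +
    (2 * comp - 1) * get 5 (2 * (4 * P.site + 2 * .const v + .const u) + 1) *
      P.cell (2 * P.x + .const u) (2 * P.y + .const v) (1 - comp)
def shift : Expr :=
  ite (lt (2 * P.x + 1) P.D)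
    (ite (lt (2 * P.y + 1) P.D) (Expr.sum (fun u => Expr.sum (fun v => P.shiftTerm u v) 2) 2) 0) 0
/-- The next entry of the table. -/
def entry : Expr :=
  ite (lt P.row 1) (lt (var 8) 1) (ite (lt P.phase (2 * P.gates)) P.gate P.shift)

end TabExpr

/-- Entry `i` of the table of a simulation, as an array. -/
def tabArray (S : Sim) (w i : ℕ) : ℤ :=
  S.tab (i / 2 / (2 ^ w * 2 ^ w)) (i / 2 % (2 ^ w * 2 ^ w) / 2 ^ w) (i / 2 % (2 ^ w * 2 ^ w) % 2 ^ w)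
    (i % 2)

theorem tabArray_cell (S : Sim) {w s x y c : ℕ} (hx : x < 2 ^ w) (hy : y < 2 ^ w) (hc : c < 2) :
    tabArray S w (2 * (s * (2 ^ w * 2 ^ w) + x * 2 ^ w + y) + c) = S.tab s x y c := by
  have h1 : x * 2 ^ w + y < 2 ^ w * 2 ^ w := by
    calc x * 2 ^ w + y < x * 2 ^ w + 2 ^ w := by omega
      _ = (x + 1) * 2 ^ w := by ring
      _ ≤ _ := Nat.mul_le_mul_right _ hx
  rw [tabArray, Nat.mul_add_div two_pos, Nat.div_eq_of_lt hc, add_zero, Nat.mul_add_mod,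
    Nat.mod_eq_of_lt hc, add_assoc, mul_comm s, Nat.mul_add_div (by positivity),
    Nat.div_eq_of_lt h1, Nat.mul_add_mod, Nat.mod_eq_of_lt h1, mul_comm x,
    Nat.mul_add_div (by positivity), Nat.div_eq_of_lt hy, Nat.mul_add_mod, Nat.mod_eq_of_lt hy,
    add_zero, add_zero]

/-- The memory contains what is needed to compute entry `i` of the table. -/
structure TabReady (P : TabExpr) (S : Sim) (w i : ℕ) (m : Mem) : Prop where
  r_eq : P.r = S.r
  n_eq : P.n.eval m = S.n
  L_eq : P.L.eval m = S.L
  D_eq : P.D.eval m = (2 ^ w : ℕ)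
  scale_eq : P.scale.eval m = S.scale
  N_eq : m 0 0 = S.N
  time_eq : m 0 3 = S.time
  coeff_eq : ∀ j, m 1 j = S.coeff j
  obs_eq : ∀ j < 8 * S.N, m 5 j = S.obs j
  pow_eq : ∀ j ≤ w, m 7 j = (2 ^ j : ℕ)
  ctr_eq : m 8 0 = i
  prev : ∀ j < i, m 6 j = tabArray S w j
  w_le : S.L + S.r ≤ w
  L_pos : 0 < S.L

namespace TabReady

variable {P : TabExpr} {S : Sim} {w i : ℕ} {m : Mem} (h : TabReady P S w i m)
include h

theorem eval_fourPow : P.fourPow.eval m = (4 ^ S.r : ℕ) := by rw [TabExpr.fourPow, h.r_eq]; rfl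

theorem eval_gates : P.gates.eval m = (S.gates : ℕ) := by
  simp only [TabExpr.gates, eval_mul, eval_two, h.n_eq, h.L_eq, h.eval_fourPow, Sim.gates]
  push_cast; rfl

theorem eval_period : P.period.eval m = (S.period : ℕ) := by
  simp only [TabExpr.period, eval_add, eval_mul, eval_two, eval_one, h.eval_gates, Sim.period]
  push_cast; rfl

theorem eval_ctr : (var 8).eval m = i := h.ctr_eq

theorem eval_comp : TabExpr.comp.eval m = (i % 2 : ℕ) := by
  simp only [TabExpr.comp, eval_mod, h.eval_ctr, eval_two]
  push_cast; rfl

theorem eval_row : P.row.eval m = (i / 2 / (2 ^ w * 2 ^ w) : ℕ) := by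
  simp only [TabExpr.row, eval_div, h.eval_ctr, eval_two, eval_mul, h.D_eq]
  push_cast; rfl

theorem eval_col : P.col.eval m = (i / 2 % (2 ^ w * 2 ^ w) : ℕ) := by
  simp only [TabExpr.col, eval_mod, eval_div, h.eval_ctr, eval_two, eval_mul, h.D_eq]
  push_cast; rfl

theorem eval_x : P.x.eval m = (i / 2 % (2 ^ w * 2 ^ w) / 2 ^ w : ℕ) := by
  simp only [TabExpr.x, eval_div, h.eval_col, h.D_eq]
  push_cast; rfl

theorem eval_y : P.y.eval m = (i / 2 % (2 ^ w * 2 ^ w) % 2 ^ w : ℕ) := by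
  simp only [TabExpr.y, eval_mod, h.eval_col, h.D_eq]
  push_cast; rfl

omit h in
theorem x_lt : i / 2 % (2 ^ w * 2 ^ w) / 2 ^ w < 2 ^ w :=
  Nat.div_lt_of_lt_mul (Nat.mod_lt _ (by positivity))

omit h in
theorem y_lt : i / 2 % (2 ^ w * 2 ^ w) % 2 ^ w < 2 ^ w := Nat.mod_lt _ (by positivity)

variable {s : ℕ} (hs : i / 2 / (2 ^ w * 2 ^ w) = s + 1)
include hs

theorem eval_step : P.step.eval m = s := by
  simp only [TabExpr.step, eval_sub, eval_one, h.eval_row, hs]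
  push_cast; ring

theorem eval_site : P.site.eval m = (s / S.period : ℕ) := by
  simp only [TabExpr.site, eval_div, h.eval_step hs, h.eval_period]
  push_cast; rfl

theorem eval_phase : P.phase.eval m = (s % S.period : ℕ) := by
  simp only [TabExpr.phase, eval_mod, h.eval_step hs, h.eval_period]
  push_cast; rfl

theorem eval_half : P.half.eval m = (s % S.period / 2 : ℕ) := by
  simp only [TabExpr.half, eval_div, h.eval_phase hs, eval_two]
  push_cast; rfl

theorem eval_side : P.side.eval m = (s % S.period % 2 : ℕ) := by
  simp only [TabExpr.side, eval_mod, h.eval_phase hs, eval_two]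
  push_cast; rfl

theorem eval_word : P.word.eval m = (s % S.period / 2 % 4 ^ S.r : ℕ) := by
  simp only [TabExpr.word, eval_mod, h.eval_half hs, h.eval_fourPow]
  push_cast; rfl

theorem eval_pos : P.pos.eval m = (S.pos (s % S.period / 2) : ℕ) := by
  simp only [TabExpr.pos, eval_mod, eval_div, h.eval_half hs, h.eval_fourPow, h.L_eq, Sim.pos]
  push_cast; rfl

theorem eval_sgn : P.sgn.eval m = S.sgn (s % S.period / 2) := by
  simp only [TabExpr.sgn, eval_ite_lt, eval_div, h.eval_half hs, h.eval_fourPow, h.L_eq, h.n_eq,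
    h.eval_pos hs, eval_one, eval_zero, eval_const, Sim.sgn]
  norm_cast
  simp only [Nat.lt_one_iff]

theorem eval_amp : P.amp.eval m = S.amp (s / S.period) (s % S.period / 2) := by
  simp only [TabExpr.amp, eval_mul, eval_get, eval_add, h.eval_sgn hs, h.eval_site hs, h.eval_pos hs,
    h.eval_fourPow, h.eval_word hs, eval_const, Sim.amp]
  norm_cast
  rw [h.coeff_eq]
  congr 1
  exact h.time_eq

theorem eval_letter (j : ℕ) :
    (P.letter j).eval m = (S.letters (s / S.period) (s % S.period / 2) j : ℕ) := by
  simp only [TabExpr.letter, eval_ite_lt, eval_add, eval_get, h.eval_site hs, h.eval_pos hs,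
    h.eval_word hs, eval_const, eval_mod, eval_div, eval_four, eval_zero, Sim.letters, SpinChain.letter]
  have : m 0 (Int.toNat 0) = S.N := h.N_eq
  rw [this]
  norm_cast

/-- The index which the current gate flips. -/
theorem eval_z : P.z.eval m = ((if s % S.period % 2 = 0 then i / 2 % (2 ^ w * 2 ^ w) / 2 ^ w
    else i / 2 % (2 ^ w * 2 ^ w) % 2 ^ w : ℕ) : ℤ) := by
  simp only [TabExpr.z, eval_ite_lt, h.eval_side hs, eval_one, h.eval_x, h.eval_y]
  norm_cast
  simp only [Nat.lt_one_iff]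

theorem eval_pow {j : ℕ} (hj : j < S.r) :
    (P.pow j).eval m = (2 ^ (S.pos (s % S.period / 2) + j) : ℕ) := by
  simp only [TabExpr.pow, eval_get, eval_add, h.eval_pos hs, eval_const]
  norm_cast
  rw [h.pow_eq]
  have : S.pos (s % S.period / 2) < S.L := Nat.mod_lt _ h.L_pos
  have := h.w_le
  omega

variable {z : ℕ} (hz : P.z.eval m = z)
include hz

theorem eval_bit {j : ℕ} (hj : j < S.r) :
    (P.bit j).eval m = bitAt z (S.pos (s % S.period / 2) + j) := by
  simp only [TabExpr.bit, eval_mod, eval_div, hz, h.eval_pow hs hj, eval_two, bitAt]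
  push_cast; rfl

theorem eval_offset : P.offset.eval m = flipOffset (S.pos (s % S.period / 2))
    (S.letters (s / S.period) (s % S.period / 2)) S.r z := by
  rw [TabExpr.offset, eval_sum, h.r_eq, flipOffset]
  refine Finset.sum_congr rfl fun j hj => ?_
  rw [Finset.mem_range] at hj
  simp only [eval_ite_lt, eval_mul, eval_sub, eval_one, eval_two, eval_zero, eval_three,
    h.eval_letter hs, h.eval_bit hs hz hj, h.eval_pow hs hj]
  norm_cast
  set a := S.letters (s / S.period) (s % S.period / 2) j
  by_cases h1 : a = 1 ∨ a = 2
  · rw [if_pos (by omega), if_pos (by omega), if_pos h1]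
  · rw [if_neg h1]
    split_ifs <;> first | rfl | omega

theorem eval_sign : P.sign.eval m = signAt (S.pos (s % S.period / 2))
    (S.letters (s / S.period) (s % S.period / 2)) S.r z := by
  rw [TabExpr.sign, eval_prod, h.r_eq, signAt]
  refine Finset.prod_congr rfl fun j hj => ?_
  rw [Finset.mem_range] at hj
  simp only [eval_ite_lt, eval_mul, eval_sub, eval_one, eval_two, h.eval_letter hs,
    h.eval_bit hs hz hj]
  norm_cast

omit hz in
theorem eval_countY : P.countY.eval m
    = (countY (S.letters (s / S.period) (s % S.period / 2)) S.r : ℕ) := by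
  rw [TabExpr.countY, eval_sum, h.r_eq, countY]
  push_cast
  refine Finset.sum_congr rfl fun j hj => ?_
  simp only [eval_ite_lt, eval_one, eval_zero, eval_three, h.eval_letter hs]
  norm_cast
  set a := S.letters (s / S.period) (s % S.period / 2) j
  split_ifs <;> first | rfl | omega

omit hz in
theorem eval_reUnit : P.reUnit.eval m
    = Sim.reUnit (countY (S.letters (s / S.period) (s % S.period / 2)) S.r) := by
  simp only [TabExpr.reUnit, eval_ite_lt, eval_lt, eval_mod, h.eval_countY hs, eval_four, eval_two,
    eval_zero, eval_three, eval_const, Sim.reUnit]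
  norm_cast
  generalize countY (S.letters (s / S.period) (s % S.period / 2)) S.r = y
  split_ifs <;> first | rfl | omega

omit hz in
theorem eval_imUnit : P.imUnit.eval m
    = Sim.imUnit (countY (S.letters (s / S.period) (s % S.period / 2)) S.r) := by
  simp only [TabExpr.imUnit, eval_ite_lt, eval_mod, h.eval_countY hs, eval_four, eval_two,
    eval_zero, eval_one, eval_three, eval_const, Sim.imUnit]
  norm_cast
  generalize countY (S.letters (s / S.period) (s % S.period / 2)) S.r = y
  split_ifs <;> first | rfl | omega

omit hz in
theorem eval_x' {x : ℕ} (hx : P.x.eval m = x) : P.x'.eval m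
    = ((if s % S.period % 2 = 0 then S.flipped (s / S.period) (s % S.period / 2) x else x : ℕ) : ℤ) := by
  rw [TabExpr.x', eval_ite_lt, h.eval_side hs, eval_one, eval_add, hx]
  by_cases hb : s % S.period % 2 = 0
  · have hz : P.z.eval m = x := by rw [h.eval_z hs, if_pos hb, ← hx, h.eval_x]
    rw [hb, if_pos (by norm_num), if_pos rfl, h.eval_offset hs hz, Sim.flipped,
      toNat_add_flipOffset, cast_xor_flipMask]
  · rw [if_neg (by omega), if_neg hb]

omit hz in
theorem eval_y' {y : ℕ} (hy : P.y.eval m = y) : P.y'.eval m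
    = ((if s % S.period % 2 = 0 then y else S.flipped (s / S.period) (s % S.period / 2) y : ℕ) : ℤ) := by
  rw [TabExpr.y', eval_ite_lt, h.eval_side hs, eval_one, eval_add, hy]
  by_cases hb : s % S.period % 2 = 0
  · rw [hb, if_pos (by norm_num), if_pos rfl]
  · have hz : P.z.eval m = y := by rw [h.eval_z hs, if_neg hb, ← hy, h.eval_y]
    rw [if_neg (by omega), if_neg hb, h.eval_offset hs hz, Sim.flipped,
      toNat_add_flipOffset, cast_xor_flipMask]

omit hz in
theorem eval_cell {ex ey ec : Expr} {x y c : ℕ} (hx : ex.eval m = x) (hy : ey.eval m = y)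
    (hc : ec.eval m = c) (hxw : x < 2 ^ w) (hyw : y < 2 ^ w) (hc2 : c < 2) :
    (P.cell ex ey ec).eval m = S.tab s x y c := by
  simp only [TabExpr.cell, eval_get, eval_add, eval_mul, eval_two, h.eval_step hs, h.D_eq, hx, hy, hc]
  norm_cast
  rw [h.prev, tabArray_cell S hxw hyw hc2]
  have h1 : x * 2 ^ w + y < 2 ^ w * 2 ^ w := by
    calc x * 2 ^ w + y < x * 2 ^ w + 2 ^ w := by omega
      _ = (x + 1) * 2 ^ w := by ring
      _ ≤ _ := Nat.mul_le_mul_right _ hxw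
  have h2 : (s + 1) * (2 ^ w * 2 ^ w) ≤ i / 2 := hs ▸ Nat.div_mul_le_self _ _
  rw [add_mul, one_mul] at h2
  omega

omit hz in
theorem eval_gate {x y : ℕ} (hx : P.x.eval m = x) (hy : P.y.eval m = y) (hxw : x < 2 ^ w)
    (hyw : y < 2 ^ w) : P.gate.eval m
      = S.gateStep (s / S.period) (s % S.period / 2) (s % S.period % 2) (S.tab s) x y (i % 2) := by
  have hz : P.z.eval m = ((if s % S.period % 2 = 0 then x else y : ℕ) : ℤ) := by
    rw [h.eval_z hs]
    rw [h.eval_x] at hx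
    rw [h.eval_y] at hy
    rw [Int.ofNat_inj.1 hx, Int.ofNat_inj.1 hy]
  have hc2 : i % 2 < 2 := Nat.mod_lt _ two_pos
  have hfl : ∀ k h' x, x < 2 ^ w → S.flipped k h' x < 2 ^ w := by
    intro k h' x hx
    rw [Sim.flipped, toNat_add_flipOffset]
    refine (xor_flipMask_lt ?_).2 hx
    have : S.pos h' < S.L := Nat.mod_lt _ h.L_pos
    have := h.w_le
    omega
  have hc' : (1 - TabExpr.comp).eval m = (1 - i % 2 : ℕ) := by
    rw [eval_sub, eval_one, h.eval_comp]
    omega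
  have hx'w : (if s % S.period % 2 = 0 then S.flipped (s / S.period) (s % S.period / 2) x else x)
      < 2 ^ w := by split_ifs; exacts [hfl _ _ _ hxw, hxw]
  have hy'w : (if s % S.period % 2 = 0 then y else S.flipped (s / S.period) (s % S.period / 2) y)
      < 2 ^ w := by split_ifs; exacts [hyw, hfl _ _ _ hyw]
  simp only [TabExpr.gate, eval_add, eval_mul, eval_sub, eval_one, eval_two,
    h.eval_cell hs hx hy h.eval_comp hxw hyw hc2,
    h.eval_cell hs (h.eval_x' hs hx) (h.eval_y' hs hy) h.eval_comp hx'w hy'w hc2,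
    h.eval_cell hs (h.eval_x' hs hx) (h.eval_y' hs hy) hc' hx'w hy'w (by omega),
    h.scale_eq, h.eval_amp hs, h.eval_sign hs hz, h.eval_reUnit hs, h.eval_imUnit hs, h.eval_side hs,
    h.eval_comp, Sim.gateStep]

omit hz in
theorem eval_shift {x y : ℕ} (hx : P.x.eval m = x) (hy : P.y.eval m = y) (hk : s / S.period < S.N) :
    P.shift.eval m = S.shiftStep (s / S.period) (S.tab s) x y (i % 2) := by
  have hc2 : i % 2 < 2 := Nat.mod_lt _ two_pos
  have hc' : (1 - TabExpr.comp).eval m = (1 - i % 2 : ℕ) := by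
    rw [eval_sub, eval_one, h.eval_comp]
    omega
  have hw1 : 2 ^ w = 2 * 2 ^ (w - 1) := by
    rw [← pow_succ']
    congr 1
    have := h.w_le; have := h.L_pos; omega
  rw [TabExpr.shift, eval_ite_lt, eval_ite_lt]
  simp only [eval_add, eval_mul, eval_two, eval_one, hx, hy, h.D_eq]
  norm_cast
  by_cases h1 : 2 * x + 1 < 2 ^ w ∧ 2 * y + 1 < 2 ^ w
  · rw [if_pos h1.1, if_pos h1.2, eval_sum, Sim.shiftStep]
    refine Finset.sum_congr rfl fun u hu => ?_
    rw [eval_sum]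
    refine Finset.sum_congr rfl fun v hv => ?_
    rw [Finset.mem_range] at hu hv
    have hxu : (2 * P.x + .const u).eval m = (2 * x + u : ℕ) := by
      simp only [eval_add, eval_mul, eval_two, hx, eval_const]; push_cast; rfl
    have hyv : (2 * P.y + .const v).eval m = (2 * y + v : ℕ) := by
      simp only [eval_add, eval_mul, eval_two, hy, eval_const]; push_cast; rfl
    simp only [TabExpr.shiftTerm, eval_add, eval_mul, eval_sub, eval_get, eval_one, eval_two, eval_four,
      h.eval_cell hs hxu hyv h.eval_comp (by omega) (by omega) hc2,
      h.eval_cell hs hxu hyv hc' (by omega) (by omega) (by omega), h.eval_comp, h.eval_site hs,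
      eval_const]
    norm_cast
    rw [h.obs_eq _ (by omega), h.obs_eq _ (by omega)]
  · have : (if 2 * x + 1 < 2 ^ w then (if 2 * y + 1 < 2 ^ w then
        (Expr.sum (fun u => Expr.sum (fun v => P.shiftTerm u v) 2) 2).eval m else (0 : Expr).eval m)
        else (0 : Expr).eval m) = 0 := by
      split_ifs <;> first | rfl | tauto
    rw [this, Sim.shiftStep]
    symm
    refine Finset.sum_eq_zero fun u _ => Finset.sum_eq_zero fun v _ => ?_
    rw [S.tab_eq_zero h.w_le h.L_pos s (by omega), S.tab_eq_zero h.w_le h.L_pos s (by omega)]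
    ring

omit hs hz in
theorem eval_entry (hi : i < 2 * ((S.N * S.period + 1) * (2 ^ w * 2 ^ w))) :
    P.entry.eval m = tabArray S w i := by
  rw [TabExpr.entry, eval_ite_lt, eval_ite_lt, h.eval_row, tabArray]
  rcases Nat.eq_zero_or_pos (i / 2 / (2 ^ w * 2 ^ w)) with h0 | h0
  · rw [h0, if_pos (by simp), eval_lt, h.eval_ctr, eval_one]
    have hlt : i / 2 < 2 ^ w * 2 ^ w := (Nat.div_eq_zero_iff.1 h0).resolve_left (by positivity)
    rw [Nat.mod_eq_of_lt hlt, Sim.tab]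
    have : (i / 2 / 2 ^ w = 0 ∧ i / 2 % 2 ^ w = 0 ∧ i % 2 = 0) ↔ i < 1 := by
      constructor
      · rintro ⟨h1, h2, h3⟩
        have := Nat.div_add_mod (i / 2) (2 ^ w)
        rw [h1, h2] at this
        omega
      · intro h1
        have : i = 0 := by omega
        subst this; simp
    simp only [this]
    norm_cast
  · obtain ⟨s, hs⟩ := Nat.exists_eq_add_of_le' h0
    rw [hs, if_neg (by push_cast; simp [eval_one]), h.eval_phase hs, eval_mul, eval_two, h.eval_gates]
    have hsN : s < S.N * S.period := by
      have h1 : i / 2 < (S.N * S.period + 1) * (2 ^ w * 2 ^ w) := by omega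
      have := (Nat.div_lt_iff_lt_mul (by positivity)).2 h1
      omega
    have hk : s / S.period < S.N := (Nat.div_lt_iff_lt_mul S.period_pos).2 hsN
    rw [h.eval_gate hs h.eval_x h.eval_y x_lt y_lt, h.eval_shift hs h.eval_x h.eval_y hk, Sim.tab]
    norm_cast
    by_cases hg : s % S.period < 2 * S.gates
    · rw [if_pos hg, if_pos hg]
    · rw [if_neg hg, if_neg hg]

end TabReady

end RAM

end SpinChain

end

section

namespace SpinChain

/-- The size of a problem, and the integers that describe the evolution. -/
structure Input where
  N : ℕ
  m : ℕ
  p : ℕ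
  time : ℤ
  coeff : ℕ → ℤ

/-- The constants of the simulation algorithm: the range `r` of the Hamiltonian, and exponents that
control the window size and the number of Trotter steps. -/
structure Params where
  r : ℕ
  a : ℕ
  b : ℕ

namespace Input

variable (I : Input) (A : Params)

/-- The size parameter, of which all others are powers. -/
def M : ℕ := I.N + I.m + 1

/-- The bound for the length of the window is the logarithm of this number. -/
def Q : ℕ := I.M ^ A.a

def w : ℕ := Nat.clog 2 (I.Q A) + 1 + A.r

/-- The number of powers of two that are tabulated. -/
def len : ℕ := I.N * I.p + I.N + I.m + I.p + I.Q A + A.r + 2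

/-- The simulation with the observables `o`. -/
def sim (o : ℕ → ℤ) : Sim where
  N := I.N
  r := A.r
  n := I.M ^ A.b
  L := Nat.clog 2 (I.Q A) + 1
  scale := (I.M ^ A.b : ℕ) * (2 ^ I.p : ℕ) * (2 ^ I.p : ℕ)
  coeff := I.coeff
  time := I.time
  obs := o

/-- The expectation value of the observables `o` in the unnormalized state of the simulation. -/
def expect (o : ℕ → ℤ) : ℤ := (I.sim A o).tab (I.N * (I.sim A o).period) 0 0 0

/-- The number of cells of the table. -/
def cells : ℕ :=
  2 * ((I.N * (I.sim A 0).period + 1) * (2 ^ I.w A * 2 ^ I.w A))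

/-- The word length `B` suffices for the counters. -/
structure Fits (B : ℕ) : Prop where
  len_lt : I.len A < B
  cells_le : RAM.bits (I.cells A : ℕ) ≤ B
  obs_le : RAM.bits (8 * I.N : ℕ) ≤ B

/-- The word length `B` suffices for the contraction of the observables `o`. -/
structure ObsFits (o : ℕ → ℤ) (B : ℕ) : Prop where
  obs_le : ∀ i, RAM.bits (o i) ≤ B
  tab_le : ∀ i < I.cells A, RAM.bits (RAM.tabArray (I.sim A o) (I.w A) i) ≤ B

end Input

namespace RAM

open SpinChain.RAM.Expr

/-- The memory contains the input. -/
structure Holds (I : Input) (m : Mem) : Prop where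
  N_eq : m 0 0 = I.N
  m_eq : m 0 1 = I.m
  p_eq : m 0 2 = I.p
  time_eq : m 0 3 = I.time
  coeff_eq : ∀ j, m 1 j = I.coeff j

theorem Holds.of_eq {I : Input} {m m' : Mem} (h : Holds I m) (h0 : m' 0 = m 0) (h1 : m' 1 = m 1) :
    Holds I m' :=
  ⟨h0 ▸ h.1, h0 ▸ h.2, h0 ▸ h.3, h0 ▸ h.4, h1 ▸ h.5⟩

/-- The memory contains the input, the powers of two, and the logarithm of `Q`. -/
structure Tables (I : Input) (A : Params) (m : Mem) : Prop extends Holds I m where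
  pow_eq : ∀ j < I.len A, m 7 j = (2 ^ j : ℕ)
  log_eq : m 9 (I.Q A) = (Nat.clog 2 (I.Q A) : ℕ)

theorem Tables.of_eq {I : Input} {A : Params} {m m' : Mem} (h : Tables I A m)
    (h' : ∀ x, x = 0 ∨ x = 1 ∨ x = 7 ∨ x = 9 → m' x = m x) : Tables I A m' where
  toHolds := h.toHolds.of_eq (h' 0 (by simp)) (h' 1 (by simp))
  pow_eq := by rw [h' 7 (by simp)]; exact h.pow_eq
  log_eq := by rw [h' 9 (by simp)]; exact h.log_eq

/-- `e ^ k`. -/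
def Expr.npow (e : Expr) : ℕ → Expr
  | 0 => 1
  | k + 1 => npow e k * e

theorem Expr.eval_npow (m : Mem) (e : Expr) (k : ℕ) : (e.npow k).eval m = e.eval m ^ k := by
  induction k with
  | zero => rw [Expr.npow, eval_one, pow_zero]
  | succ k ih => rw [Expr.npow, eval_mul, ih, pow_succ]

def nExpr : Expr := get 0 0
def mExpr : Expr := get 0 1
def pExpr : Expr := get 0 2
def sizeExpr : Expr := nExpr + mExpr + 1
def qExpr (A : Params) : Expr := sizeExpr.npow A.a
def lenExpr (A : Params) : Expr :=
  nExpr * pExpr + nExpr + mExpr + pExpr + qExpr A + .const (A.r : ℕ) + 2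
def logExpr (A : Params) : Expr := get 9 (qExpr A)

def tabExpr (A : Params) : TabExpr where
  r := A.r
  n := sizeExpr.npow A.b
  L := logExpr A + 1
  D := get 7 (logExpr A + 1 + .const (A.r : ℕ))
  scale := sizeExpr.npow A.b * get 7 pExpr * get 7 pExpr

/-- Tabulates the powers of two and the numbers `min i (log₂ Q)`. -/
def setup (A : Params) : Prog :=
  .seq (fill 8 7 (lenExpr A) (ite (lt (var 8) 1) 1 (2 * get 7 (var 8 - 1))))
    (fill 8 9 (qExpr A + 1) (ite (lt (var 8) 1) 0
      (get 9 (var 8 - 1) + lt (get 7 (get 9 (var 8 - 1))) (qExpr A))))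

namespace Holds

variable {I : Input} {A : Params} {m : Mem} (h : Holds I m)
include h

theorem eval_nExpr : nExpr.eval m = I.N := h.N_eq
theorem eval_mExpr : mExpr.eval m = I.m := h.m_eq
theorem eval_pExpr : pExpr.eval m = I.p := h.p_eq

theorem eval_sizeExpr : sizeExpr.eval m = (I.M : ℕ) := by
  rw [sizeExpr, eval_add, eval_add, h.eval_nExpr, h.eval_mExpr, eval_one, Input.M]
  push_cast; rfl

theorem eval_size_npow (k : ℕ) : (sizeExpr.npow k).eval m = (I.M ^ k : ℕ) := by
  rw [eval_npow, h.eval_sizeExpr]; push_cast; rfl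

theorem eval_qExpr : (qExpr A).eval m = (I.Q A : ℕ) := h.eval_size_npow A.a

theorem eval_lenExpr : (lenExpr A).eval m = (I.len A : ℕ) := by
  simp only [lenExpr, eval_add, eval_mul, h.eval_nExpr, h.eval_mExpr, h.eval_pExpr, h.eval_qExpr,
    eval_const, eval_two, Input.len]
  push_cast; rfl

end Holds

theorem bits_natCast_le (n : ℕ) : bits (n : ℤ) ≤ n + 1 := by
  rw [bits_le_iff, Int.natAbs_natCast]
  exact n.lt_two_pow_self

theorem bits_natCast_le_of_lt {n B : ℕ} (h : n < B) : bits (n : ℤ) ≤ B :=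
  (bits_natCast_le n).trans h

theorem bits_two_pow_le (j : ℕ) : bits ((2 ^ j : ℕ) : ℤ) ≤ j + 2 := by
  rw [bits_le_iff, Int.natAbs_natCast]
  exact Nat.pow_lt_pow_right one_lt_two (Nat.lt_succ_self j)

theorem Q_pos (I : Input) (A : Params) : 0 < I.Q A := Nat.pow_pos (Nat.succ_pos _)

theorem clog_Q_le (I : Input) (A : Params) : Nat.clog 2 (I.Q A) ≤ I.Q A :=
  Nat.clog_le_of_le_pow (Nat.lt_two_pow_self).le

/-- The cost of `setup`. -/
def setupWeight (A : Params) (I : Input) : ℕ :=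
  (I.len A + 1) * fillWeight 8 (lenExpr A) (ite (lt (var 8) 1) 1 (2 * get 7 (var 8 - 1))) +
    (I.len A + 1) * fillWeight 8 (qExpr A + 1) (ite (lt (var 8) 1) 0
      (get 9 (var 8 - 1) + lt (get 7 (get 9 (var 8 - 1))) (qExpr A)))

theorem run_setup {I : Input} {A : Params} {m : Mem} {B : ℕ} (h : Holds I m) (hB : I.len A < B) :
    ∃ m', Run B (setup A) m (setupWeight A I) m' ∧ Tables I A m' ∧
      ∀ x, x ≠ 7 → x ≠ 8 → x ≠ 9 → m' x = m x := by
  have hlen : I.Q A + 2 ≤ I.len A := by simp only [Input.len]; omega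
  set f : ℕ → ℤ := fun i => (2 ^ i : ℕ)
  set g : ℕ → ℤ := fun i => (min i (Nat.clog 2 (I.Q A)) : ℕ)
  set m₁ := fillMem m 8 7 f (I.len A) with hm₁
  have hH : ∀ i, Holds I (fillMem m 8 7 f i) := fun i =>
    h.of_eq (fillMem_of_ne (by simp) (by simp)) (fillMem_of_ne (by simp) (by simp))
  have hH' : ∀ i, Holds I (fillMem m₁ 8 9 g i) := fun i =>
    (hH _).of_eq (fillMem_of_ne (by simp) (by simp)) (fillMem_of_ne (by simp) (by simp))
  have h7 : ∀ i, ∀ j < I.len A, fillMem m₁ 8 9 g i 7 j = (2 ^ j : ℕ) := by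
    intro i j hj
    rw [fillMem_of_ne (by simp) (by simp), hm₁, fillMem_of_lt (by simp) hj]
  have r1 : Run B (fill 8 7 (lenExpr A) (ite (lt (var 8) 1) 1 (2 * get 7 (var 8 - 1)))) m
      ((I.len A + 1) * fillWeight 8 (lenExpr A) (ite (lt (var 8) 1) 1 (2 * get 7 (var 8 - 1)))) m₁ := by
    refine run_fill (n := I.len A) (f := f) (by simp) (bits_natCast_le_of_lt hB)
      (fun i hi => (bits_two_pow_le i).trans (by omega)) (fun i _ => (hH i).eval_lenExpr) ?_
    intro i hi
    have hc : (var 8).eval (fillMem m 8 7 f i) = i := fillMem_ctr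
    rw [eval_ite_lt, hc, eval_one, eval_mul, eval_two, eval_get, eval_sub, hc, eval_one]
    rcases Nat.eq_zero_or_pos i with rfl | hi0
    · simp [f]
    · obtain ⟨j, rfl⟩ := Nat.exists_eq_add_of_le' hi0
      rw [if_neg (by push_cast; omega), show ((j + 1 : ℕ) : ℤ) - 1 = (j : ℕ) by push_cast; ring,
        Int.toNat_natCast, fillMem_of_lt (by simp) (Nat.lt_succ_self j)]
      simp only [f]; push_cast; ring
  have r2 : Run B (fill 8 9 (qExpr A + 1) (ite (lt (var 8) 1) 0
      (get 9 (var 8 - 1) + lt (get 7 (get 9 (var 8 - 1))) (qExpr A)))) m₁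
      ((I.Q A + 1 + 1) * fillWeight 8 (qExpr A + 1) (ite (lt (var 8) 1) 0
        (get 9 (var 8 - 1) + lt (get 7 (get 9 (var 8 - 1))) (qExpr A))))
      (fillMem m₁ 8 9 g (I.Q A + 1)) := by
    refine run_fill (n := I.Q A + 1) (f := g) (by simp) (bits_natCast_le_of_lt (by omega))
      (fun i hi => bits_natCast_le_of_lt (by omega)) ?_ ?_
    · intro i _
      rw [eval_add, (hH' i).eval_qExpr, eval_one]; push_cast; rfl
    intro i hi
    have hc : (var 8).eval (fillMem m₁ 8 9 g i) = i := fillMem_ctr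
    rw [eval_ite_lt, hc, eval_one, eval_add, eval_lt, eval_get, eval_get, eval_get, eval_sub, hc,
      eval_one, (hH' i).eval_qExpr, eval_zero]
    rcases Nat.eq_zero_or_pos i with rfl | hi0
    · simp [g]
    · obtain ⟨j, rfl⟩ := Nat.exists_eq_add_of_le' hi0
      rw [if_neg (by push_cast; omega), show ((j + 1 : ℕ) : ℤ) - 1 = (j : ℕ) by push_cast; ring,
        Int.toNat_natCast, fillMem_of_lt (by simp) (Nat.lt_succ_self j)]
      have hc := clog_Q_le I A
      have hgj : (g j).toNat = min j (Nat.clog 2 (I.Q A)) := Int.toNat_natCast _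
      simp only [hgj, h7 _ (min j (Nat.clog 2 (I.Q A))) (by omega)]
      simp only [g]
      norm_cast
      by_cases hlt : 2 ^ min j (Nat.clog 2 (I.Q A)) < I.Q A
      · rw [if_pos hlt]
        have := (Nat.lt_clog_iff_pow_lt one_lt_two).2 hlt
        omega
      · rw [if_neg hlt]
        have := (Nat.clog_le_iff_le_pow one_lt_two).2 (not_lt.1 hlt)
        omega
  refine ⟨_, (r1.seq r2).mono ?_, ⟨hH' _, h7 _, ?_⟩, ?_⟩
  · exact Nat.add_le_add_left (Nat.mul_le_mul_right _ (by omega)) _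
  · rw [fillMem_of_lt (by simp) (Nat.lt_succ_self _)]
    simp only [g]
    rw [min_eq_right (clog_Q_le I A)]
  · intro x h7 h8 h9
    rw [fillMem_of_ne h8 h9, hm₁, fillMem_of_ne h8 h7]

/-- Contracts the chain, with the observables given by the expression `eO` for their entries. -/
def contract (A : Params) (eO : Expr) : Prog :=
  .seq (fill 8 5 (8 * nExpr) eO)
    (fill 8 6 (2 * ((nExpr * (tabExpr A).period + 1) * ((tabExpr A).D * (tabExpr A).D)))
      (tabExpr A).entry)

/-- The result of `contract`. -/
def resultExpr (A : Params) : Expr :=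
  get 6 (2 * (nExpr * (tabExpr A).period * ((tabExpr A).D * (tabExpr A).D)))

/-- The cost of `contract`. -/
def contractWeight (A : Params) (eO : Expr) (I : Input) : ℕ :=
  (8 * I.N + 1) * fillWeight 8 (8 * nExpr) eO +
    (I.cells A + 1) * fillWeight 8
      (2 * ((nExpr * (tabExpr A).period + 1) * ((tabExpr A).D * (tabExpr A).D))) (tabExpr A).entry

section

variable {I : Input} {A : Params} {m : Mem} (h : Tables I A m)
include h

theorem Tables.eval_logExpr : (logExpr A).eval m = (Nat.clog 2 (I.Q A) : ℕ) := by
  rw [logExpr, eval_get, h.eval_qExpr, Int.toNat_natCast, h.log_eq]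

theorem Tables.pow_eq' {j : ℕ} (hj : j ≤ I.w A) : m 7 j = (2 ^ j : ℕ) := by
  refine h.pow_eq _ ?_
  have := clog_Q_le I A
  simp only [Input.w, Input.len] at *
  omega

theorem Tables.eval_D : (tabExpr A).D.eval m = (2 ^ I.w A : ℕ) := by
  simp only [tabExpr, eval_get, eval_add, h.eval_logExpr, eval_one, eval_const]
  rw [← h.pow_eq' le_rfl]
  congr 1

theorem Tables.eval_L : (tabExpr A).L.eval m = (Nat.clog 2 (I.Q A) + 1 : ℕ) := by
  simp only [tabExpr, eval_add, h.eval_logExpr, eval_one]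
  push_cast; rfl

theorem Tables.eval_period : (tabExpr A).period.eval m = ((I.sim A 0).period : ℕ) := by
  simp only [TabExpr.period, TabExpr.gates, TabExpr.fourPow, eval_add, eval_mul, eval_two, eval_one,
    h.eval_L, eval_const, Sim.period, Sim.gates]
  rw [show (tabExpr A).n = sizeExpr.npow A.b from rfl, h.eval_size_npow]
  simp only [Input.sim, tabExpr]
  push_cast; rfl

theorem Tables.eval_scale : (tabExpr A).scale.eval m = (I.sim A 0).scale := by
  simp only [tabExpr, eval_mul, eval_get, h.eval_size_npow, h.eval_pExpr, Int.toNat_natCast]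
  rw [h.pow_eq _ (by simp only [Input.len]; omega)]
  rfl

theorem Tables.ready {o : ℕ → ℤ} {i : ℕ} (h5 : ∀ j < 8 * I.N, m 5 j = o j) (h8 : m 8 0 = i)
    (h6 : ∀ j < i, m 6 j = tabArray (I.sim A o) (I.w A) j) :
    TabReady (tabExpr A) (I.sim A o) (I.w A) i m where
  r_eq := rfl
  n_eq := h.eval_size_npow _
  L_eq := h.eval_L
  D_eq := h.eval_D
  scale_eq := h.eval_scale
  N_eq := h.N_eq
  time_eq := h.time_eq
  coeff_eq := h.coeff_eq
  obs_eq := h5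
  pow_eq := fun _ hj => h.pow_eq' hj
  ctr_eq := h8
  prev := h6
  w_le := le_rfl
  L_pos := Nat.succ_pos _

theorem run_contract {eO : Expr} {o : ℕ → ℤ} {B : ℕ} (hB : I.Fits A B) (ho : I.ObsFits A o B)
    (he : ∀ i < 8 * I.N, ∀ m' : Mem, (∀ x, x ≠ 5 → x ≠ 8 → m' x = m x) → m' 8 0 = i →
      eO.eval m' = o i) :
    ∃ m', Run B (contract A eO) m (contractWeight A eO I) m' ∧
      (resultExpr A).eval m' = I.expect A o ∧ ∀ x, x ≠ 5 → x ≠ 6 → x ≠ 8 → m' x = m x := by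
  set m₁ := fillMem m 8 5 o (8 * I.N) with hm₁
  set T := tabArray (I.sim A o) (I.w A)
  have hne : ∀ i x, x ≠ 5 → x ≠ 8 → fillMem m 8 5 o i x = m x := fun i x h5 h8 => fillMem_of_ne h8 h5
  have hT₁ : ∀ i, Tables I A (fillMem m 8 5 o i) := fun i =>
    h.of_eq fun x hx => hne i x (by omega) (by omega)
  have hT₂ : ∀ i, Tables I A (fillMem m₁ 8 6 T i) := fun i =>
    (hT₁ (8 * I.N)).of_eq fun x hx => fillMem_of_ne (by omega) (by omega)
  have r1 : Run B (fill 8 5 (8 * nExpr) eO) m ((8 * I.N + 1) * fillWeight 8 (8 * nExpr) eO) m₁ := by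
    refine run_fill (n := 8 * I.N) (f := o) (by simp) hB.obs_le (fun i _ => ho.obs_le i) ?_ ?_
    · intro i _
      rw [eval_mul, (hT₁ i).eval_nExpr]
      push_cast; rfl
    · exact fun i hi => he i hi _ (hne i) fillMem_ctr
  have hcells : ∀ i, (2 * ((nExpr * (tabExpr A).period + 1) *
      ((tabExpr A).D * (tabExpr A).D))).eval (fillMem m₁ 8 6 T i) = (I.cells A : ℕ) := by
    intro i
    simp only [eval_mul, eval_add, eval_two, eval_one, (hT₂ i).eval_nExpr, (hT₂ i).eval_D,
      (hT₂ i).eval_period, Input.cells]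
    push_cast; rfl
  have r2 : Run B (fill 8 6 (2 * ((nExpr * (tabExpr A).period + 1) *
      ((tabExpr A).D * (tabExpr A).D))) (tabExpr A).entry) m₁ ((I.cells A + 1) * fillWeight 8
      (2 * ((nExpr * (tabExpr A).period + 1) * ((tabExpr A).D * (tabExpr A).D))) (tabExpr A).entry)
      (fillMem m₁ 8 6 T (I.cells A)) := by
    refine run_fill (n := I.cells A) (f := T) (by simp) hB.cells_le ho.tab_le
      (fun i _ => hcells i) ?_
    intro i hi
    refine ((hT₂ i).ready ?_ fillMem_ctr ?_).eval_entry hi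
    · intro j hj
      rw [fillMem_of_ne (by simp) (by simp), hm₁, fillMem_of_lt (by simp) hj]
    · exact fun j hj => fillMem_of_lt (by simp) hj
  refine ⟨_, r1.seq r2, ?_, ?_⟩
  · simp only [resultExpr, eval_mul, eval_two, (hT₂ _).eval_nExpr, (hT₂ _).eval_D,
      (hT₂ _).eval_period, eval_get]
    norm_cast
    have hpos : 0 < 2 ^ I.w A * 2 ^ I.w A := by positivity
    rw [fillMem_of_lt (by simp)]
    · have := tabArray_cell (I.sim A o) (w := I.w A) (s := I.N * (I.sim A 0).period) (x := 0) (y := 0)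
        (c := 0) (by positivity) (by positivity) two_pos
      simp only [zero_mul, add_zero] at this
      exact this
    · rw [Input.cells, add_mul]
      omega
  · intro x h5 h6 h8
    rw [fillMem_of_ne h8 h6, hm₁, fillMem_of_ne h8 h5]

end

end RAM

end SpinChain

end

section

namespace SpinChain

/-- Whether the outcome `u` agrees with the letter `q` of a query, where `2` allows all outcomes. -/
def agree (q : ℤ) (u : ℕ) : ℤ := if 1 < q then 1 else if q = u then 1 else 0

/-- The entries of diagonal matrices, as an array of observables. -/
def diagArray (P : ℕ → ℕ → ℤ) (i : ℕ) : ℤ :=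
  if i % 2 = 0 ∧ i / 4 % 2 = i / 2 % 2 then P (i / 8) (i / 4 % 2) else 0

/-- The real and the imaginary parts of the entries of matrices, as an array of observables. -/
def entryArray (x y : ℕ → ℤ) (i : ℕ) : ℤ := if i % 2 = 0 then x (i / 2) else y (i / 2)

/-- The query that prescribes the outcomes `s` on the first `j` sites, and `0` on the next. -/
def prefixQuery (s : ℕ → ℤ) (j k : ℕ) : ℤ := if k < j then s k else if j < k then 2 else 0

namespace Input

variable (I : Input) (A : Params)

/-- The number of coin flips. -/
def coins : ℕ := I.N + I.m + I.p

/-- The normalization of the state of the simulation. -/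
def total : ℤ := I.expect A (diagArray fun _ _ => 1)

/-- The weight of the outcomes `s` on the first `j` sites, and `0` on the next. -/
def prefixWeight (s : ℕ → ℤ) (j : ℕ) : ℤ :=
  I.expect A (diagArray fun k u => agree (prefixQuery s j k) u)

/-- The outcomes on the first `j` sites, and the weight of the smaller outcomes, in the inversion of
the cumulative distribution at `u / 2 ^ coins`. -/
def sample (u : ℤ) : ℕ → (ℕ → ℤ) × ℤ
  | 0 => (0, 0)
  | j + 1 =>
    if u * I.total A < ((sample u j).2 + I.prefixWeight A (sample u j).1 j) * (2 ^ I.coins : ℕ)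
    then (Function.update (sample u j).1 j 0, (sample u j).2)
    else (Function.update (sample u j).1 j 1, (sample u j).2 + I.prefixWeight A (sample u j).1 j)

end Input

namespace RAM

open SpinChain.RAM.Expr

/-- Equality. -/
def eqExpr (x y : Expr) : Expr := ite (lt x y) 0 (ite (lt y x) 0 1)

theorem eval_eqExpr (m : Mem) (x y : Expr) :
    (eqExpr x y).eval m = if x.eval m = y.eval m then 1 else 0 := by
  rw [eqExpr, eval_ite_lt, eval_ite_lt, eval_zero, eval_one]
  split_ifs <;> first | rfl | omega

def siteExpr : Expr := var 8 / .const 8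
def rowExpr : Expr := (var 8 / .const 4).mod 2
def colExpr : Expr := (var 8 / .const 2).mod 2

def agreeExpr (q : Expr) : Expr := ite (lt 1 q) 1 (eqExpr q rowExpr)

def diagExpr (e : Expr) : Expr := ite (lt ((var 8).mod 2) 1) (eqExpr rowExpr colExpr * e) 0

def entryExpr : Expr :=
  ite (lt ((var 8).mod 2) 1) (get 2 (var 8 / .const 2)) (get 3 (var 8 / .const 2))

section

variable {m : Mem} {i : ℕ} (h : m 8 0 = i)
include h

theorem eval_var_eight : (var 8).eval m = i := h

theorem eval_siteExpr : siteExpr.eval m = (i / 8 : ℕ) := by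
  rw [siteExpr, eval_div, eval_var_eight h, eval_const]; push_cast; rfl

theorem eval_rowExpr : rowExpr.eval m = (i / 4 % 2 : ℕ) := by
  rw [rowExpr, eval_mod, eval_div, eval_var_eight h, eval_const, eval_two]; push_cast; rfl

theorem eval_colExpr : colExpr.eval m = (i / 2 % 2 : ℕ) := by
  rw [colExpr, eval_mod, eval_div, eval_var_eight h, eval_const, eval_two]; push_cast; rfl

theorem eval_agreeExpr (q : Expr) : (agreeExpr q).eval m = agree (q.eval m) (i / 4 % 2) := by
  rw [agreeExpr, eval_ite_lt, eval_eqExpr, eval_rowExpr h, eval_one]; rfl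

theorem eval_diagExpr {e : Expr} {P : ℕ → ℕ → ℤ} (he : e.eval m = P (i / 8) (i / 4 % 2)) :
    (diagExpr e).eval m = diagArray P i := by
  rw [diagExpr, eval_ite_lt, eval_mul, eval_eqExpr, eval_rowExpr h, eval_colExpr h, eval_mod,
    eval_var_eight h, he, eval_one, eval_two, eval_zero, diagArray]
  norm_cast
  by_cases h1 : i % 2 = 0
  · by_cases h2 : i / 4 % 2 = i / 2 % 2
    · rw [if_pos (by omega), if_pos h2, if_pos ⟨h1, h2⟩]; push_cast; ring
    · rw [if_pos (by omega), if_neg h2, if_neg (by tauto)]; push_cast; ring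
  · rw [if_neg (by omega), if_neg (by tauto)]

theorem eval_entryExpr : entryExpr.eval m = entryArray (m 2) (m 3) i := by
  rw [entryExpr, eval_ite_lt, eval_mod, eval_get _ (var 8 / .const 2), eval_get _ (var 8 / .const 2),
    eval_div, eval_var_eight h, eval_one, eval_two, eval_const, entryArray]
  norm_cast
  by_cases h1 : i % 2 = 0
  · rw [if_pos (by omega), if_pos h1]
  · rw [if_neg (by omega), if_neg h1]

end

theorem bits_expect_le {I : Input} {A : Params} {o : ℕ → ℤ} {B : ℕ} (h : I.ObsFits A o B) :
    bits (I.expect A o) ≤ B := by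
  have h1 := h.tab_le (2 * (I.N * (I.sim A o).period * (2 ^ I.w A * 2 ^ I.w A)
    + 0 * 2 ^ I.w A + 0) + 0)
  rw [tabArray_cell _ (by positivity) (by positivity) two_pos] at h1
  refine h1 ?_
  have : 0 < 2 ^ I.w A * 2 ^ I.w A := by positivity
  have e : (I.sim A o).period = (I.sim A 0).period := rfl
  rw [Input.cells, add_mul, e]
  omega

/-- The program for marginal and conditional probabilities. -/
def probabilityProg (A : Params) : Prog :=
  .seq (setup A) (.seq (contract A (diagExpr (agreeExpr (get 2 siteExpr))))
    (.seq (.assign 10 (.const 0) (resultExpr A))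
      (.seq (contract A (diagExpr (agreeExpr (get 2 siteExpr) * agreeExpr (get 3 siteExpr))))
        (.seq (.assign 4 (.const 0) (resultExpr A)) (.assign 4 (.const 1) (var 10))))))

/-- Its cost. -/
def probabilityWeight (A : Params) (I : Input) : ℕ :=
  setupWeight A I + (contractWeight A (diagExpr (agreeExpr (get 2 siteExpr))) I +
    (assignWeight (.const 0) (resultExpr A) +
      (contractWeight A (diagExpr (agreeExpr (get 2 siteExpr) * agreeExpr (get 3 siteExpr))) I +
        (assignWeight (.const 0) (resultExpr A) + assignWeight (.const 1) (var 10)))))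

theorem run_probabilityProg {I : Input} {A : Params} {m : Mem} {B : ℕ} (h : Holds I m)
    (hB : I.Fits A B)
    (ho : I.ObsFits A (diagArray fun k u => agree (m 2 k) u) B)
    (ho' : I.ObsFits A (diagArray fun k u => agree (m 2 k) u * agree (m 3 k) u) B) :
    ∃ m', Run B (probabilityProg A) m (probabilityWeight A I) m' ∧
      m' 4 0 = I.expect A (diagArray fun k u => agree (m 2 k) u * agree (m 3 k) u) ∧
      m' 4 1 = I.expect A (diagArray fun k u => agree (m 2 k) u) := by
  obtain ⟨m₁, r1, t1, e1⟩ := run_setup h hB.len_lt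
  have hq : ∀ (x : ℕ) (m' : Mem) i, (m' : Mem) 8 0 = (i : ℕ) →
      (get x siteExpr).eval m' = m' x (i / 8) := by
    intro x m' i hi
    rw [eval_get, eval_siteExpr hi, Int.toNat_natCast]
  obtain ⟨m₂, r2, v2, e2⟩ := run_contract t1 (eO := diagExpr (agreeExpr (get 2 siteExpr))) hB ho (by
    intro i _ m' hm' hi
    refine eval_diagExpr hi ?_
    rw [eval_agreeExpr hi, hq 2 m' i hi, hm' 2 (by simp) (by simp), e1 2 (by simp) (by simp) (by simp)])
  have r3 := run_assign (B := B) (m := m₂) 10 (.const 0) (resultExpr A) (j := 0) rfl v2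
    (bits_expect_le ho)
  set m₃ := write m₂ 10 0 (I.expect A (diagArray fun k u => agree (m 2 k) u)) with hm₃
  have e3 : ∀ x, x ≠ 5 → x ≠ 6 → x ≠ 8 → x ≠ 10 → m₃ x = m₁ x := by
    intro x h5 h6 h8 h10
    rw [hm₃, write, Function.update_of_ne h10, e2 x h5 h6 h8]
  have t3 : Tables I A m₃ := t1.of_eq fun x hx => e3 x (by omega) (by omega) (by omega) (by omega)
  obtain ⟨m₄, r4, v4, e4⟩ := run_contract t3
    (eO := diagExpr (agreeExpr (get 2 siteExpr) * agreeExpr (get 3 siteExpr))) hB ho' (by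
    intro i _ m' hm' hi
    refine eval_diagExpr hi ?_
    rw [eval_mul, eval_agreeExpr hi, eval_agreeExpr hi, hq 2 m' i hi, hq 3 m' i hi,
      hm' 2 (by simp) (by simp), hm' 3 (by simp) (by simp), e3 2 (by simp) (by simp) (by simp) (by simp),
      e3 3 (by simp) (by simp) (by simp) (by simp), e1 2 (by simp) (by simp) (by simp),
      e1 3 (by simp) (by simp) (by simp)])
  have r5 := run_assign (B := B) (m := m₄) 4 (.const 0) (resultExpr A) (j := 0) rfl v4
    (bits_expect_le ho')
  have r6 := run_assign (B := B) (m := write m₄ 4 0 (I.expect A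
    (diagArray fun k u => agree (m 2 k) u * agree (m 3 k) u))) 4 (.const 1) (var 10) (j := 1)
    (v := I.expect A (diagArray fun k u => agree (m 2 k) u)) rfl (by
      simp only [var, eval_get, eval_const, write]
      rw [Function.update_of_ne (by simp), e4 10 (by simp) (by simp) (by simp), hm₃, write]
      simp) (bits_expect_le ho)
  refine ⟨_, r1.seq (r2.seq (r3.seq (r4.seq (r5.seq r6)))), ?_, ?_⟩ <;> simp [write]

/-- The program for expectation values of observables. -/
def observableProg (A : Params) : Prog :=
  .seq (setup A) (.seq (contract A entryExpr)
    (.seq (.assign 10 (.const 0) (resultExpr A))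
      (.seq (contract A (diagExpr 1))
        (.seq (.assign 4 (.const 1) (resultExpr A * get 7 (nExpr * pExpr)))
          (.assign 4 (.const 0) (var 10))))))

/-- Its cost. -/
def observableWeight (A : Params) (I : Input) : ℕ :=
  setupWeight A I + (contractWeight A entryExpr I +
    (assignWeight (.const 0) (resultExpr A) +
      (contractWeight A (diagExpr 1) I +
        (assignWeight (.const 1) (resultExpr A * get 7 (nExpr * pExpr)) +
          assignWeight (.const 0) (var 10)))))

theorem run_observableProg {I : Input} {A : Params} {m : Mem} {B : ℕ} (h : Holds I m)
    (hB : I.Fits A B)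
    (ho : I.ObsFits A (entryArray (m 2) (m 3)) B)
    (ho' : I.ObsFits A (diagArray fun _ _ => 1) B)
    (hB' : bits (I.total A * (2 ^ (I.N * I.p) : ℕ)) ≤ B) :
    ∃ m', Run B (observableProg A) m (observableWeight A I) m' ∧
      m' 4 0 = I.expect A (entryArray (m 2) (m 3)) ∧
      m' 4 1 = I.total A * (2 ^ (I.N * I.p) : ℕ) := by
  obtain ⟨m₁, r1, t1, e1⟩ := run_setup h hB.len_lt
  obtain ⟨m₂, r2, v2, e2⟩ := run_contract t1 (eO := entryExpr) hB ho (by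
    intro i _ m' hm' hi
    rw [eval_entryExpr hi, hm' 2 (by simp) (by simp), hm' 3 (by simp) (by simp),
      e1 2 (by simp) (by simp) (by simp), e1 3 (by simp) (by simp) (by simp)])
  have r3 := run_assign (B := B) (m := m₂) 10 (.const 0) (resultExpr A) (j := 0) rfl v2
    (bits_expect_le ho)
  set m₃ := write m₂ 10 0 (I.expect A (entryArray (m 2) (m 3))) with hm₃
  have e3 : ∀ x, x ≠ 5 → x ≠ 6 → x ≠ 8 → x ≠ 10 → m₃ x = m₁ x := by
    intro x h5 h6 h8 h10
    rw [hm₃, write, Function.update_of_ne h10, e2 x h5 h6 h8]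
  have t3 : Tables I A m₃ := t1.of_eq fun x hx => e3 x (by omega) (by omega) (by omega) (by omega)
  obtain ⟨m₄, r4, v4, e4⟩ := run_contract t3 (eO := diagExpr 1) hB ho' (by
    intro i _ m' hm' hi
    exact eval_diagExpr hi (eval_one _))
  have t4 : Tables I A m₄ := t3.of_eq fun x hx => e4 x (by omega) (by omega) (by omega)
  have r5 := run_assign (B := B) (m := m₄) 4 (.const 1) (resultExpr A * get 7 (nExpr * pExpr)) (j := 1)
    (v := I.total A * (2 ^ (I.N * I.p) : ℕ)) rfl (by
      rw [eval_mul, v4, eval_get, eval_mul, t4.eval_nExpr, t4.eval_pExpr]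
      norm_cast
      rw [t4.pow_eq _ (by simp only [Input.len]; omega), Input.total]) hB'
  have r6 := run_assign (B := B) (m := write m₄ 4 1 (I.total A * (2 ^ (I.N * I.p) : ℕ)))
    4 (.const 0) (var 10) (j := 0) (v := I.expect A (entryArray (m 2) (m 3))) rfl (by
      simp only [var, eval_get, eval_const, write]
      rw [Function.update_of_ne (by simp), e4 10 (by simp) (by simp) (by simp), hm₃, write]
      simp) (bits_expect_le ho)
  refine ⟨_, r1.seq (r2.seq (r3.seq (r4.seq (r5.seq r6)))), ?_, ?_⟩ <;> simp [write]

def coinsExpr : Expr := nExpr + mExpr + pExpr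

/-- The query in the sampling of site `var 13`. -/
def prefixExpr : Expr :=
  ite (lt siteExpr (var 13)) (get 4 siteExpr) (ite (lt (var 13) siteExpr) 2 0)

/-- The sampling of one site. -/
def sampleBody (A : Params) : Prog :=
  .seq (contract A (diagExpr (agreeExpr prefixExpr)))
    (.cond (lt (get 12 coinsExpr * var 14) ((var 15 + resultExpr A) * get 7 coinsExpr))
      (.assign 4 (var 13) 0)
      (.seq (.assign 15 (.const 0) (var 15 + resultExpr A)) (.assign 4 (var 13) 1)))

def coinExpr : Expr :=
  ite (lt (var 8) 1) 0 (get 12 (var 8 - 1) + get 2 (var 8 - 1) * get 7 (var 8 - 1))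

/-- The program for sampling. -/
def sampleProg (A : Params) : Prog :=
  .seq (setup A) (.seq (fill 8 12 (coinsExpr + 1) coinExpr)
    (.seq (contract A (diagExpr 1)) (.seq (.assign 14 (.const 0) (resultExpr A))
      (.seq (.assign 15 (.const 0) 0) (forLoop 13 nExpr (sampleBody A))))))

def sampleBodyWeight (A : Params) (I : Input) : ℕ :=
  contractWeight A (diagExpr (agreeExpr prefixExpr)) I +
    ((lt (get 12 coinsExpr * var 14) ((var 15 + resultExpr A) * get 7 coinsExpr)).weight + 1 +
      assignWeight (var 13) 0 +
      (assignWeight (.const 0) (var 15 + resultExpr A) + assignWeight (var 13) 1))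

/-- Its cost. -/
def sampleWeight (A : Params) (I : Input) : ℕ :=
  setupWeight A I + ((I.coins + 2) * fillWeight 8 (coinsExpr + 1) coinExpr +
    (contractWeight A (diagExpr 1) I + (assignWeight (.const 0) (resultExpr A) +
      (assignWeight (.const 0) 0 +
        (I.N + 1) * (sampleBodyWeight A I + loopWeight 13 nExpr)))))

/-- The number with the given binary digits. -/
def binary (x : ℕ → ℤ) (R : ℕ) : ℤ := ∑ l ∈ Finset.range R, x l * (2 ^ l : ℕ)

theorem abs_binary_lt {x : ℕ → ℤ} {R : ℕ} (hx : ∀ l < R, |x l| ≤ 1) : |binary x R| < 2 ^ R := by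
  induction R with
  | zero => simp [binary]
  | succ R ih =>
    have h1 := ih fun l hl => hx l (by omega)
    rw [binary, Finset.sum_range_succ, ← binary]
    have h2 : |x R * (2 ^ R : ℕ)| ≤ 2 ^ R := by
      rw [abs_mul, Nat.abs_cast]
      push_cast
      exact mul_le_of_le_one_left (by positivity) (hx R (by omega))
    have := abs_add_le (binary x R) (x R * (2 ^ R : ℕ))
    rw [pow_succ]
    omega

theorem run_sampleProg {I : Input} {A : Params} {m : Mem} {B : ℕ} (h : Holds I m)
    (hB : I.Fits A B) (hm4 : m 4 = 0) (hx : ∀ l < I.coins, |m 2 l| ≤ 1)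
    (ho : I.ObsFits A (diagArray fun _ _ => 1) B)
    (ho' : ∀ s : ℕ → ℤ, ∀ j, I.ObsFits A (diagArray fun k u => agree (prefixQuery s j k) u) B)
    (hc : ∀ j ≤ I.N, bits (I.sample A (binary (m 2) I.coins) j).2 ≤ B) :
    ∃ m', Run B (sampleProg A) m (sampleWeight A I) m' ∧
      m' 4 = (I.sample A (binary (m 2) I.coins) I.N).1 := by
  have hlen : I.coins + 2 ≤ I.len A := by simp only [Input.len, Input.coins]; omega
  have hcE : ∀ {m : Mem}, Holds I m → coinsExpr.eval m = (I.coins : ℕ) := by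
    intro m h
    rw [coinsExpr, eval_add, eval_add, h.eval_nExpr, h.eval_mExpr, h.eval_pExpr, Input.coins]
    push_cast; rfl
  obtain ⟨m₁, r1, t1, e1⟩ := run_setup h hB.len_lt
  set f := binary (m 2) with hf
  set u := binary (m 2) I.coins with hu
  have t1' : ∀ i, Tables I A (fillMem m₁ 8 12 f i) := fun i =>
    t1.of_eq fun x hx => fillMem_of_ne (by omega) (by omega)
  have r2 : Run B (fill 8 12 (coinsExpr + 1) coinExpr) m₁
      ((I.coins + 2) * fillWeight 8 (coinsExpr + 1) coinExpr)
      (fillMem m₁ 8 12 f (I.coins + 1)) := by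
    refine run_fill (n := I.coins + 1) (f := f) (by simp)
      (bits_natCast_le_of_lt (by have := hB.len_lt; omega)) ?_ ?_ ?_
    · intro i hi
      have := hB.len_lt
      exact (bits_le_of_abs_lt (abs_binary_lt fun l hl => hx l (by omega))).trans (by omega)
    · intro i _
      rw [eval_add, hcE (t1' i).toHolds, eval_one]
      push_cast; rfl
    · intro i hi
      have hc8 : (var 8).eval (fillMem m₁ 8 12 f i) = i := fillMem_ctr
      rw [coinExpr, eval_ite_lt, eval_add, eval_mul, eval_get _ (var 8 - 1),
        eval_get _ (var 8 - 1), eval_get _ (var 8 - 1), eval_sub, hc8, eval_one, eval_zero]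
      rcases Nat.eq_zero_or_pos i with rfl | hi0
      · simp [hf, binary]
      · obtain ⟨j, rfl⟩ := Nat.exists_eq_add_of_le' hi0
        rw [if_neg (by push_cast; omega), show ((j + 1 : ℕ) : ℤ) - 1 = (j : ℕ) by push_cast; ring,
          Int.toNat_natCast, fillMem_of_lt (by simp) (Nat.lt_succ_self j),
          (t1' _).pow_eq _ (by omega), fillMem_of_ne (by simp) (by simp),
          e1 2 (by simp) (by simp) (by simp)]
        exact (Finset.sum_range_succ _ _).symm
  set m₂ := fillMem m₁ 8 12 f (I.coins + 1) with hm₂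
  have h12 : m₂ 12 I.coins = u := fillMem_of_lt (by simp) (Nat.lt_succ_self _)
  have t2 : Tables I A m₂ := t1' _
  obtain ⟨m₃, r3, v3, e3⟩ := run_contract t2 (eO := diagExpr 1) hB ho (by
    intro i _ m' hm' hi
    exact eval_diagExpr hi (eval_one _))
  have r4 := run_assign (B := B) (m := m₃) 14 (.const 0) (resultExpr A) (j := 0) rfl v3
    (bits_expect_le ho)
  set m₄ := write m₃ 14 0 (I.expect A (diagArray fun _ _ => 1)) with hm₄
  have hB2 : bits 0 ≤ B := (bits_mono (by simp)).trans (bits_expect_le ho)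
  have hB3 : bits 1 ≤ B := bits_natCast_le_of_lt (n := 1) (by have := hB.len_lt; omega)
  have r5 := run_assign (B := B) (m := m₄) 15 (.const 0) 0 (j := 0) rfl (eval_zero _) hB2
  set m₅ := write m₄ 15 0 0 with hm₅
  have e5 : ∀ x, x ≠ 5 → x ≠ 6 → x ≠ 8 → x ≠ 14 → x ≠ 15 → m₅ x = m₂ x := by
    intro x h5 h6 h8 h14 h15
    rw [hm₅, write, Function.update_of_ne h15, hm₄, write, Function.update_of_ne h14, e3 x h5 h6 h8]
  obtain ⟨m', r6, hI⟩ := run_forLoop (B := B) (ctr := 13) (bound := nExpr) (c := sampleBody A)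
    (n := I.N) (K := sampleBodyWeight A I) (m := m₅)
    (fun j m => Tables I A m ∧ m 13 0 = j ∧ m 12 I.coins = u ∧ m 14 0 = I.total A ∧
      m 15 0 = (I.sample A u j).2 ∧ m 4 = (I.sample A u j).1)
    (bits_natCast_le_of_lt (by have := hB.len_lt; simp only [Input.coins] at hlen; omega))
    (by
      refine ⟨t2.of_eq fun x hx => ?_, by simp [write], ?_, ?_, ?_, ?_⟩
      · rw [write, Function.update_of_ne (by omega)]
        exact e5 x (by omega) (by omega) (by omega) (by omega) (by omega)
      · rw [write, Function.update_of_ne (by simp), e5 12 (by simp) (by simp) (by simp) (by simp) (by simp),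
          h12]
      · rw [write, Function.update_of_ne (by simp), hm₅, write, Function.update_of_ne (by simp), hm₄]
        simp [write, Input.total]
      · rw [write, Function.update_of_ne (by simp), hm₅]
        simp [write, Input.sample]
      · rw [write, Function.update_of_ne (by simp), e5 4 (by simp) (by simp) (by simp) (by simp) (by simp),
          hm₂, fillMem_of_ne (by simp) (by simp), e1 4 (by simp) (by simp) (by simp), hm4]
        rfl)
    (by
      rintro i hi m ⟨t, h13, -⟩
      exact ⟨h13, t.eval_nExpr⟩)
    (by
      rintro j hj m ⟨t, h13, h12, h14, h15, h4⟩
      set s := (I.sample A u j).1 with hs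
      set cum := (I.sample A u j).2 with hcum
      obtain ⟨k₁, q1, v1, g1⟩ := run_contract t (eO := diagExpr (agreeExpr prefixExpr)) hB (ho' s j) (by
        intro i _ m' hm' hi
        refine eval_diagExpr hi ?_
        have h13' : (var 13).eval m' = j := by
          simp only [var, eval_get]; rw [hm' 13 (by simp) (by simp)]; exact h13
        rw [eval_agreeExpr hi, prefixExpr, eval_ite_lt, eval_ite_lt, eval_get _ siteExpr, eval_siteExpr hi, h13',
          hm' 4 (by simp) (by simp), h4, eval_two, eval_zero, Int.toNat_natCast]
        simp only [Nat.cast_lt, prefixQuery])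
      have tk : Tables I A k₁ := t.of_eq fun x hx => g1 x (by omega) (by omega) (by omega)
      have w13 : (var 13).eval k₁ = j := by
        simp only [var, eval_get]; rw [g1 13 (by simp) (by simp) (by simp)]; exact h13
      have w14 : (var 14).eval k₁ = I.total A := by
        simp only [var, eval_get]; rw [g1 14 (by simp) (by simp) (by simp)]; exact h14
      have w15 : (var 15).eval k₁ = cum := by
        simp only [var, eval_get]; rw [g1 15 (by simp) (by simp) (by simp)]; exact h15
      have w12 : (get 12 coinsExpr).eval k₁ = u := by
        rw [eval_get, hcE tk.toHolds, Int.toNat_natCast, g1 12 (by simp) (by simp) (by simp), h12]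
      have w7 : (get 7 coinsExpr).eval k₁ = (2 ^ I.coins : ℕ) := by
        rw [eval_get, hcE tk.toHolds, Int.toNat_natCast, tk.pow_eq _ (by omega)]
      have g4 : k₁ 4 = s := by rw [g1 4 (by simp) (by simp) (by simp), h4]
      have hstep : I.sample A u (j + 1) =
          if u * I.total A < (cum + I.prefixWeight A s j) * (2 ^ I.coins : ℕ)
          then (Function.update s j 0, cum) else (Function.update s j 1, cum + I.prefixWeight A s j) :=
        rfl
      have hbool : (lt (get 12 coinsExpr * var 14)
          ((var 15 + resultExpr A) * get 7 coinsExpr)).eval k₁ =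
          if u * I.total A < (cum + I.prefixWeight A s j) * (2 ^ I.coins : ℕ) then 1 else 0 := by
        rw [eval_lt, eval_mul, eval_mul, eval_add, w12, w14, w15, w7, v1, Input.prefixWeight]
      refine ⟨write (write k₁ 15 0 (I.sample A u (j + 1)).2) 4 j ((I.sample A u (j + 1)).1 j),
        q1.seq (run_cond ?_ ?_), ?_, ?_⟩
      · intro hne
        have hlt : u * I.total A < (cum + I.prefixWeight A s j) * (2 ^ I.coins : ℕ) := by
          by_contra hcon; rw [hbool, if_neg hcon] at hne; exact hne rfl
        rw [if_pos hlt] at hstep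
        rw [hstep]
        have hk : write k₁ 15 0 cum = k₁ := by
          have : k₁ 15 0 = cum := w15
          rw [write, ← this, Function.update_eq_self, Function.update_eq_self]
        simp only [hk, Function.update_self]
        exact run_assign 4 (var 13) 0 (by rw [w13, Int.toNat_natCast]) (eval_zero _) hB2
      · intro hne
        have hlt : ¬ u * I.total A < (cum + I.prefixWeight A s j) * (2 ^ I.coins : ℕ) := by
          intro hcon; rw [hbool, if_pos hcon] at hne; exact one_ne_zero hne
        have hbb := hc (j + 1) hj
        rw [if_neg hlt] at hstep
        rw [hstep] at hbb ⊢
        simp only [Function.update_self] at hbb ⊢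
        refine (run_assign 15 (.const 0) (var 15 + resultExpr A) (j := 0) rfl (by rw [eval_add, w15, v1]; rfl)
          hbb).seq (run_assign 4 (var 13) 1 ?_ (eval_one _) hB3)
        have : (var 13).eval (write k₁ 15 0 (cum + I.prefixWeight A s j)) = (var 13).eval k₁ := by
          simp [var, write]
        rw [this, w13, Int.toNat_natCast]
      · rw [write, Function.update_of_ne (by simp), write, Function.update_of_ne (by simp)]
        exact w13
      · have hne : ∀ x, x ≠ 4 → x ≠ 13 → x ≠ 15 →
            write (write (write k₁ 15 0 (I.sample A u (j + 1)).2) 4 j ((I.sample A u (j + 1)).1 j)) 13 0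
              ((j + 1 : ℕ) : ℤ) x = k₁ x := by
          intro x h4 h13 h15
          rw [write, Function.update_of_ne h13, write, Function.update_of_ne h4, write,
            Function.update_of_ne h15]
        refine ⟨tk.of_eq fun x hx => hne x (by omega) (by omega) (by omega), by simp [write], ?_, ?_, ?_, ?_⟩
        · rw [hne 12 (by simp) (by simp) (by simp), g1 12 (by simp) (by simp) (by simp), h12]
        · rw [hne 14 (by simp) (by simp) (by simp), g1 14 (by simp) (by simp) (by simp), h14]
        · simp [write]
        · rw [write, Function.update_of_ne (by simp), write, Function.update_self, write,
            Function.update_of_ne (by simp), g4, hstep]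
          split_ifs <;> simp)
  exact ⟨m', r1.seq (r2.seq (r3.seq (r4.seq (r5.seq r6)))), hI.2.2.2.2.2⟩

end RAM

end SpinChain

end

section

namespace SpinChain

namespace Input

variable (I : Input) (A : Params)

/-- The unnormalized state of the simulation. -/
def state : Cfg I.N → ℂ := (I.sim A 0).simState

/-- The unnormalized probability of the outcomes `s`. -/
def weight (s : Cfg I.N) : ℝ := ‖I.state A s‖ ^ 2

theorem expect_eq_re (o : ℕ → ℤ) :
    (I.expect A o : ℝ) = (star (I.state A) ⬝ᵥ (siteTensor (fun i : Fin I.N =>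
      Matrix.of ((I.sim A o).obsC i)) *ᵥ I.state A)).re := by
  have h := congrArg Complex.re (I.sim A o).val_tab_last
  rw [Sim.val] at h
  simp only [Complex.add_re, Complex.intCast_re, Complex.mul_re, Complex.I_re, Complex.I_im,
    Complex.intCast_im, mul_zero, zero_mul, sub_zero, add_zero] at h
  exact h

theorem obsC_diagArray (P : ℕ → ℕ → ℤ) (k : ℕ) (u v : Fin 2) :
    (I.sim A (diagArray P)).obsC k u v = if u = v then (P k u.val : ℂ) else 0 := by
  have hu := u.isLt
  have hv := v.isLt
  have e0 : diagArray P (2 * (4 * k + 2 * u.val + v.val)) = if u = v then P k u.val else 0 := by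
    rw [diagArray, show 2 * (4 * k + 2 * u.val + v.val) / 8 = k by omega,
      show 2 * (4 * k + 2 * u.val + v.val) / 4 % 2 = u.val by omega,
      show 2 * (4 * k + 2 * u.val + v.val) / 2 % 2 = v.val by omega]
    refine if_congr ?_ rfl rfl
    rw [Fin.ext_iff]
    omega
  have e1 : diagArray P (2 * (4 * k + 2 * u.val + v.val) + 1) = 0 := if_neg (by omega)
  have : (I.sim A (diagArray P)).obs = diagArray P := rfl
  rw [Sim.obsC, this, e0, e1]
  split_ifs <;> simp

theorem obsC_entryArray (x y : ℕ → ℤ) (k : ℕ) (u v : Fin 2) :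
    (I.sim A (entryArray x y)).obsC k u v
      = x (4 * k + 2 * u.val + v.val) + y (4 * k + 2 * u.val + v.val) * Complex.I := by
  have : (I.sim A (entryArray x y)).obs = entryArray x y := rfl
  rw [Sim.obsC, this, entryArray, entryArray, if_pos (by omega), if_neg (by omega)]
  congr 4 <;> omega

theorem expect_diagArray (P : ℕ → ℕ → ℤ) :
    (I.expect A (diagArray P) : ℝ)
      = ∑ s : Cfg I.N, ((∏ i : Fin I.N, P i (s i).val : ℤ) : ℝ) * I.weight A s := by
  have h : siteTensor (fun i : Fin I.N => Matrix.of ((I.sim A (diagArray P)).obsC i))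
      = Matrix.diagonal fun s : Cfg I.N => ((∏ i : Fin I.N, P i (s i).val : ℤ) : ℂ) := by
    ext s s'
    simp only [siteTensor, Matrix.of_apply, obsC_diagArray, Matrix.diagonal_apply]
    split_ifs with hs
    · subst hs; simp
    · obtain ⟨i, hi⟩ := Function.ne_iff.1 hs
      exact Finset.prod_eq_zero (Finset.mem_univ i) (if_neg hi)
  rw [expect_eq_re, h, dotProduct, Complex.re_sum]
  refine Finset.sum_congr rfl fun s _ => ?_
  rw [Matrix.mulVec_diagonal, weight, Pi.star_apply, ← Complex.normSq_eq_norm_sq,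
    mul_left_comm, Complex.star_def, Complex.normSq_eq_conj_mul_self.symm, ← Complex.ofReal_intCast,
    ← Complex.ofReal_mul, Complex.ofReal_re]

theorem total_eq : (I.total A : ℝ) = ∑ s, I.weight A s := by
  rw [total, expect_diagArray]
  simp

theorem prod_agree (q : ℕ → ℤ) (s : Cfg I.N) :
    ∏ i : Fin I.N, agree (q i) (s i).val
      = if ∀ i : Fin I.N, 1 < q i ∨ q i = (s i).val then 1 else 0 := by
  split_ifs with h
  · refine Finset.prod_eq_one fun i _ => ?_
    rw [agree]
    rcases h i with h | h
    · rw [if_pos h]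
    · rw [if_pos h, ite_self]
  · push Not at h
    obtain ⟨i, h1, h2⟩ := h
    refine Finset.prod_eq_zero (Finset.mem_univ i) ?_
    rw [agree, if_neg (by omega), if_neg h2]

theorem queryArray_agrees (a : Fin I.N → Option (Fin 2)) (s : Cfg I.N) :
    (∀ i : Fin I.N, 1 < queryArray a i ∨ queryArray a i = (s i).val) ↔ Agrees a s := by
  refine forall_congr' fun i => ?_
  rw [queryArray, dif_pos i.isLt]
  rcases h : a ⟨i.val, i.isLt⟩ with _ | b
  · simp
  · have := b.isLt
    simp only [Option.mem_def, Option.some.injEq]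
    rw [forall_eq', Fin.ext_iff]
    omega

/-- The distribution of the outcomes in the state of the simulation. -/
def dist (s : Cfg I.N) : ℝ := I.weight A s / I.total A

theorem weight_nonneg (s : Cfg I.N) : 0 ≤ I.weight A s := by unfold weight; positivity

theorem total_nonneg : (0 : ℝ) ≤ I.total A := by
  rw [total_eq]
  exact Finset.sum_nonneg fun s _ => I.weight_nonneg A s

theorem isDist_dist (h : I.total A ≠ 0) : IsDist (I.dist A) := by
  refine ⟨fun s => div_nonneg (I.weight_nonneg A s) (I.total_nonneg A), ?_⟩
  simp only [dist]
  rw [← Finset.sum_div, ← total_eq, div_self (by exact_mod_cast h)]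

open Classical in
theorem expect_query (a : Fin I.N → Option (Fin 2)) :
    (I.expect A (diagArray fun k u => agree (queryArray a k) u) : ℝ)
      = ∑ s ∈ Finset.univ.filter (fun s => Agrees a s), I.weight A s := by
  rw [expect_diagArray, Finset.sum_filter]
  refine Finset.sum_congr rfl fun s _ => ?_
  rw [prod_agree, if_congr (I.queryArray_agrees a s) rfl rfl]
  split_ifs <;> simp

open Classical in
theorem expect_query_query (a b : Fin I.N → Option (Fin 2)) :
    (I.expect A (diagArray fun k u => agree (queryArray a k) u * agree (queryArray b k) u) : ℝ)
      = ∑ s ∈ Finset.univ.filter (fun s => Agrees a s ∧ Agrees b s), I.weight A s := by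
  rw [expect_diagArray, Finset.sum_filter]
  refine Finset.sum_congr rfl fun s _ => ?_
  rw [Finset.prod_mul_distrib, prod_agree, prod_agree,
    if_congr (I.queryArray_agrees a s) rfl rfl, if_congr (I.queryArray_agrees b s) rfl rfl]
  split_ifs <;> simp_all

theorem marginal_dist (a : Fin I.N → Option (Fin 2)) :
    marginal (I.dist A) a
      = (I.expect A (diagArray fun k u => agree (queryArray a k) u) : ℝ) / I.total A := by
  rw [expect_query, marginal, Finset.sum_div]; rfl

theorem conditional_dist (h : I.total A ≠ 0) (a b : Fin I.N → Option (Fin 2)) :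
    conditional (I.dist A) a b
      = (I.expect A (diagArray fun k u => agree (queryArray a k) u * agree (queryArray b k) u) : ℝ) /
        I.expect A (diagArray fun k u => agree (queryArray a k) u) := by
  have h' : (I.total A : ℝ) ≠ 0 := by exact_mod_cast h
  rw [conditional, marginal_dist, expect_query_query]
  simp only [dist]
  rw [← Finset.sum_div, div_div_div_cancel_right₀ h']

/-! ### Sampling -/

open Classical in
/-- The weight of the outcomes `s` on the first `j` sites. -/
def mass (s : ℕ → ℤ) (j : ℕ) : ℝ :=
  ∑ t : Cfg I.N, if ∀ i : Fin I.N, i.val < j → s i = (t i).val then I.weight A t else 0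

theorem mass_zero (s : ℕ → ℤ) : I.mass A s 0 = I.total A := by
  rw [total_eq, mass]
  simp

theorem mass_update (s : ℕ → ℤ) {j : ℕ} (hj : j < I.N) : I.mass A s j =
    I.mass A (Function.update s j 0) (j + 1) + I.mass A (Function.update s j 1) (j + 1) := by
  classical
  simp only [mass]
  rw [← Finset.sum_add_distrib]
  refine Finset.sum_congr rfl fun t _ => ?_
  have key : ∀ v : ℤ, (∀ i : Fin I.N, i.val < j + 1 → Function.update s j v i = (t i).val) ↔
      (∀ i : Fin I.N, i.val < j → s i = (t i).val) ∧ v = (t ⟨j, hj⟩).val := by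
    intro v
    constructor
    · intro h
      refine ⟨fun i hi => ?_, ?_⟩
      · rw [← h i (by omega), Function.update_of_ne hi.ne]
      · rw [← h ⟨j, hj⟩ (Nat.lt_succ_self j), Function.update_self]
    · rintro ⟨h1, h2⟩ i hi
      rcases Nat.lt_succ_iff_lt_or_eq.1 hi with h | h
      · rw [Function.update_of_ne h.ne, h1 i h]
      · have : i = ⟨j, hj⟩ := Fin.ext h
        rw [this, Function.update_self, h2]
  rw [if_congr (key 0) rfl rfl, if_congr (key 1) rfl rfl]
  have hlt := (t ⟨j, hj⟩).isLt
  by_cases h : ∀ i : Fin I.N, i.val < j → s i = (t i).val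
  · rw [if_pos h]
    rcases Nat.lt_succ_iff_lt_or_eq.1 hlt with h1 | h1
    · rw [if_pos ⟨h, by omega⟩, if_neg (by rintro ⟨-, h2⟩; omega), add_zero]
    · rw [if_neg (by rintro ⟨-, h2⟩; omega), if_pos ⟨h, by omega⟩, zero_add]
  · rw [if_neg h, if_neg (fun h' => h h'.1), if_neg (fun h' => h h'.1), add_zero]

theorem prefixWeight_eq (s : ℕ → ℤ) (hs : ∀ k, s k ≤ 1) (j : ℕ) :
    (I.prefixWeight A s j : ℝ) = I.mass A (Function.update s j 0) (j + 1) := by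
  classical
  rw [prefixWeight, expect_diagArray, mass]
  refine Finset.sum_congr rfl fun t _ => ?_
  rw [prod_agree]
  have : (∀ i : Fin I.N, 1 < prefixQuery s j i ∨ prefixQuery s j i = (t i).val) ↔
      ∀ i : Fin I.N, i.val < j + 1 → Function.update s j 0 i = (t i).val := by
    refine forall_congr' fun i => ?_
    rw [prefixQuery]
    rcases lt_trichotomy i.val j with h | h | h
    · have := hs i
      rw [if_pos h, Function.update_of_ne h.ne]
      omega
    · rw [if_neg (by omega), if_neg (by omega), h, Function.update_self]
      omega
    · rw [if_neg (by omega), if_pos h]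
      omega
  rw [if_congr this rfl rfl]
  split_ifs <;> simp

theorem prefixWeight_congr {s s' : ℕ → ℤ} {j : ℕ} (h : ∀ k < j, s k = s' k) :
    I.prefixWeight A s j = I.prefixWeight A s' j := by
  have : prefixQuery s j = prefixQuery s' j := by
    funext k
    rw [prefixQuery, prefixQuery]
    split_ifs with h1
    · exact h k h1
    · rfl
    · rfl
  rw [prefixWeight, prefixWeight, this]

/-- The weight of the outcomes below `s`. -/
def cumulative (s : ℕ → ℤ) (j : ℕ) : ℤ :=
  ∑ i ∈ Finset.range j, if s i = 1 then I.prefixWeight A s i else 0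

theorem cumulative_congr {s s' : ℕ → ℤ} {j : ℕ} (h : ∀ k < j, s k = s' k) :
    I.cumulative A s j = I.cumulative A s' j := by
  refine Finset.sum_congr rfl fun i hi => ?_
  rw [Finset.mem_range] at hi
  rw [h i hi, I.prefixWeight_congr A fun k hk => h k (hk.trans hi)]

theorem cumulative_update (s : ℕ → ℤ) (j : ℕ) (v : ℤ) :
    I.cumulative A (Function.update s j v) (j + 1)
      = I.cumulative A s j + if v = 1 then I.prefixWeight A s j else 0 := by
  have h : ∀ k < j, Function.update s j v k = s k := fun k hk => Function.update_of_ne hk.ne _ _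
  have h2 := I.cumulative_congr A h
  rw [cumulative, Finset.sum_range_succ, ← cumulative, h2, Function.update_self,
    I.prefixWeight_congr A h]

theorem sample_succ (u : ℤ) (j : ℕ) : I.sample A u (j + 1) =
    if u * I.total A < ((I.sample A u j).2 + I.prefixWeight A (I.sample A u j).1 j) * (2 ^ I.coins : ℕ)
    then (Function.update (I.sample A u j).1 j 0, (I.sample A u j).2)
    else (Function.update (I.sample A u j).1 j 1,
      (I.sample A u j).2 + I.prefixWeight A (I.sample A u j).1 j) := rfl

theorem sample_fst (u : ℤ) (j k : ℕ) : (I.sample A u j).1 k = 0 ∨ (I.sample A u j).1 k = 1 := by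
  induction j with
  | zero => exact Or.inl rfl
  | succ j ih =>
    rw [sample_succ]
    by_cases hk : k = j
    · subst hk; split_ifs <;> simp
    · split_ifs <;> simpa [hk] using ih

theorem sample_snd (u : ℤ) (j : ℕ) :
    (I.sample A u j).2 = I.cumulative A (I.sample A u j).1 j := by
  induction j with
  | zero => simp [sample, cumulative]
  | succ j ih =>
    rw [sample_succ]
    split_ifs <;> simp [cumulative_update, ih]

theorem sample_bounds {u : ℤ} (hu : 0 ≤ u) (hu' : u < 2 ^ I.coins) (h : I.total A ≠ 0) {j : ℕ}
    (hj : j ≤ I.N) :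
    ((I.sample A u j).2 : ℝ) * 2 ^ I.coins ≤ u * I.total A ∧
      (u * I.total A : ℝ) < ((I.sample A u j).2 + I.mass A (I.sample A u j).1 j) * 2 ^ I.coins := by
  have hE : (0 : ℝ) < I.total A := lt_of_le_of_ne (I.total_nonneg A) (by exact_mod_cast h.symm)
  induction j with
  | zero =>
    rw [mass_zero]
    simp only [sample, Int.cast_zero, zero_mul, zero_add]
    refine ⟨mul_nonneg (by exact_mod_cast hu) hE.le, ?_⟩
    rw [mul_comm]
    exact mul_lt_mul_of_pos_left (by exact_mod_cast hu') hE
  | succ j ih =>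
    obtain ⟨h1, h2⟩ := ih (by omega)
    have hp := I.prefixWeight_eq A (I.sample A u j).1
      (fun k => by rcases I.sample_fst A u j k with h | h <;> rw [h]; norm_num) j
    rw [I.mass_update A _ (show j < I.N by omega)] at h2
    rw [sample_succ]
    split_ifs with hlt
    · refine ⟨h1, ?_⟩
      rw [← hp]
      exact_mod_cast hlt
    · refine ⟨?_, ?_⟩
      · push_cast
        have := not_lt.1 hlt
        exact_mod_cast this
      · push_cast
        rw [hp, add_assoc]
        exact h2

/-- The outcomes that are given by the array `s`. -/
def toCfg (s : ℕ → ℤ) : Cfg I.N := fun i => if s i = 0 then 0 else 1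

theorem mass_le_weight (s : ℕ → ℤ) : I.mass A s I.N ≤ I.weight A (I.toCfg s) := by
  classical
  rw [mass, ← Finset.sum_filter]
  refine (Finset.sum_le_sum_of_subset_of_nonneg (t := {I.toCfg s}) ?_
    fun t _ _ => I.weight_nonneg A t).trans_eq (Finset.sum_singleton _ _)
  intro t ht
  rw [Finset.mem_filter] at ht
  rw [Finset.mem_singleton]
  funext i
  have h1 := ht.2 i i.isLt
  have := (t i).isLt
  rw [toCfg, h1]
  split_ifs with h
  · exact Fin.ext (by simpa using h)
  · refine Fin.ext ?_
    simp only [Fin.val_one]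
    omega

theorem sample_snd_eq (u : ℤ) {t : Cfg I.N} (h : I.toCfg (I.sample A u I.N).1 = t) :
    (I.sample A u I.N).2
      = I.cumulative A (fun k => if h : k < I.N then ((t ⟨k, h⟩).val : ℤ) else 0) I.N := by
  rw [sample_snd]
  refine I.cumulative_congr A fun k hk => ?_
  rw [dif_pos hk, ← h, toCfg]
  rcases I.sample_fst A u I.N k with h | h <;> simp [h]

end Input

theorem card_le_of_mem_Ico {s : Finset ℤ} {x l : ℝ} (hl : 0 ≤ l)
    (h : ∀ u ∈ s, x ≤ (u : ℝ) ∧ (u : ℝ) < x + l) : (s.card : ℝ) ≤ l + 1 := by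
  have h1 : s ⊆ Finset.Ico ⌈x⌉ ⌈x + l⌉ := by
    intro u hu
    obtain ⟨h1, h2⟩ := h u hu
    rw [Finset.mem_Ico]
    exact ⟨Int.ceil_le.2 h1, Int.lt_ceil.2 h2⟩
  have h2 := Finset.card_le_card h1
  rw [Int.card_Ico] at h2
  have h3 : ⌈x⌉ ≤ ⌈x + l⌉ := Int.ceil_mono (by linarith)
  have h4 : ((⌈x + l⌉ - ⌈x⌉).toNat : ℝ) = (⌈x + l⌉ : ℝ) - ⌈x⌉ := by
    exact_mod_cast Int.toNat_of_nonneg (show 0 ≤ ⌈x + l⌉ - ⌈x⌉ by omega)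
  have h5 := Int.ceil_lt_add_one (x + l)
  have h6 := Int.le_ceil x
  calc (s.card : ℝ) ≤ ((⌈x + l⌉ - ⌈x⌉).toNat : ℝ) := by exact_mod_cast h2
    _ ≤ _ := by rw [h4]; linarith

theorem tvDist_le_of_le_add {α : Type*} [Fintype α] {D E : α → ℝ} (h : ∑ s, D s = ∑ s, E s) {x : ℝ}
    (hx : 0 ≤ x) (hle : ∀ s, D s ≤ E s + x) : tvDist D E ≤ Fintype.card α * x := by
  have h1 : ∀ s, |D s - E s| ≤ 2 * x - (D s - E s) := by
    intro s
    have := hle s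
    rcases abs_cases (D s - E s) with h | h <;> linarith
  calc tvDist D E ≤ (1 / 2) * ∑ s, (2 * x - (D s - E s)) := by
        unfold tvDist; gcongr with s; exact h1 s
    _ = _ := by
        rw [Finset.sum_sub_distrib, Finset.sum_sub_distrib, h]
        simp
        ring

theorem tvDist_triangle {α : Type*} [Fintype α] (D E F : α → ℝ) :
    tvDist D F ≤ tvDist D E + tvDist E F := by
  unfold tvDist
  rw [← mul_add, ← Finset.sum_add_distrib]
  gcongr with s
  exact abs_sub_le _ _ _

theorem sum_coinDist {R : ℕ} {α : Type*} [Fintype α] [DecidableEq α] (f : (Fin R → Fin 2) → α) :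
    ∑ s, coinDist f s = 1 := by
  simp only [coinDist]
  rw [← Finset.sum_div, ← Nat.cast_sum,
    ← Finset.card_eq_sum_card_fiberwise (f := f) (fun _ _ => Finset.mem_coe.2 (Finset.mem_univ _))]
  simp

theorem binary_coinArray {R : ℕ} (ω : Fin R → Fin 2) :
    RAM.binary (coinArray ω) R = (finFunctionFinEquiv ω).val := by
  rw [finFunctionFinEquiv_apply, RAM.binary, Finset.sum_range]
  push_cast
  refine Finset.sum_congr rfl fun i _ => ?_
  rw [coinArray, dif_pos i.isLt]

namespace Input

variable (I : Input) (A : Params)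

theorem tvDist_sample_le {R : ℕ} (hR : R = I.coins) (h : I.total A ≠ 0) :
    tvDist (coinDist fun ω : Fin R → Fin 2 =>
      I.toCfg (I.sample A (RAM.binary (coinArray ω) R) I.N).1) (I.dist A)
      ≤ 2 ^ I.N * (1 / 2 ^ R) := by
  classical
  subst hR
  have hE : (0 : ℝ) < I.total A := lt_of_le_of_ne (I.total_nonneg A) (by exact_mod_cast h.symm)
  refine (tvDist_le_of_le_add (x := 1 / 2 ^ I.coins) ?_ (by positivity) fun t => ?_).trans ?_
  · rw [sum_coinDist, (I.isDist_dist A h).2]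
  · set S := Finset.univ.filter fun ω : Fin I.coins → Fin 2 =>
      I.toCfg (I.sample A (RAM.binary (coinArray ω) I.coins) I.N).1 = t with hS
    set C := I.cumulative A (fun k => if h : k < I.N then ((t ⟨k, h⟩).val : ℤ) else 0) I.N
    have hcard : (S.card : ℝ) ≤ I.weight A t * 2 ^ I.coins / I.total A + 1 := by
      rw [← Finset.card_image_of_injOn (f := fun ω => RAM.binary (coinArray ω) I.coins)]
      · refine card_le_of_mem_Ico (x := C * 2 ^ I.coins / I.total A) ?_ ?_
        · exact div_nonneg (mul_nonneg (I.weight_nonneg A t) (by positivity)) hE.le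
        · intro u hu
          obtain ⟨ω, hω, rfl⟩ := Finset.mem_image.1 hu
          have ht := (Finset.mem_filter.1 hω).2
          have hb := binary_coinArray ω
          obtain ⟨h1, h2⟩ := I.sample_bounds A (u := RAM.binary (coinArray ω) I.coins)
            (by rw [hb]; positivity) (by rw [hb]; exact_mod_cast (finFunctionFinEquiv ω).isLt) h le_rfl
          rw [I.sample_snd_eq A _ ht] at h1 h2
          have h3 := I.mass_le_weight A (I.sample A (RAM.binary (coinArray ω) I.coins) I.N).1
          rw [ht] at h3
          rw [← add_div, div_le_iff₀ hE, lt_div_iff₀ hE, ← add_mul]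
          exact ⟨h1, h2.trans_le (by gcongr)⟩
      · intro ω _ ω' _ he
        simp only [binary_coinArray] at he
        exact finFunctionFinEquiv.injective (Fin.ext (by exact_mod_cast he))
    rw [coinDist, dist, div_le_iff₀ (by positivity)]
    refine hcard.trans_eq ?_
    field_simp
  · simp

end Input

end SpinChain

end

section

namespace SpinChain

section
open scoped Matrix.Norms.L2Operator

theorem norm_star_dotProduct_le {α : Type*} [Fintype α] (v w : α → ℂ) :
    ‖star v ⬝ᵥ w‖ ≤ ‖WithLp.toLp 2 v‖ * ‖WithLp.toLp 2 w‖ := by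
  have h := norm_inner_le_norm (𝕜 := ℂ) (WithLp.toLp 2 v) (WithLp.toLp 2 w)
  rw [EuclideanSpace.inner_toLp_toLp, dotProduct_comm] at h
  exact h

theorem sum_norm_mul_norm_le {α : Type*} [Fintype α] (v w : α → ℂ) :
    ∑ s, ‖v s‖ * ‖w s‖ ≤ ‖WithLp.toLp 2 v‖ * ‖WithLp.toLp 2 w‖ := by
  rw [EuclideanSpace.norm_eq, EuclideanSpace.norm_eq]
  exact Real.sum_mul_le_sqrt_mul_sqrt _ _ _

theorem sum_norm_sq {α : Type*} [Fintype α] (v : α → ℂ) :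
    ∑ s, ‖v s‖ ^ 2 = ‖WithLp.toLp 2 v‖ ^ 2 := by
  rw [EuclideanSpace.norm_sq_eq]

theorem exists_normalized {α : Type*} [Fintype α] {φ ψ χ : α → ℂ} {c : ℂ} (hc : c ≠ 0)
    (hφ : φ = c • ψ) (hχ : ‖WithLp.toLp 2 χ‖ = 1) {δ : ℝ} (hδ : δ < 1)
    (h : ‖WithLp.toLp 2 (ψ - χ)‖ ≤ δ) :
    ∃ (c' : ℂ) (v : α → ℂ), c' ≠ 0 ∧ φ = c' • v ∧ ‖WithLp.toLp 2 v‖ = 1 ∧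
      ‖WithLp.toLp 2 (v - χ)‖ ≤ 2 * δ := by
  set x := WithLp.toLp 2 ψ with hx
  set y := WithLp.toLp 2 χ with hy
  have h' : ‖x - y‖ ≤ δ := h
  have h1 : |‖x‖ - 1| ≤ δ := by
    rw [← hχ]; exact (abs_norm_sub_norm_le x y).trans h'
  have hx0 : 0 < ‖x‖ := by have := abs_le.1 h1; linarith
  have hxc : (‖x‖ : ℂ) ≠ 0 := by exact_mod_cast hx0.ne'
  refine ⟨c * ‖x‖, (‖x‖ : ℂ)⁻¹ • ψ, mul_ne_zero hc hxc, ?_, ?_, ?_⟩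
  · rw [hφ, smul_smul, mul_assoc, mul_inv_cancel₀ hxc, mul_one]
  · rw [WithLp.toLp_smul, norm_smul, norm_inv, Complex.norm_real, norm_norm, inv_mul_cancel₀ hx0.ne']
  · have e1 : WithLp.toLp 2 ((‖x‖ : ℂ)⁻¹ • ψ - χ) = ((‖x‖ : ℂ)⁻¹ • x - x) + (x - y) := by
      rw [sub_add_sub_cancel]; rfl
    have e2 : ‖(‖x‖ : ℂ)⁻¹ • x - x‖ = |‖x‖ - 1| := by
      have : (‖x‖ : ℂ)⁻¹ • x - x = (((‖x‖⁻¹ - 1 : ℝ)) : ℂ) • x := by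
        push_cast; rw [sub_smul, one_smul]
      rw [this, norm_smul, Complex.norm_real, Real.norm_eq_abs, ← abs_of_pos hx0, ← abs_mul,
        abs_of_pos hx0, sub_mul, inv_mul_cancel₀ hx0.ne', one_mul, abs_sub_comm]
    rw [e1]
    have := norm_add_le ((‖x‖ : ℂ)⁻¹ • x - x) (x - y)
    rw [e2] at this
    linarith

theorem tvDist_norm_sq_le {α : Type*} [Fintype α] {v χ : α → ℂ} (hv : ‖WithLp.toLp 2 v‖ = 1)
    (hχ : ‖WithLp.toLp 2 χ‖ = 1) :
    tvDist (fun s => ‖v s‖ ^ 2) (fun s => ‖χ s‖ ^ 2) ≤ ‖WithLp.toLp 2 (v - χ)‖ := by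
  have h1 := sum_norm_mul_norm_le (v - χ) v
  have h2 := sum_norm_mul_norm_le (v - χ) χ
  have h3 : ∀ s, |‖v s‖ ^ 2 - ‖χ s‖ ^ 2| ≤ ‖(v - χ) s‖ * ‖v s‖ + ‖(v - χ) s‖ * ‖χ s‖ := by
    intro s
    rw [sq_sub_sq, abs_mul, abs_of_nonneg (by positivity), ← mul_add, mul_comm]
    exact mul_le_mul_of_nonneg_right (abs_norm_sub_norm_le _ _) (by positivity)
  calc tvDist (fun s => ‖v s‖ ^ 2) (fun s => ‖χ s‖ ^ 2)
      ≤ (1 / 2) * ∑ s, (‖(v - χ) s‖ * ‖v s‖ + ‖(v - χ) s‖ * ‖χ s‖) := by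
        unfold tvDist; gcongr with s; exact h3 s
    _ ≤ _ := by
        rw [Finset.sum_add_distrib]
        rw [hv, mul_one] at h1
        rw [hχ, mul_one] at h2
        linarith

theorem norm_expectation_sub_le {N : ℕ} (X : Op N) {v χ : Cfg N → ℂ} (hv : ‖WithLp.toLp 2 v‖ = 1)
    (hχ : ‖WithLp.toLp 2 χ‖ = 1) :
    ‖star v ⬝ᵥ (X *ᵥ v) - star χ ⬝ᵥ (X *ᵥ χ)‖ ≤ 2 * ‖X‖ * ‖WithLp.toLp 2 (v - χ)‖ := by
  have e : star v ⬝ᵥ (X *ᵥ v) - star χ ⬝ᵥ (X *ᵥ χ)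
      = star (v - χ) ⬝ᵥ (X *ᵥ v) + star χ ⬝ᵥ (X *ᵥ (v - χ)) := by
    rw [star_sub, sub_dotProduct, Matrix.mulVec_sub, dotProduct_sub]; ring
  rw [e]
  refine (norm_add_le _ _).trans ?_
  have h1 := norm_star_dotProduct_le (v - χ) (X *ᵥ v)
  have h2 := norm_star_dotProduct_le χ (X *ᵥ (v - χ))
  have h3 := Sim.norm_mulVec_le X v
  have h4 := Sim.norm_mulVec_le X (v - χ)
  rw [hv, mul_one] at h3
  rw [hχ, one_mul] at h2
  have h5 : ‖WithLp.toLp 2 (v - χ)‖ * ‖WithLp.toLp 2 (X *ᵥ v)‖ ≤ ‖WithLp.toLp 2 (v - χ)‖ * ‖X‖ := by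
    gcongr
  linarith

theorem norm_expectation_le_of_entries {N : ℕ} {X : Op N} {x : ℝ} (hX : ∀ s t, ‖X s t‖ ≤ x)
    {v : Cfg N → ℂ} (hv : ‖WithLp.toLp 2 v‖ = 1) : ‖star v ⬝ᵥ (X *ᵥ v)‖ ≤ 4 ^ N * x := by
  have hv1 : ∀ s, ‖v s‖ ≤ 1 := fun s => hv ▸ PiLp.norm_apply_le (WithLp.toLp 2 v) s
  have h : ∀ s, ‖(X *ᵥ v) s‖ ≤ 2 ^ N * x := by
    intro s
    rw [Matrix.mulVec, dotProduct]
    refine (norm_sum_le_of_le (n := fun _ => x) _ (fun t _ => ?_)).trans_eq ?_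
    · rw [norm_mul]
      exact (mul_le_mul (hX s t) (hv1 t) (norm_nonneg _) ((norm_nonneg _).trans (hX s t))).trans
        (mul_one x).le
    · simp
  rw [dotProduct]
  refine (norm_sum_le_of_le (n := fun _ => 2 ^ N * x) _ (fun t _ => ?_)).trans_eq ?_
  · rw [norm_mul, Pi.star_apply, norm_star]
    exact (mul_le_mul (hv1 t) (h t) (norm_nonneg _) zero_le_one).trans (one_mul _).le
  · simp only [Finset.sum_const, Finset.card_univ, nsmul_eq_mul, Fintype.card_fun, Fintype.card_fin]
    push_cast
    rw [show (4 : ℝ) = 2 * 2 by norm_num, mul_pow]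
    ring

theorem norm_prod_sub_prod_le {ι : Type*} (s : Finset ι) {f g : ι → ℂ} {η : ℝ} (hη : 0 ≤ η)
    (hg : ∀ i ∈ s, ‖g i‖ ≤ 1) (h : ∀ i ∈ s, ‖f i - g i‖ ≤ η) :
    ‖∏ i ∈ s, f i - ∏ i ∈ s, g i‖ ≤ (1 + η) ^ s.card - 1 := by
  classical
  induction s using Finset.induction_on with
  | empty => simp
  | insert a s ha ih =>
    have ih' := ih (fun i hi => hg i (Finset.mem_insert_of_mem hi))
      (fun i hi => h i (Finset.mem_insert_of_mem hi))
    have h1 := hg a (Finset.mem_insert_self a s)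
    have h2 := h a (Finset.mem_insert_self a s)
    have h3 : ‖f a‖ ≤ 1 + η := by
      have := norm_sub_norm_le (f a) (g a); linarith
    have h4 : ‖∏ i ∈ s, g i‖ ≤ 1 := by
      rw [norm_prod]
      exact Finset.prod_le_one (fun i _ => norm_nonneg _)
        (fun i hi => hg i (Finset.mem_insert_of_mem hi))
    rw [Finset.prod_insert ha, Finset.prod_insert ha, Finset.card_insert_of_notMem ha]
    calc ‖f a * ∏ i ∈ s, f i - g a * ∏ i ∈ s, g i‖
        = ‖f a * (∏ i ∈ s, f i - ∏ i ∈ s, g i) + (f a - g a) * ∏ i ∈ s, g i‖ := by congr 1; ring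
      _ ≤ ‖f a‖ * ‖∏ i ∈ s, f i - ∏ i ∈ s, g i‖ + ‖f a - g a‖ * ‖∏ i ∈ s, g i‖ :=
        (norm_add_le _ _).trans (add_le_add (norm_mul_le _ _) (norm_mul_le _ _))
      _ ≤ (1 + η) * ((1 + η) ^ s.card - 1) + η * 1 := by gcongr
      _ = _ := by ring

theorem norm_apply_le_opNorm {n : Type*} [Fintype n] [DecidableEq n] (A : Matrix n n ℂ) (i j : n) :
    ‖A i j‖ ≤ opNorm A := by
  have h1 := (Matrix.toEuclideanCLM (n := n) (𝕜 := ℂ) A).le_opNorm (EuclideanSpace.single j 1)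
  have h2 := PiLp.norm_apply_le (Matrix.toEuclideanCLM (n := n) (𝕜 := ℂ) A (EuclideanSpace.single j 1)) i
  have h3 : (Matrix.toEuclideanCLM (n := n) (𝕜 := ℂ) A (EuclideanSpace.single j 1)) i = A i j := by
    rw [Matrix.ofLp_toEuclideanCLM]
    simp
  rw [h3] at h2
  refine h2.trans (h1.trans ?_)
  simp [opNorm]

theorem matArray_apply {N : ℕ} (o : Fin N → Fin 2 → Fin 2 → ℤ) (i : Fin N) (u v : Fin 2) :
    matArray o (4 * i.val + 2 * u.val + v.val) = o i u v := by
  have h1 : (4 * i.val + 2 * u.val + v.val) / 4 = i.val := by omega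
  have h2 : (4 * i.val + 2 * u.val + v.val) / 2 % 2 = u.val := by omega
  have h3 : (4 * i.val + 2 * u.val + v.val) % 2 = v.val := by omega
  rw [matArray, dif_pos (by rw [h1]; exact i.isLt)]
  congr 1 <;> simp [h1, h2, h3]

theorem star_siteTensor_of_isHermitian {N : ℕ} {O : Fin N → Matrix (Fin 2) (Fin 2) ℂ}
    (h : ∀ i, (O i).IsHermitian) : (siteTensor O)ᴴ = siteTensor O := by
  have := star_siteTensor O
  rw [Matrix.star_eq_conjTranspose] at this
  rw [this]
  congr 1
  funext i
  exact h i

theorem expectation_eq_re {N : ℕ} {X : Op N} (h : Xᴴ = X) (v : Cfg N → ℂ) :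
    (((star v ⬝ᵥ (X *ᵥ v)).re : ℝ) : ℂ) = star v ⬝ᵥ (X *ᵥ v) := by
  rw [← Complex.conj_eq_iff_re, ← Complex.star_def, ← Matrix.star_dotProduct_star, star_star,
    Matrix.star_mulVec, h, ← Matrix.dotProduct_mulVec, dotProduct_comm]

theorem Input.total_of_eq_smul {I : Input} {A : Params} {c : ℂ} {v : Cfg I.N → ℂ}
    (hv : I.state A = c • v) (h1 : ‖WithLp.toLp 2 v‖ = 1) : (I.total A : ℝ) = ‖c‖ ^ 2 := by
  rw [Input.total_eq]
  simp only [Input.weight, hv, Pi.smul_apply, smul_eq_mul, norm_mul, mul_pow]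
  rw [← Finset.mul_sum, sum_norm_sq, h1]
  ring

/-- The simulation prepares the state `χ` with error `δ`, up to normalization. -/
def Prepares (I : Input) (A : Params) (χ : Cfg I.N → ℂ) (δ : ℝ) : Prop :=
  ∃ (c : ℂ) (v : Cfg I.N → ℂ), c ≠ 0 ∧ I.state A = c • v ∧ ‖WithLp.toLp 2 v‖ = 1 ∧
    ‖WithLp.toLp 2 (v - χ)‖ ≤ δ

namespace Prepares

variable {I : Input} {A : Params} {χ : Cfg I.N → ℂ} {δ : ℝ} (h : Prepares I A χ δ)
include h

theorem total_ne_zero : I.total A ≠ 0 := by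
  obtain ⟨c, v, hc, hv, h1, -⟩ := h
  have : (I.total A : ℝ) = ‖c‖ ^ 2 := Input.total_of_eq_smul hv h1
  have h2 : (I.total A : ℝ) ≠ 0 := by rw [this]; positivity
  exact_mod_cast h2

theorem tvDist_le (hχ : ‖WithLp.toLp 2 χ‖ = 1) :
    tvDist (I.dist A) (fun s => ‖χ s‖ ^ 2) ≤ δ := by
  obtain ⟨c, v, hc, hv, h1, h2⟩ := h
  have ht : (I.total A : ℝ) = ‖c‖ ^ 2 := Input.total_of_eq_smul hv h1
  have : I.dist A = fun s => ‖v s‖ ^ 2 := by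
    funext s
    rw [Input.dist, ht, Input.weight, hv, Pi.smul_apply, smul_eq_mul, norm_mul, mul_pow,
      mul_div_cancel_left₀ _ (by positivity)]
  rw [this]
  exact (tvDist_norm_sq_le h1 hχ).trans h2

theorem observable_le (hχ : ‖WithLp.toLp 2 χ‖ = 1) {O : Fin I.N → Matrix (Fin 2) (Fin 2) ℂ}
    (hO : ∀ i, (O i).IsHermitian ∧ opNorm (O i) ≤ 1) {re im : Fin I.N → Fin 2 → Fin 2 → ℤ}
    (happ : ∀ i u v, Approx I.p (re i u v) (O i u v).re ∧ Approx I.p (im i u v) (O i u v).im) :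
    ‖(((I.expect A (entryArray (matArray re) (matArray im)) : ℝ) /
        ((I.total A * (2 ^ (I.N * I.p) : ℕ) : ℤ) : ℝ) : ℝ) : ℂ) - star χ ⬝ᵥ (siteTensor O *ᵥ χ)‖
      ≤ 2 * δ + 4 ^ I.N * ((1 + 2 / 2 ^ I.p) ^ I.N - 1) := by
  obtain ⟨c, v, hc, hv, h1, h2⟩ := h
  have ht : (I.total A : ℝ) = ‖c‖ ^ 2 := Input.total_of_eq_smul hv h1
  set O' : Fin I.N → Matrix (Fin 2) (Fin 2) ℂ := fun i =>
    Matrix.of fun u v => ((re i u v : ℂ) + im i u v * Complex.I) / 2 ^ I.p with hO'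
  have hentry : ∀ i u v, ‖O' i u v - O i u v‖ ≤ 2 / 2 ^ I.p := by
    intro i u v
    obtain ⟨g1, g2⟩ := happ i u v
    have e : O' i u v - O i u v = ((((re i u v : ℝ) - 2 ^ I.p * (O i u v).re) : ℝ) +
        (((im i u v : ℝ) - 2 ^ I.p * (O i u v).im) : ℝ) * Complex.I) / 2 ^ I.p := by
      have hO'a : O' i u v = ((re i u v : ℂ) + im i u v * Complex.I) / 2 ^ I.p := rfl
      rw [hO'a]
      have hz := Complex.re_add_im (O i u v)
      rw [div_sub' (pow_ne_zero _ two_ne_zero)]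
      congr 1
      rw [← hz]
      push_cast
      simp only [Complex.add_re, Complex.ofReal_re, Complex.mul_re, Complex.I_re, Complex.I_im,
        Complex.ofReal_im, Complex.add_im, Complex.mul_im]
      push_cast
      ring
    rw [e, norm_div, norm_pow, Complex.norm_ofNat]
    gcongr
    refine (norm_add_le _ _).trans ?_
    rw [norm_mul, Complex.norm_I, mul_one, Complex.norm_real, Complex.norm_real, Real.norm_eq_abs,
      Real.norm_eq_abs]
    unfold Approx at g1 g2
    linarith
  have hdiff : ∀ s t, ‖(siteTensor O' - siteTensor O) s t‖ ≤ (1 + 2 / 2 ^ I.p) ^ I.N - 1 := by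
    intro s t
    rw [Matrix.sub_apply, siteTensor_apply, siteTensor_apply]
    have := norm_prod_sub_prod_le (Finset.univ : Finset (Fin I.N)) (f := fun i => O' i (s i) (t i))
      (g := fun i => O i (s i) (t i)) (η := 2 / 2 ^ I.p) (by positivity)
      (fun i _ => (norm_apply_le_opNorm _ _ _).trans (hO i).2) (fun i _ => hentry _ _ _)
    rwa [Finset.card_univ, Fintype.card_fin] at this
  have hexp : (I.expect A (entryArray (matArray re) (matArray im)) : ℝ) /
        ((I.total A * (2 ^ (I.N * I.p) : ℕ) : ℤ) : ℝ) = (star v ⬝ᵥ (siteTensor O' *ᵥ v)).re := by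
    have e1 : siteTensor (fun i : Fin I.N =>
        Matrix.of ((I.sim A (entryArray (matArray re) (matArray im))).obsC i))
        = ((2 ^ (I.N * I.p) : ℝ) : ℂ) • siteTensor O' := by
      ext s t
      rw [Matrix.smul_apply, siteTensor_apply, siteTensor_apply, mul_comm I.N, pow_mul]
      push_cast
      have : ((2 : ℂ) ^ I.p) ^ I.N = ∏ _i : Fin I.N, (2 : ℂ) ^ I.p := by simp
      rw [this, smul_eq_mul, ← Finset.prod_mul_distrib]
      refine Finset.prod_congr rfl fun i _ => ?_
      have hO'a : O' i (s i) (t i)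
          = ((re i (s i) (t i) : ℂ) + im i (s i) (t i) * Complex.I) / 2 ^ I.p := rfl
      rw [Matrix.of_apply, Input.obsC_entryArray, matArray_apply, matArray_apply, hO'a,
        mul_div_cancel₀ _ (pow_ne_zero _ two_ne_zero)]
    have e2 : star (c • v) ⬝ᵥ ((((2 ^ (I.N * I.p) : ℝ) : ℂ) • siteTensor O') *ᵥ (c • v))
        = ((‖c‖ ^ 2 * 2 ^ (I.N * I.p) : ℝ) : ℂ) * (star v ⬝ᵥ (siteTensor O' *ᵥ v)) := by
      rw [star_smul, Matrix.smul_mulVec, Matrix.mulVec_smul, smul_dotProduct, dotProduct_smul,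
        dotProduct_smul]
      simp only [smul_eq_mul]
      have : ((‖c‖ ^ 2 : ℝ) : ℂ) = star c * c := by
        rw [← Complex.normSq_eq_norm_sq, Complex.normSq_eq_conj_mul_self, Complex.star_def]
      push_cast at this ⊢
      rw [this]
      ring
    rw [Input.expect_eq_re, e1, hv, e2, Complex.re_ofReal_mul]
    push_cast
    rw [ht, mul_div_cancel_left₀ _ (by positivity)]
  have hX : ‖siteTensor O‖ ≤ 1 := norm_siteTensor_le_one fun i => (hO i).2
  have hreal := expectation_eq_re (star_siteTensor_of_isHermitian fun i => (hO i).1) χ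
  rw [hexp, ← hreal, ← Complex.ofReal_sub, ← Complex.sub_re, Complex.norm_real]
  refine (Complex.abs_re_le_norm _).trans ?_
  have e3 : star v ⬝ᵥ (siteTensor O' *ᵥ v) - star χ ⬝ᵥ (siteTensor O *ᵥ χ)
      = star v ⬝ᵥ ((siteTensor O' - siteTensor O) *ᵥ v) +
        (star v ⬝ᵥ (siteTensor O *ᵥ v) - star χ ⬝ᵥ (siteTensor O *ᵥ χ)) := by
    rw [Matrix.sub_mulVec, dotProduct_sub]; ring
  rw [e3]
  refine (norm_add_le _ _).trans ?_
  have g1 := norm_expectation_le_of_entries hdiff h1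
  have g2 := norm_expectation_sub_le (siteTensor O) h1 hχ
  have g3 : 2 * ‖siteTensor O‖ * ‖WithLp.toLp 2 (v - χ)‖ ≤ 2 * 1 * δ := by gcongr
  linarith

end Prepares

end

end SpinChain

end

section

namespace SpinChain

section Bridge

open scoped Matrix.Norms.L2Operator

variable {r : ℕ} {K ξ q : ℝ} {τ : ℕ → ℝ}

theorem pauliWindow_eq_pauliWord {N : ℕ} (k : Fin N) (α : Fin (4 ^ r)) :
    pauliWindow k (finFunctionFinEquiv.symm α) = pauliWord N r k α := by
  rw [pauliWindow, pauliWord]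
  congr 1
  funext i
  rw [letterAt]
  split_ifs with h
  · rfl
  · rfl

namespace Inst

variable (P : Inst r K ξ q τ)

/-- The coefficients of `H t`, by position and index of the Pauli word. -/
def coeffTime (k α : ℕ) : ℝ :=
  if h : k < P.N then
    P.t * P.coeff ⟨k, h⟩ (finFunctionFinEquiv.symm ⟨α % 4 ^ r, Nat.mod_lt α (by positivity)⟩)
  else 0

theorem coeffTime_of_le (k α : ℕ) (h : P.N ≤ k) : P.coeffTime k α = 0 := dif_neg (not_lt.2 h)

theorem gen_coeffTime :
    gen P.N r P.coeffTime 0 P.N = ((P.t : ℂ) * Complex.I) • hamiltonian P.coeff := by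
  rw [gen, ← Finset.range_eq_Ico, Finset.sum_range, hamiltonian, Finset.smul_sum]
  refine Finset.sum_congr rfl fun k _ => ?_
  rw [localGen, Finset.sum_range, Finset.smul_sum,
    ← Equiv.sum_comp (finFunctionFinEquiv (m := 4) (n := r)).symm]
  refine Finset.sum_congr rfl fun α _ => ?_
  rw [pauliWindow_eq_pauliWord, smul_smul, coeffTime, dif_pos k.isLt]
  have : (⟨α.val % 4 ^ r, Nat.mod_lt _ (by positivity)⟩ : Fin (4 ^ r)) = α :=
    Fin.ext (Nat.mod_eq_of_lt α.isLt)
  rw [this]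
  congr 1
  push_cast
  ring

theorem state_eq : P.state = NormedSpace.exp (-gen P.N r P.coeffTime 0 P.N) *ᵥ Pi.single 0 1 := by
  rw [gen_coeffTime, state, neg_smul, mul_comm]
  rfl

theorem norm_state : ‖WithLp.toLp 2 P.state‖ = 1 := by
  set U : Op P.N := NormedSpace.exp (-gen P.N r P.coeffTime 0 P.N) with hU
  have hskew : star (-gen P.N r P.coeffTime 0 P.N) = -(-gen P.N r P.coeffTime 0 P.N) := by
    rw [star_neg, star_gen]
  have h1 := Sim.norm_mulVec_le U (Pi.single 0 1)
  have h2 := Sim.norm_mulVec_le (star U) (U *ᵥ Pi.single 0 1)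
  have e : star U * U = 1 := by
    let _ : NormedAlgebra ℚ (Op P.N) := NormedAlgebra.restrictScalars ℚ ℝ (Op P.N)
    exact Unitary.star_mul_self_of_mem
      (NormedSpace.exp_mem_unitary_of_mem_skewAdjoint (skewAdjoint.mem_iff.2 hskew))
  have hU1 : ‖U‖ ≤ 1 := norm_exp_skewAdjoint_le _ hskew
  have hU2 : ‖star U‖ ≤ 1 := by rwa [norm_star]
  have h0 : ‖WithLp.toLp 2 (Pi.single 0 1 : Cfg P.N → ℂ)‖ = 1 := by
    simp
  rw [Matrix.mulVec_mulVec, e, Matrix.one_mulVec, h0] at h2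
  rw [h0, mul_one] at h1
  rw [state_eq, ← hU]
  refine le_antisymm (h1.trans hU1) (h2.trans ?_)
  exact mul_le_of_le_one_left (norm_nonneg _) hU2

end Inst

/-- The input of the simulation. -/
def Desc.input {P : Inst r K ξ q τ} {p : ℕ} (d : Desc P p) (m : ℕ) : Input where
  N := P.N
  m := m
  p := p
  time := d.time
  coeff := inputMem m d 0 0 1

theorem Desc.holds_input {P : Inst r K ξ q τ} {p : ℕ} (d : Desc P p) (m : ℕ) (x y : ℕ → ℤ) :
    RAM.Holds (d.input m) (inputMem m d x y) := ⟨rfl, rfl, rfl, rfl, fun _ => rfl⟩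

theorem Inst.K_nonneg (P : Inst r K ξ q τ) : 0 ≤ K :=
  (abs_nonneg _).trans (P.coeff_le ⟨0, P.N_pos⟩ fun _ => 0)

/-- Relative precision of the product of a coefficient and the time. -/
theorem Desc.abs_coeff_mul_time_sub_le {P : Inst r K ξ q τ} {p : ℕ} (d : Desc P p) (m k : ℕ) {α : ℕ}
    (hα : α < 4 ^ r) :
    |((d.input m).coeff (k * 4 ^ r + α) : ℝ) * d.time / (2 ^ p * 2 ^ p) - P.coeffTime k α|
      ≤ (K + |P.t| + 1) / 2 ^ p := by
  have hK := P.K_nonneg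
  have hdiv : (k * 4 ^ r + α) / 4 ^ r = k := by
    rw [mul_comm, Nat.mul_add_div (by positivity), Nat.div_eq_of_lt hα, add_zero]
  have hmod : (k * 4 ^ r + α) % 4 ^ r = α % 4 ^ r := Nat.mul_add_mod_self_right _ _ _
  have hc : (d.input m).coeff (k * 4 ^ r + α) = if h : (k * 4 ^ r + α) / 4 ^ r < P.N then
      d.coeff ⟨(k * 4 ^ r + α) / 4 ^ r, h⟩ (finFunctionFinEquiv.symm
        ⟨(k * 4 ^ r + α) % 4 ^ r, Nat.mod_lt _ (by positivity)⟩) else 0 := rfl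
  by_cases hk : k < P.N
  · set w : Fin r → Fin 4 := finFunctionFinEquiv.symm ⟨α % 4 ^ r, Nat.mod_lt α (by positivity)⟩ with hw
    have hc' : (d.input m).coeff (k * 4 ^ r + α) = d.coeff ⟨k, hk⟩ w := by
      have e1 : (⟨(k * 4 ^ r + α) / 4 ^ r, by rw [hdiv]; exact hk⟩ : Fin P.N) = ⟨k, hk⟩ := Fin.ext hdiv
      have e2 : (⟨(k * 4 ^ r + α) % 4 ^ r, Nat.mod_lt _ (by positivity)⟩ : Fin (4 ^ r))
          = ⟨α % 4 ^ r, Nat.mod_lt α (by positivity)⟩ := Fin.ext hmod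
      rw [hc, dif_pos (by rw [hdiv]; exact hk), e1, e2]
    have h1 := d.coeff_approx ⟨k, hk⟩ w
    have h2 := d.time_approx
    have h3 := P.coeff_le ⟨k, hk⟩ w
    rw [hc', Inst.coeffTime, dif_pos hk, ← hw]
    unfold Approx at h1 h2
    set c := P.coeff ⟨k, hk⟩ w
    set c' := d.coeff ⟨k, hk⟩ w
    have hp : (1 : ℝ) ≤ 2 ^ p := one_le_pow₀ one_le_two
    set D : ℝ := 2 ^ p
    have e : (c' : ℝ) * d.time / (D * D) - P.t * c
        = ((c' - D * c) * (d.time - D * P.t) + (c' - D * c) * (D * P.t) + D * c * (d.time - D * P.t))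
          / (D * D) := by
      field_simp; ring
    have h4 : |(c' - D * c) * (d.time - D * P.t) + (c' - D * c) * (D * P.t)
        + D * c * (d.time - D * P.t)| ≤ D * (K + |P.t| + 1) := by
      refine (abs_add_three _ _ _).trans ?_
      simp only [abs_mul]
      have hD : |D| = D := abs_of_pos (by linarith)
      rw [hD]
      have g1 : |(c' : ℝ) - D * c| * |(d.time : ℝ) - D * P.t| ≤ 1 * 1 := by gcongr
      have g2 : |(c' : ℝ) - D * c| * (D * |P.t|) ≤ 1 * (D * |P.t|) := by gcongr
      have g3 : D * |c| * |(d.time : ℝ) - D * P.t| ≤ D * K * 1 := by gcongr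
      linarith
    rw [e, abs_div, abs_of_pos (show 0 < D * D by positivity), div_le_div_iff₀ (by positivity) (by positivity)]
    calc _ ≤ D * (K + |P.t| + 1) * D := by gcongr
      _ = _ := by ring
  · rw [hc, dif_neg (by rw [hdiv]; exact hk), Inst.coeffTime, dif_neg hk]
    simp
    positivity

theorem Inst.abs_coeffTime_le (P : Inst r K ξ q τ) (k α : ℕ) : |P.coeffTime k α| ≤ K * |P.t| := by
  have hK := P.K_nonneg
  rw [Inst.coeffTime]
  split_ifs with h
  · rw [abs_mul, mul_comm]
    gcongr
    exact P.coeff_le _ _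
  · simp
    positivity

/-- The accuracy of the simulation, in terms of its parameters. -/
theorem Desc.prepares {P : Inst r K ξ q τ} {p : ℕ} (d : Desc P p) (m : ℕ) (A : Params) (hr : A.r = r)
    {κ η E n L : ℝ} (hκ : K * |P.t| ≤ κ) (hη : (K + |P.t| + 1) / 2 ^ p / n ≤ η)
    (hn : n = ((d.input m).M ^ A.b : ℕ)) (hL : L = (Nat.clog 2 ((d.input m).Q A) + 1 : ℕ))
    (hσ : L * 4 ^ r * (κ / n + η) ≤ 1)
    (hδ : 2 * n * (2 * (L * 4 ^ r * (κ / n + η)) ^ 2 + L * 4 ^ r * η) ≤ 1)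
    (hE : P.N * (2 * (2 * n * (2 * (L * 4 ^ r * (κ / n + η)) ^ 2 + L * 4 ^ r * η))
      + 2 * (4 ^ r * κ) * Real.exp (Real.exp 1 * (2 * ((r + 1) * (4 ^ r * κ))) -
        (Nat.clog 2 ((d.input m).Q A) / (r + 1) : ℕ))) ≤ E)
    (hE1 : E < 1 / 2) : Prepares (d.input m) A P.state (4 * E) := by
  subst hr
  have hM : 0 < (d.input m).M ^ A.b := Nat.pow_pos (Nat.succ_pos _)
  have hn0 : 0 < n := by rw [hn]; exact_mod_cast hM
  set S := (d.input m).sim A 0 with hS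
  have hscale : (S.scale : ℝ) = n * (2 ^ p * 2 ^ p) := by
    have : S.scale = (((d.input m).M ^ A.b : ℕ) : ℤ) * (2 ^ p : ℕ) * (2 ^ p : ℕ) := rfl
    rw [this, hn]
    push_cast
    ring
  have hscale0 : S.scale ≠ 0 := by
    have : (S.scale : ℝ) ≠ 0 := by rw [hscale]; positivity
    exact_mod_cast this
  obtain ⟨ψ, h1, h2⟩ : ∃ ψ : Cfg P.N → ℂ,
      (d.input m).state A = (S.scale : ℂ) ^ (S.gates * S.N) • ψ ∧
        ‖WithLp.toLp 2 (ψ - P.state)‖ ≤ 2 * E := by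
    rw [P.state_eq]
    exact S.simState_approx (c := P.coeffTime) (κ := κ) (η := η) (E := E)
      (l := Nat.clog 2 ((d.input m).Q A)) rfl hM hscale0 (fun k α => (P.abs_coeffTime_le k α).trans hκ)
      (fun k α h => P.coeffTime_of_le k α h)
      (by
        intro k α hα
        have h := d.abs_coeff_mul_time_sub_le m k hα
        have hSn : ((S.n : ℕ) : ℝ) = n := hn.symm
        rw [hscale, hSn]
        refine le_trans ?_ hη
        have e : (S.coeff (k * 4 ^ S.r + α) : ℝ) * S.time / (n * (2 ^ p * 2 ^ p)) - P.coeffTime k α / n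
            = (((d.input m).coeff (k * 4 ^ A.r + α) : ℝ) * d.time / (2 ^ p * 2 ^ p) - P.coeffTime k α) / n := by
          rw [sub_div, div_div, mul_comm n]
          rfl
        rw [e, abs_div, abs_of_pos hn0]
        gcongr)
      (by rw [hn, hL] at hσ; exact hσ) (by rw [hn, hL] at hδ; exact hδ)
      (by rw [hn, hL] at hE; exact hE) (by linarith)
  obtain ⟨c', v, g1, g2, g3, g4⟩ := exists_normalized (c := (S.scale : ℂ) ^ (S.gates * S.N))
    (pow_ne_zero _ (by exact_mod_cast hscale0)) h1 P.norm_state (by linarith) h2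
  exact ⟨c', v, g1, g2, g3, g4.trans_eq (by ring)⟩

end Bridge

end SpinChain

end

section

namespace SpinChain

theorem one_le_log_of_three_le {x : ℝ} (hx : 3 ≤ x) : 1 ≤ Real.log x := by
  rw [Real.le_log_iff_exp_le (by linarith)]
  have := Real.exp_one_lt_d9
  linarith

theorem exists_le_mul_log {τ : ℕ → ℝ}
    (hτ : Asymptotics.IsBigO Filter.atTop τ (fun N : ℕ => Real.log (N : ℝ))) :
    ∃ C : ℝ, 0 ≤ C ∧ ∀ N : ℕ, 0 < N → ∀ M : ℕ, 3 ≤ M → N ≤ M → τ N ≤ C * Real.log M := by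
  obtain ⟨c, hc⟩ := hτ.bound
  obtain ⟨N₀, hN₀⟩ := Filter.eventually_atTop.1 hc
  have hS : 0 ≤ ∑ i ∈ Finset.range N₀, |τ i| := Finset.sum_nonneg fun _ _ => abs_nonneg _
  refine ⟨|c| + ∑ i ∈ Finset.range N₀, |τ i|, by positivity, fun N hN M hM hNM => ?_⟩
  have h1 : (1 : ℝ) ≤ Real.log M := one_le_log_of_three_le (by exact_mod_cast hM)
  rcases lt_or_ge N N₀ with h | h
  · have h2 : |τ N| ≤ ∑ i ∈ Finset.range N₀, |τ i| :=
      Finset.single_le_sum (f := fun i => |τ i|) (fun _ _ => abs_nonneg _) (Finset.mem_range.2 h)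
    calc τ N ≤ |τ N| := le_abs_self _
      _ ≤ (|c| + ∑ i ∈ Finset.range N₀, |τ i|) * 1 := by linarith [abs_nonneg c]
      _ ≤ _ := by gcongr
  · have h2 := hN₀ N h
    have hN1 : (1 : ℝ) ≤ N := by exact_mod_cast hN
    have h3 : 0 ≤ Real.log N := Real.log_nonneg hN1
    rw [Real.norm_eq_abs, Real.norm_eq_abs, abs_of_nonneg h3] at h2
    calc τ N ≤ |τ N| := le_abs_self _
      _ ≤ c * Real.log N := h2
      _ ≤ |c| * Real.log M := by
        gcongr
        exact le_abs_self c
      _ ≤ _ := by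
        gcongr
        linarith

/-- The bounds on the parameters that make the simulation accurate. -/
theorem accuracy_bound {M N n L κ η R θ D : ℝ} {g a : ℕ} (hM : 3 ≤ M) (hNM : N ≤ M)
    (hn : n = M ^ (2 * a + 4 * g + 16)) (hL0 : 0 ≤ L) (hL : L ≤ M ^ (a + 1)) (hR0 : 0 ≤ R) (hR : R ≤ M ^ g)
    (hκ0 : 0 ≤ κ) (hκ : κ ≤ M ^ (g + 1)) (hD : M ^ (a + 2 * g + 11) ≤ D)
    (hη : η = M ^ (g + 1) / D / n) (hθ0 : 0 ≤ θ)
    (hθ : θ ≤ M / M ^ (2 * g + 11)) :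
    L * R * (κ / n + η) ≤ 1 ∧
      2 * n * (2 * (L * R * (κ / n + η)) ^ 2 + L * R * η) ≤ 1 ∧
      N * (2 * (2 * n * (2 * (L * R * (κ / n + η)) ^ 2 + L * R * η)) + 2 * (R * κ) * θ)
        ≤ 1 / (16 * M) := by
  have hM1 : 1 ≤ M := by linarith
  have hM0 : 0 < M := by linarith
  have hn0 : 0 < n := by rw [hn]; positivity
  have hD1 : 1 ≤ D := (one_le_pow₀ hM1).trans hD
  have hη0 : 0 ≤ η := by rw [hη]; positivity
  set y := L * R * (κ + M ^ (g + 1) / D) with hy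
  have hy0 : 0 ≤ y := by positivity
  have e1 : L * R * (κ / n + η) = y / n := by rw [hη, hy]; field_simp
  have hy1 : y ≤ M ^ (a + 2 * g + 3) := by
    calc y ≤ M ^ (a + 1) * M ^ g * (M ^ (g + 1) + M ^ (g + 1)) := by
          rw [hy]
          gcongr
          exact div_le_self (by positivity) hD1
      _ = M ^ (a + 1) * M ^ g * M ^ (g + 1) * 2 := by ring
      _ ≤ M ^ (a + 1) * M ^ g * M ^ (g + 1) * M := by gcongr; linarith
      _ = _ := by ring
  have hyn : y ^ 2 / n ≤ 1 / M ^ 10 := by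
    rw [div_le_div_iff₀ hn0 (by positivity), one_mul, hn]
    calc y ^ 2 * M ^ 10 ≤ (M ^ (a + 2 * g + 3)) ^ 2 * M ^ 10 := by gcongr
      _ = _ := by ring
  have hz : L * R * (M ^ (g + 1) / D) ≤ 1 / M ^ 9 := by
    rw [← mul_div_assoc, div_le_div_iff₀ (by positivity) (by positivity), one_mul]
    calc L * R * M ^ (g + 1) * M ^ 9 ≤ M ^ (a + 1) * M ^ g * M ^ (g + 1) * M ^ 9 := by gcongr
      _ = M ^ (a + 2 * g + 11) := by ring
      _ ≤ D := hD
  have e2 : 2 * n * (2 * (y / n) ^ 2 + L * R * η)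
      = 4 * (y ^ 2 / n) + 2 * (L * R * (M ^ (g + 1) / D)) := by
    rw [hη]; field_simp; ring
  have hw : 4 * (y ^ 2 / n) + 2 * (L * R * (M ^ (g + 1) / D)) ≤ 6 / M ^ 9 := by
    have h1 : 1 / M ^ 10 ≤ 1 / M ^ 9 :=
      one_div_le_one_div_of_le (by positivity) (pow_le_pow_right₀ hM1 (by norm_num))
    have h2 : 6 / M ^ 9 = 6 * (1 / M ^ 9) := by ring
    rw [h2]; linarith
  have hM9 : (3 : ℝ) ^ 9 ≤ M ^ 9 := by gcongr
  have hM6 : (3 : ℝ) ^ 6 ≤ M ^ 6 := by gcongr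
  rw [e1, e2]
  refine ⟨?_, ?_, ?_⟩
  · rw [div_le_one hn0, hn]
    exact hy1.trans (pow_le_pow_right₀ hM1 (by omega))
  · refine hw.trans ?_
    rw [div_le_one (by positivity)]
    norm_num at hM9
    linarith
  · have h1 : N * (2 * (R * κ) * θ) ≤ 2 / M ^ 8 := by
      have : M / M ^ (2 * g + 11) = 1 / M ^ (2 * g + 10) := by
        rw [div_eq_div_iff (by positivity) (by positivity)]; ring
      rw [this] at hθ
      calc N * (2 * (R * κ) * θ) ≤ M * (2 * (M ^ g * M ^ (g + 1)) * (1 / M ^ (2 * g + 10))) := by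
            gcongr
        _ = 2 / M ^ 8 := by field_simp; ring
    have h2 : N * (2 * (4 * (y ^ 2 / n) + 2 * (L * R * (M ^ (g + 1) / D)))) ≤ 12 / M ^ 8 := by
      calc _ ≤ M * (2 * (6 / M ^ 9)) := by gcongr
        _ = _ := by field_simp; ring
    rw [mul_add]
    have h3 : 14 / M ^ 8 ≤ 1 / (16 * M) := by
      rw [div_le_div_iff₀ (by positivity) (by positivity)]
      have h4 : M ^ 8 = M ^ 6 * M * M := by ring
      rw [h4]
      have h5 : (3 : ℝ) ^ 6 * M * 3 ≤ M ^ 6 * M * M := by gcongr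
      norm_num at h5
      linarith
    have h6 : 12 / M ^ 8 + 2 / M ^ 8 = 14 / M ^ 8 := by ring
    linarith

theorem exists_params (r : ℕ) (K ξ q : ℝ) (τ : ℕ → ℝ)
    (hτ : Asymptotics.IsBigO Filter.atTop τ (fun N : ℕ => Real.log (N : ℝ))) :
    ∃ (A : Params) (g : ℕ), A.r = r ∧ ∀ (P : Inst r K ξ q τ) (m p : ℕ) (d : Desc P p), 0 < m →
      |P.t| ≤ 2 ^ g * (P.N + m + 1) ∧ (g * (P.N + m + 1) ≤ p →
        Prepares (d.input m) A P.state (1 / (4 * (P.N + m + 1)))) := by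
  obtain ⟨C, hC, hτC⟩ := exists_le_mul_log hτ
  have hexp : ∀ x : ℝ, ∃ g : ℕ, ∀ g' ≥ g, x ≤ 2 ^ g' := by
    intro x
    obtain ⟨g, hg⟩ := pow_unbounded_of_one_lt x one_lt_two
    exact ⟨g, fun g' h => hg.le.trans (pow_le_pow_right₀ one_le_two h)⟩
  obtain ⟨g₁, h₁⟩ := hexp (|K| * C)
  obtain ⟨g₂, h₂⟩ := hexp (|K| + C + 1)
  obtain ⟨g₃, h₃⟩ := hexp (4 ^ r)
  obtain ⟨g₄, h₄⟩ := exists_nat_ge (Real.exp 1 * (2 * ((r + 1) * (4 ^ r * (|K| * C)))))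
  set g := g₁ + g₂ + g₃ + g₄ with hg
  set a := (r + 1) * (3 * g + 11) with ha
  refine ⟨⟨r, a, 2 * a + 4 * g + 16⟩, a + 2 * g + 11, rfl, fun P m p d hm => ?_⟩
  have hN := P.N_pos
  have hK := P.K_nonneg
  set M : ℕ := P.N + m + 1 with hMdef
  have hMc : ((P.N : ℝ) + m + 1) = (M : ℝ) := by rw [hMdef]; push_cast; ring
  have hM3 : 3 ≤ M := by omega
  have hM3' : (3 : ℝ) ≤ M := by exact_mod_cast hM3
  have hM1 : (1 : ℝ) ≤ M := by linarith
  have hM0 : (0 : ℝ) < M := by linarith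
  have ht : |P.t| ≤ C * Real.log M := P.t_le.trans (hτC P.N hN M hM3 (by omega))
  have hlog0 : 0 ≤ Real.log M := Real.log_nonneg hM1
  have hlogM : Real.log M ≤ M := (Real.log_le_sub_one_of_pos hM0).trans (by linarith)
  have htM : |P.t| ≤ C * M := ht.trans (by gcongr)
  have h2M : ∀ k : ℕ, (2 : ℝ) ^ k ≤ (M : ℝ) ^ k := fun k => by gcongr; linarith
  have habsK : |K| = K := abs_of_nonneg hK
  rw [hMc]
  refine ⟨?_, fun hp => ?_⟩
  · have h5 := h₂ (a + 2 * g + 11) (by omega)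
    calc |P.t| ≤ C * M := htM
      _ ≤ _ := by
        gcongr
        have := abs_nonneg K
        linarith
  · have hD : (M : ℝ) ^ (a + 2 * g + 11) ≤ 2 ^ p := by
      have h6 : M ^ (a + 2 * g + 11) ≤ 2 ^ p := by
        calc M ^ (a + 2 * g + 11) ≤ (2 ^ M) ^ (a + 2 * g + 11) :=
              Nat.pow_le_pow_left Nat.lt_two_pow_self.le _
          _ = 2 ^ ((a + 2 * g + 11) * M) := by rw [← pow_mul, mul_comm]
          _ ≤ _ := Nat.pow_le_pow_right two_pos hp
      exact_mod_cast h6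
    set κ := K * C * Real.log M with hκdef
    have hκ0 : 0 ≤ κ := by positivity
    have hκ : κ ≤ M ^ (g + 1) := by
      have h7 := h₁ g (by omega)
      rw [habsK] at h7
      calc κ ≤ 2 ^ g * M := by rw [hκdef]; gcongr
        _ ≤ M ^ g * M := by gcongr; linarith
        _ = _ := by ring
    set l := Nat.clog 2 (M ^ a) with hl
    have hL : ((l + 1 : ℕ) : ℝ) ≤ M ^ (a + 1) := by
      have h8 : l + 1 ≤ M ^ (a + 1) := by
        have h9 : l ≤ M ^ a := Nat.clog_le_of_le_pow Nat.lt_two_pow_self.le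
        have h10 : 0 < M ^ a := by positivity
        calc l + 1 ≤ M ^ a * 2 := by omega
          _ ≤ M ^ a * M := Nat.mul_le_mul_left _ (by omega)
          _ = _ := (pow_succ _ _).symm
      exact_mod_cast h8
    have hR : (4 : ℝ) ^ r ≤ M ^ g := (h₃ g (by omega)).trans (h2M g)
    have hθ : Real.exp (Real.exp 1 * (2 * ((r + 1) * (4 ^ r * κ))) - (l / (r + 1) : ℕ))
        ≤ M / M ^ (2 * g + 11) := by
      have e1 : Real.exp 1 * (2 * ((r + 1) * (4 ^ r * κ))) ≤ g * Real.log M := by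
        have h9 : (g₄ : ℝ) ≤ g := by exact_mod_cast (by omega : g₄ ≤ g)
        rw [habsK] at h₄
        calc _ = Real.exp 1 * (2 * ((r + 1) * (4 ^ r * (K * C)))) * Real.log M := by
              rw [hκdef]; ring
          _ ≤ _ := by gcongr; exact h₄.trans h9
      have e2 : (3 * g + 11 : ℝ) * Real.log M - 1 ≤ (l / (r + 1) : ℕ) := by
        have h10 : M ^ a ≤ 2 ^ l := Nat.le_pow_clog one_lt_two _
        have h11 : (a : ℝ) * Real.log M ≤ l := by
          have h12 : Real.log ((M : ℝ) ^ a) ≤ Real.log (2 ^ l) :=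
            Real.log_le_log (by positivity) (by exact_mod_cast h10)
          rw [Real.log_pow, Real.log_pow] at h12
          have h13 : Real.log 2 ≤ 1 := by
            have := Real.log_two_lt_d9; linarith
          calc _ ≤ l * Real.log 2 := h12
            _ ≤ l * 1 := by gcongr
            _ = _ := mul_one _
        have h14 : (l : ℝ) < (r + 1) * ((l / (r + 1) : ℕ) + 1) := by
          exact_mod_cast Nat.lt_mul_div_succ l (Nat.succ_pos r)
        have h15 : (a : ℝ) = (r + 1) * (3 * g + 11) := by rw [ha]; push_cast; ring
        rw [h15, mul_assoc] at h11
        have h16 := lt_of_mul_lt_mul_left (h11.trans_lt h14) (by positivity)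
        linarith
      calc _ ≤ Real.exp (Real.log M - (2 * g + 11 : ℕ) * Real.log M) := by
            have := one_le_log_of_three_le hM3'
            apply Real.exp_le_exp.2
            push_cast
            linarith
        _ = _ := by
            rw [Real.exp_sub, Real.exp_log hM0, ← Real.log_pow, Real.exp_log (by positivity)]
    obtain ⟨b1, b2, b3⟩ := accuracy_bound (N := P.N) (R := 4 ^ r) hM3'
      (by exact_mod_cast (by omega : P.N ≤ M)) rfl (Nat.cast_nonneg _) hL (by positivity) hR hκ0 hκ hD rfl
      (Real.exp_pos _).le hθ
    have hη : (K + |P.t| + 1) / 2 ^ p / (M : ℝ) ^ (2 * a + 4 * g + 16)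
        ≤ M ^ (g + 1) / 2 ^ p / (M : ℝ) ^ (2 * a + 4 * g + 16) := by
      gcongr
      have h7 := h₂ g (by omega)
      rw [habsK] at h7
      calc K + |P.t| + 1 ≤ K * M + C * M + 1 * M := by
            gcongr
            · exact le_mul_of_one_le_right hK hM1
            · linarith
        _ = (K + C + 1) * M := by ring
        _ ≤ 2 ^ g * M := by gcongr
        _ ≤ M ^ g * M := by gcongr; linarith
        _ = _ := by ring
    have key := d.prepares m ⟨r, a, 2 * a + 4 * g + 16⟩ rfl (κ := κ) (by
        calc K * |P.t| ≤ K * (C * Real.log M) := by gcongr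
          _ = κ := by ring) hη
      (by push_cast; rfl) (L := ((l + 1 : ℕ) : ℝ)) rfl b1 b2 b3 (by
        rw [div_lt_div_iff₀ (by positivity) (by norm_num)]; linarith)
    convert key using 1
    field_simp
    norm_num

end SpinChain

end

section

namespace SpinChain

/-- The function is bounded by a polynomial in `N + m + p`. -/
def PolyBounded (f : Input → ℕ) : Prop :=
  ∃ P : Polynomial ℕ, ∀ I, f I ≤ P.eval (I.N + I.m + I.p)

namespace PolyBounded

variable {f f' : Input → ℕ}

theorem mono (h : PolyBounded f) (hle : ∀ I, f' I ≤ f I) : PolyBounded f' := by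
  obtain ⟨P, hP⟩ := h
  exact ⟨P, fun I => (hle I).trans (hP I)⟩

theorem const (c : ℕ) : PolyBounded fun _ => c := ⟨Polynomial.C c, fun I => by simp⟩

theorem add (h : PolyBounded f) (h' : PolyBounded f') : PolyBounded fun I => f I + f' I := by
  obtain ⟨P, hP⟩ := h
  obtain ⟨P', hP'⟩ := h'
  exact ⟨P + P', fun I => by rw [Polynomial.eval_add]; exact add_le_add (hP I) (hP' I)⟩

theorem mul (h : PolyBounded f) (h' : PolyBounded f') : PolyBounded fun I => f I * f' I := by
  obtain ⟨P, hP⟩ := h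
  obtain ⟨P', hP'⟩ := h'
  exact ⟨P * P', fun I => by rw [Polynomial.eval_mul]; exact Nat.mul_le_mul (hP I) (hP' I)⟩

theorem pow (h : PolyBounded f) (k : ℕ) : PolyBounded fun I => f I ^ k := by
  obtain ⟨P, hP⟩ := h
  exact ⟨P ^ k, fun I => by rw [Polynomial.eval_pow]; exact Nat.pow_le_pow_left (hP I) k⟩

theorem size : PolyBounded fun I => I.N + I.m + I.p := ⟨Polynomial.X, fun I => by simp⟩

theorem N : PolyBounded fun I => I.N := size.mono fun I => by omega

theorem m : PolyBounded fun I => I.m := size.mono fun I => by omega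

theorem p : PolyBounded fun I => I.p := size.mono fun I => by omega

theorem M : PolyBounded fun I => I.M := (N.add m).add (const 1)

theorem Q (A : Params) : PolyBounded fun I => I.Q A := M.pow A.a

theorem len (A : Params) : PolyBounded fun I => I.len A :=
  ((((((N.mul p).add N).add m).add p).add (Q A)).add (const A.r)).add (const 2)

theorem clog_Q (A : Params) : PolyBounded fun I => Nat.clog 2 (I.Q A) :=
  (Q A).mono fun I => RAM.clog_Q_le I A

theorem two_pow_w (A : Params) : PolyBounded fun I => 2 ^ I.w A := by
  refine ((Q A).mul (const (2 * 2 ^ (1 + A.r)))).mono fun I => ?_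
  have h : 2 ^ Nat.clog 2 (I.Q A) ≤ 2 * I.Q A := by
    rcases Nat.eq_or_lt_of_le (RAM.Q_pos I A) with h | h
    · rw [← h]; simp
    · have h1 := Nat.pow_pred_clog_lt_self one_lt_two h
      have h2 : 0 < Nat.clog 2 (I.Q A) := Nat.clog_pos one_lt_two h
      obtain ⟨k, hk⟩ := Nat.exists_eq_add_of_le' h2
      rw [hk] at h1 ⊢
      rw [pow_succ]
      simp only [Nat.succ_eq_add_one, zero_add, Nat.add_sub_cancel, Nat.pred_eq_sub_one] at h1
      omega
  calc 2 ^ I.w A = 2 ^ Nat.clog 2 (I.Q A) * 2 ^ (1 + A.r) := by rw [Input.w, add_assoc, pow_add]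
    _ ≤ 2 * I.Q A * 2 ^ (1 + A.r) := Nat.mul_le_mul_right _ h
    _ = _ := by ring

theorem period (A : Params) : PolyBounded fun I => (I.sim A 0).period :=
  (((const 2).mul ((((const 2).mul (M.pow A.b)).mul ((clog_Q A).add (const 1))).mul
    (const (4 ^ A.r))))).add (const 1)

theorem cells (A : Params) : PolyBounded fun I => I.cells A :=
  (const 2).mul (((N.mul (period A)).add (const 1)).mul ((two_pow_w A).mul (two_pow_w A)))

theorem coins : PolyBounded fun I => I.coins := size

theorem setupWeight (A : Params) : PolyBounded (RAM.setupWeight A) :=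
  (((len A).add (const 1)).mul (const _)).add (((len A).add (const 1)).mul (const _))

theorem contractWeight (A : Params) (e : RAM.Expr) : PolyBounded (RAM.contractWeight A e) :=
  ((((const 8).mul N).add (const 1)).mul (const _)).add (((cells A).add (const 1)).mul (const _))

theorem probabilityWeight (A : Params) : PolyBounded (RAM.probabilityWeight A) :=
  (setupWeight A).add ((contractWeight A _).add ((const _).add ((contractWeight A _).add (const _))))

theorem observableWeight (A : Params) : PolyBounded (RAM.observableWeight A) :=
  (setupWeight A).add ((contractWeight A _).add ((const _).add ((contractWeight A _).add (const _))))

theorem sampleBodyWeight (A : Params) : PolyBounded (RAM.sampleBodyWeight A) :=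
  (contractWeight A _).add (const _)

theorem sampleWeight (A : Params) : PolyBounded (RAM.sampleWeight A) :=
  (setupWeight A).add (((coins.add (const 2)).mul (const _)).add ((contractWeight A _).add
    ((const _).add ((const _).add ((N.add (const 1)).mul ((sampleBodyWeight A).add (const _)))))))

end PolyBounded

namespace Input

variable (I : Input) (A : Params) (e : ℕ)

/-- A bound for the number of bits by which one step of the simulation lengthens the entries. -/
def stepBits : ℕ := I.M ^ A.b + 2 * e + I.M + 5 * I.p + 6

/-- A bound for the length of the entries of the table. -/
def tabBits : ℕ := I.stepBits A e * (I.N * (I.sim A 0).period)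

/-- A sufficient word length. -/
def wordLength : ℕ :=
  I.len A + I.cells A + 8 * I.N + I.tabBits A e + I.N * I.p + I.N + (e + I.M + I.p) + 10

/-- The numbers in the input are not too large. -/
structure Moderate : Prop where
  coeff_le : ∀ j, |I.coeff j| ≤ 2 ^ (e + I.p)
  time_le : |I.time| ≤ 2 ^ (e + I.M + I.p)

theorem polyBounded_wordLength : PolyBounded fun I => I.wordLength A e := by
  have h1 : PolyBounded fun I => I.stepBits A e :=
    (((((PolyBounded.M.pow A.b).add (.const (2 * e))).add .M).add ((PolyBounded.const 5).mul .p))).add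
      (.const 6)
  exact ((((((((PolyBounded.len A).add (.cells A)).add ((PolyBounded.const 8).mul .N)).add
    (h1.mul (PolyBounded.N.mul (.period A)))).add (PolyBounded.N.mul .p)).add .N).add
      (((PolyBounded.const e).add .M).add .p))).add (.const 10)

theorem bits_le_of_abs_le {z : ℤ} {k : ℕ} (h : |z| ≤ 2 ^ k) : RAM.bits z ≤ k + 2 :=
  RAM.bits_le_of_abs_lt (k := k + 1) (h.trans_lt (pow_lt_pow_right₀ (by norm_num) (Nat.lt_succ_self k)))

theorem fits_wordLength : I.Fits A (I.wordLength A e) where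
  len_lt := by rw [wordLength]; omega
  cells_le := (RAM.bits_natCast_le _).trans (by rw [wordLength]; omega)
  obs_le := (RAM.bits_natCast_le _).trans (by rw [wordLength]; omega)

variable {I A e} (h : I.Moderate e)
include h

theorem abs_amp_le (o : ℕ → ℤ) (k j : ℕ) :
    |(I.sim A o).amp k j| ≤ 2 ^ (2 * e + I.M + 2 * I.p) := by
  have hs : |(I.sim A o).sgn j| ≤ 1 := by
    unfold Sim.sgn; split_ifs <;> simp
  rw [Sim.amp, abs_mul, abs_mul]
  have h1 := mul_le_mul (mul_le_mul hs (h.coeff_le ((k + (I.sim A o).pos j) * 4 ^ (I.sim A o).r +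
    j % 4 ^ (I.sim A o).r)) (abs_nonneg _) zero_le_one) h.time_le (abs_nonneg _) (by positivity)
  exact h1.trans_eq (by ring)

theorem abs_tab_le_two_pow {o : ℕ → ℤ} (ho : ∀ i, |o i| ≤ 2 ^ (I.p + 1)) {s : ℕ}
    (hs : s ≤ I.N * (I.sim A 0).period) (x y : ℕ) {c : ℕ} (hc : c < 2) :
    |(I.sim A o).tab s x y c| ≤ 2 ^ I.tabBits A e := by
  have hscale : |(I.sim A o).scale| ≤ 2 ^ (I.M ^ A.b + 2 * I.p) := by
    have e1 : (I.sim A o).scale = ((I.M ^ A.b * 2 ^ I.p * 2 ^ I.p : ℕ) : ℤ) := by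
      push_cast; rfl
    rw [e1, Nat.abs_cast]
    have : I.M ^ A.b * 2 ^ I.p * 2 ^ I.p ≤ 2 ^ (I.M ^ A.b + 2 * I.p) := by
      calc _ ≤ 2 ^ (I.M ^ A.b) * 2 ^ I.p * 2 ^ I.p := by
            exact Nat.mul_le_mul_right _ (Nat.mul_le_mul_right _ Nat.lt_two_pow_self.le)
        _ = _ := by ring
    exact_mod_cast this
  have hstep : |(I.sim A o).scale| + 2 * 2 ^ (2 * e + I.M + 2 * I.p) + 8 * 2 ^ (I.p + 1)
      ≤ 2 ^ I.stepBits A e := by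
    set z := I.M ^ A.b + 2 * e + I.M + 5 * I.p + 4 with hz
    have h1 : (2 : ℤ) ^ (I.M ^ A.b + 2 * I.p) ≤ 2 ^ z := pow_le_pow_right₀ (by norm_num) (by omega)
    have h2 : (2 : ℤ) * 2 ^ (2 * e + I.M + 2 * I.p) ≤ 2 ^ z := by
      rw [← pow_succ']; exact pow_le_pow_right₀ (by norm_num) (by omega)
    have h3 : (8 : ℤ) * 2 ^ (I.p + 1) ≤ 2 ^ z := by
      rw [show (8 : ℤ) = 2 ^ 3 by norm_num, ← pow_add]
      exact pow_le_pow_right₀ (by norm_num) (by omega)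
    have h4 : (2 : ℤ) ^ I.stepBits A e = 2 ^ z * 4 := by
      rw [show I.stepBits A e = z + 2 by rw [stepBits, hz], pow_add]; norm_num
    have h5 : (0 : ℤ) < 2 ^ z := by positivity
    rw [h4]; linarith
  refine ((I.sim A o).abs_tab_le (abs_amp_le h o) ho s x y hc).trans ?_
  have h0 : 0 ≤ |(I.sim A o).scale| + 2 * 2 ^ (2 * e + I.M + 2 * I.p) + 8 * 2 ^ (I.p + 1) := by
    positivity
  calc _ ≤ (2 ^ I.stepBits A e) ^ s := pow_le_pow_left₀ h0 hstep s
    _ = 2 ^ (I.stepBits A e * s) := (pow_mul _ _ _).symm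
    _ ≤ _ := pow_le_pow_right₀ (by norm_num) (Nat.mul_le_mul_left _ hs)

theorem abs_expect_le {o : ℕ → ℤ} (ho : ∀ i, |o i| ≤ 2 ^ (I.p + 1)) :
    |I.expect A o| ≤ 2 ^ I.tabBits A e :=
  abs_tab_le_two_pow h ho le_rfl 0 0 two_pos

theorem obsFits_wordLength {o : ℕ → ℤ} (ho : ∀ i, |o i| ≤ 2 ^ (I.p + 1)) :
    I.ObsFits A o (I.wordLength A e) where
  obs_le i := (bits_le_of_abs_le (ho i)).trans (by rw [wordLength]; omega)
  tab_le i hi := by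
    refine (bits_le_of_abs_le (abs_tab_le_two_pow h ho ?_ _ _ (Nat.mod_lt _ two_pos))).trans
      (by rw [wordLength]; omega)
    have h1 : i / 2 < (I.N * (I.sim A 0).period + 1) * (2 ^ I.w A * 2 ^ I.w A) := by
      rw [cells] at hi; omega
    exact Nat.lt_succ_iff.1 ((Nat.div_lt_iff_lt_mul (by positivity)).2 h1)

omit h in
theorem abs_agree_le (q : ℤ) (u : ℕ) : |agree q u| ≤ 1 := by
  unfold agree; split_ifs <;> simp

omit h in
theorem abs_diagArray_le {P : ℕ → ℕ → ℤ} (hP : ∀ k u, |P k u| ≤ 1) (i : ℕ) :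
    |diagArray P i| ≤ 2 ^ (I.p + 1) := by
  have h1 : (1 : ℤ) ≤ 2 ^ (I.p + 1) := one_le_pow₀ (by norm_num)
  unfold diagArray
  split_ifs
  · exact (hP _ _).trans h1
  · simp

theorem obsFits_diagArray {P : ℕ → ℕ → ℤ} (hP : ∀ k u, |P k u| ≤ 1) :
    I.ObsFits A (diagArray P) (I.wordLength A e) :=
  obsFits_wordLength h (abs_diagArray_le hP)

theorem bits_total_mul_le :
    RAM.bits (I.total A * (2 ^ (I.N * I.p) : ℕ)) ≤ I.wordLength A e := by
  have h1 : |I.total A| ≤ 2 ^ I.tabBits A e := abs_expect_le h (abs_diagArray_le (by simp))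
  refine (bits_le_of_abs_le (k := I.tabBits A e + I.N * I.p) ?_).trans (by rw [wordLength]; omega)
  rw [abs_mul, Nat.abs_cast, pow_add]
  push_cast
  gcongr

theorem abs_sample_snd_le (u : ℤ) (j : ℕ) : |(I.sample A u j).2| ≤ j * 2 ^ I.tabBits A e := by
  have hw : ∀ s j, |I.prefixWeight A s j| ≤ 2 ^ I.tabBits A e := fun s j =>
    abs_expect_le h (abs_diagArray_le fun _ _ => abs_agree_le _ _)
  induction j with
  | zero => simp [sample]
  | succ j ih =>
    rw [sample_succ]
    have h0 : (0 : ℤ) ≤ 2 ^ I.tabBits A e := by positivity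
    push_cast
    split_ifs
    · dsimp only; linarith
    · refine (abs_add_le _ _).trans ?_
      have := hw (I.sample A u j).1 j
      linarith

theorem bits_sample_snd_le (u : ℤ) {j : ℕ} (hj : j ≤ I.N) :
    RAM.bits (I.sample A u j).2 ≤ I.wordLength A e := by
  refine (bits_le_of_abs_le (k := I.N + I.tabBits A e) ?_).trans (by rw [wordLength]; omega)
  refine (abs_sample_snd_le h u j).trans ?_
  rw [pow_add]
  gcongr
  calc (j : ℤ) ≤ I.N := by exact_mod_cast hj
    _ ≤ 2 ^ I.N := by exact_mod_cast Nat.lt_two_pow_self.le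

end Input

end SpinChain

end

section

namespace SpinChain

variable {r : ℕ} {K ξ q : ℝ} {τ : ℕ → ℝ}

theorem Approx.abs_le {p : ℕ} {a : ℤ} {x : ℝ} (h : Approx p a x) {k : ℕ} (hx : |x| + 1 ≤ 2 ^ k) :
    |a| ≤ 2 ^ (k + p) := by
  have hp : (1 : ℝ) ≤ 2 ^ p := one_le_pow₀ one_le_two
  have h1 : |(a : ℝ)| ≤ 2 ^ (k + p) := by
    calc |(a : ℝ)| = |((a : ℝ) - 2 ^ p * x) + 2 ^ p * x| := by congr 1; ring
      _ ≤ |(a : ℝ) - 2 ^ p * x| + |2 ^ p * x| := abs_add_le _ _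
      _ ≤ 1 * 2 ^ p + 2 ^ p * |x| := by
        rw [abs_mul, abs_of_pos (show (0 : ℝ) < 2 ^ p by positivity)]
        unfold Approx at h
        linarith
      _ = (|x| + 1) * 2 ^ p := by ring
      _ ≤ 2 ^ k * 2 ^ p := by gcongr
      _ = _ := (pow_add _ _ _).symm
  exact_mod_cast h1

theorem Desc.moderate {P : Inst r K ξ q τ} {p : ℕ} (d : Desc P p) (m : ℕ) {g e : ℕ}
    (ht : |P.t| ≤ 2 ^ g * (P.N + m + 1)) (hK : K + 1 ≤ 2 ^ e) (hg : g + 1 ≤ e) :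
    (d.input m).Moderate e where
  coeff_le j := by
    have e0 : (d.input m).coeff j = if h : j / 4 ^ r < P.N then
      d.coeff ⟨j / 4 ^ r, h⟩ (finFunctionFinEquiv.symm ⟨j % 4 ^ r, Nat.mod_lt j (by positivity)⟩)
      else 0 := rfl
    rw [e0]
    split_ifs with h
    · refine (d.coeff_approx _ _).abs_le ?_
      have := P.coeff_le ⟨j / 4 ^ r, h⟩
        (finFunctionFinEquiv.symm ⟨j % 4 ^ r, Nat.mod_lt j (by positivity)⟩)
      linarith
    · simp
  time_le := by
    refine d.time_approx.abs_le ?_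
    have h1 : (((d.input m).M : ℕ) : ℝ) = P.N + m + 1 := by
      have : (d.input m).M = P.N + m + 1 := rfl
      rw [this]; push_cast; ring
    have h2 : (((d.input m).M : ℕ) : ℝ) ≤ 2 ^ (d.input m).M := by exact_mod_cast Nat.lt_two_pow_self.le
    have h3 : (1 : ℝ) ≤ 2 ^ g * 2 ^ (d.input m).M :=
      one_le_mul_of_one_le_of_one_le (one_le_pow₀ one_le_two) (one_le_pow₀ one_le_two)
    rw [← h1] at ht
    calc |P.t| + 1 ≤ 2 ^ g * 2 ^ (d.input m).M + 2 ^ g * 2 ^ (d.input m).M :=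
          add_le_add (ht.trans (by gcongr)) h3
      _ = 2 ^ (g + 1 + (d.input m).M) := by ring
      _ ≤ _ := pow_le_pow_right₀ one_le_two (by omega)

theorem Desc.bounded_inputMem {P : Inst r K ξ q τ} {p : ℕ} (d : Desc P p) (m : ℕ) (A : Params) {e : ℕ}
    (h : (d.input m).Moderate e) {x y : ℕ → ℤ} (hx : ∀ l, |x l| ≤ 2 ^ (p + 1))
    (hy : ∀ l, |y l| ≤ 2 ^ (p + 1)) :
    RAM.Bounded ((d.input m).wordLength A e) (inputMem m d x y) := by
  have hM : (d.input m).M = P.N + m + 1 := rfl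
  have hw : (d.input m).M + p + e + 10 ≤ (d.input m).wordLength A e := by
    have : (d.input m).p = p := rfl
    rw [Input.wordLength, this]; omega
  have h0 : RAM.bits 0 ≤ (d.input m).wordLength A e :=
    (Input.bits_le_of_abs_le (k := 0) (by simp)).trans (by omega)
  intro a i
  match a, i with
  | 0, 0 => exact (RAM.bits_natCast_le P.N).trans (by omega)
  | 0, 1 => exact (RAM.bits_natCast_le m).trans (by omega)
  | 0, 2 => exact (RAM.bits_natCast_le p).trans (by omega)
  | 0, 3 =>
    refine (Input.bits_le_of_abs_le h.time_le).trans ?_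
    have : (d.input m).p = p := rfl
    omega
  | 0, _ + 4 => exact h0
  | 1, l =>
    refine (Input.bits_le_of_abs_le (h.coeff_le l)).trans ?_
    have : (d.input m).p = p := rfl
    omega
  | 2, l => exact (Input.bits_le_of_abs_le (hx l)).trans (by omega)
  | 3, l => exact (Input.bits_le_of_abs_le (hy l)).trans (by omega)
  | _ + 4, _ => exact h0

theorem RAM.Run.runsIn {B : ℕ} {c : RAM.Prog} {m m' : RAM.Mem} {n T : ℕ} (h : RAM.Run B c m n m')
    (hm : RAM.Bounded B m) (hT : n * B ^ 2 ≤ T) : RAM.RunsIn c m T m' := by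
  obtain ⟨-, T', h1, h2⟩ := h hm
  exact ⟨T', h1.trans hT, h2⟩

/-- The constants of the algorithm, and those of the bounds for the length of the numbers. -/
theorem exists_constants (r : ℕ) (K ξ q : ℝ) (τ : ℕ → ℝ)
    (hτ : Asymptotics.IsBigO Filter.atTop τ (fun N : ℕ => Real.log (N : ℝ))) :
    ∃ (A : Params) (prec : Polynomial ℕ) (e : ℕ), ∀ (P : Inst r K ξ q τ) (ε : ℝ), 0 < ε →
      0 < ⌈1 / ε⌉₊ ∧ 1 / (⌈1 / ε⌉₊ : ℝ) ≤ ε ∧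
      ∀ p, prec.eval (P.N + ⌈1 / ε⌉₊) ≤ p → 5 * (P.N + ⌈1 / ε⌉₊ + 1) ≤ p ∧
        ∀ d : Desc P p, (d.input ⌈1 / ε⌉₊).Moderate e ∧
          Prepares (d.input ⌈1 / ε⌉₊) A P.state (1 / (4 * (P.N + ⌈1 / ε⌉₊ + 1))) := by
  obtain ⟨A, g, -, h⟩ := exists_params r K ξ q τ hτ
  obtain ⟨e, he⟩ := pow_unbounded_of_one_lt (K + 1) one_lt_two
  refine ⟨A, Polynomial.C (g + 5) * (Polynomial.X + 1), e + g + 1, fun P ε hε => ?_⟩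
  have hm : 0 < ⌈1 / ε⌉₊ := Nat.ceil_pos.2 (by positivity)
  refine ⟨hm, ?_, fun p hp => ?_⟩
  · rw [one_div_le (by exact_mod_cast hm) hε]
    exact Nat.le_ceil _
  · simp only [Polynomial.eval_mul, Polynomial.eval_C, Polynomial.eval_add, Polynomial.eval_X,
      Polynomial.eval_one] at hp
    rw [add_mul] at hp
    refine ⟨by omega, fun d => ?_⟩
    obtain ⟨h1, h2⟩ := h P ⌈1 / ε⌉₊ p d hm
    refine ⟨d.moderate _ h1 (he.le.trans ?_) (by omega), h2 (by omega)⟩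
    exact pow_le_pow_right₀ one_le_two (by omega)

theorem abs_queryArray_le {N p : ℕ} (a : Fin N → Option (Fin 2)) (l : ℕ) :
    |queryArray a l| ≤ 2 ^ (p + 1) := by
  have h2 : (2 : ℤ) ≤ 2 ^ (p + 1) := by
    rw [pow_succ]
    have : (1 : ℤ) ≤ 2 ^ p := one_le_pow₀ (by norm_num)
    linarith
  refine le_trans ?_ h2
  rw [queryArray]
  split_ifs with h
  · split
    · simp
    · next b _ =>
      have := b.isLt
      rw [Nat.abs_cast]
      omega
  · simp

theorem abs_coinArray_le {R : ℕ} (ω : Fin R → Fin 2) (l : ℕ) : |coinArray ω l| ≤ 1 := by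
  rw [coinArray]
  split_ifs with h
  · have := (ω ⟨l, h⟩).isLt
    rw [Nat.abs_cast]
    omega
  · simp

theorem abs_matArray_le {N p : ℕ} {o : Fin N → Fin 2 → Fin 2 → ℤ} {x : Fin N → Fin 2 → Fin 2 → ℝ}
    (h : ∀ i u v, Approx p (o i u v) (x i u v)) (hx : ∀ i u v, |x i u v| ≤ 1) (l : ℕ) :
    |matArray o l| ≤ 2 ^ (p + 1) := by
  rw [matArray]
  split_ifs with hl
  · rw [add_comm p 1]
    refine (h _ _ _).abs_le ?_
    have := hx ⟨l / 4, hl⟩ ⟨l / 2 % 2, Nat.mod_lt _ two_pos⟩ ⟨l % 2, Nat.mod_lt _ two_pos⟩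
    linarith
  · simp

theorem probabilitiesEasy (r : ℕ) (K ξ q : ℝ) (τ : ℕ → ℝ)
    (hτ : Asymptotics.IsBigO Filter.atTop τ (fun N : ℕ => Real.log (N : ℝ))) :
    ProbabilitiesEasy r K ξ q τ := by
  obtain ⟨A, prec, e, h⟩ := exists_constants r K ξ q τ hτ
  obtain ⟨time, htime⟩ := (PolyBounded.probabilityWeight A).mul
    ((Input.polyBounded_wordLength A e).pow 2)
  refine ⟨RAM.probabilityProg A, prec, time, fun P ε hε p hp d => ?_⟩
  obtain ⟨hm, hmε, h⟩ := h P ε hε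
  obtain ⟨-, h⟩ := h p hp
  obtain ⟨hmod, hprep⟩ := h d
  set I := d.input ⌈1 / ε⌉₊ with hI
  have ht := hprep.total_ne_zero
  refine ⟨I.dist A, I.isDist_dist A ht, ?_, fun a b => ?_⟩
  · refine (hprep.tvDist_le P.norm_state).trans_lt (lt_of_lt_of_le ?_ hmε)
    have : (0 : ℝ) < ⌈1 / ε⌉₊ := by exact_mod_cast hm
    have hN : (0 : ℝ) ≤ P.N := Nat.cast_nonneg _
    exact one_div_lt_one_div_of_lt this (by linarith)
  · have ha : ∀ k u, |agree (queryArray a k) u| ≤ 1 := fun _ _ => Input.abs_agree_le _ _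
    have hab : ∀ k u, |agree (queryArray a k) u * agree (queryArray b k) u| ≤ 1 := fun k u => by
      rw [abs_mul]
      exact mul_le_one₀ (Input.abs_agree_le _ _) (abs_nonneg _) (Input.abs_agree_le _ _)
    obtain ⟨m', hrun, h0, h1⟩ := RAM.run_probabilityProg (A := A)
      (d.holds_input ⌈1 / ε⌉₊ (queryArray a) (queryArray b)) (I.fits_wordLength A e)
      (Input.obsFits_diagArray hmod ha) (Input.obsFits_diagArray hmod hab)
    refine ⟨m', hrun.runsIn (d.bounded_inputMem _ A hmod (abs_queryArray_le a) (abs_queryArray_le b))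
      (htime I), fun hne => ?_⟩
    have hne' : (I.expect A (diagArray fun k u => agree (queryArray a k) u) : ℝ) ≠ 0 :=
      fun h => hne ((I.marginal_dist A a).trans (div_eq_zero_iff.2 (Or.inl h)))
    refine ⟨?_, ?_⟩
    · rw [h1]
      exact_mod_cast hne'
    · rw [h0, h1]
      exact (I.conditional_dist A ht a b).symm

theorem samplingEasy (r : ℕ) (K ξ q : ℝ) (τ : ℕ → ℝ)
    (hτ : Asymptotics.IsBigO Filter.atTop τ (fun N : ℕ => Real.log (N : ℝ))) :
    SamplingEasy r K ξ q τ := by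
  obtain ⟨A, prec, e, h⟩ := exists_constants r K ξ q τ hτ
  obtain ⟨time, htime⟩ := (PolyBounded.sampleWeight A).mul ((Input.polyBounded_wordLength A e).pow 2)
  refine ⟨RAM.sampleProg A, prec, Polynomial.X, time, fun P ε hε p hp d => ?_⟩
  obtain ⟨hm, hmε, h⟩ := h P ε hε
  obtain ⟨hp5, h⟩ := h p hp
  obtain ⟨hmod, hprep⟩ := h d
  set I := d.input ⌈1 / ε⌉₊ with hI
  set m := ⌈1 / ε⌉₊ with hmdef
  set R := (Polynomial.X : Polynomial ℕ).eval (P.N + m + p) with hR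
  have hRc : R = I.coins := Polynomial.eval_X
  refine ⟨fun ω => I.toCfg (I.sample A (RAM.binary (coinArray ω) R) I.N).1, fun ω => ?_, ?_⟩
  · have hone : (1 : ℤ) ≤ 2 ^ (p + 1) := one_le_pow₀ (by norm_num)
    obtain ⟨m', hrun, h4⟩ := RAM.run_sampleProg (A := A)
      (d.holds_input m (coinArray ω) 0) (I.fits_wordLength A e) rfl
      (fun l _ => abs_coinArray_le ω l) (Input.obsFits_diagArray hmod (by simp))
      (fun s j => Input.obsFits_diagArray hmod fun _ _ => Input.abs_agree_le _ _)
      (fun j hj => Input.bits_sample_snd_le hmod _ hj)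
    refine ⟨m', hrun.runsIn (d.bounded_inputMem _ A hmod (fun l => (abs_coinArray_le ω l).trans hone)
      (fun l => by simp)) (htime I), ?_⟩
    have h4' : m' 4 = (I.sample A (RAM.binary (coinArray ω) R) I.N).1 :=
      h4.trans (congrArg (fun k => (I.sample A (RAM.binary (coinArray ω) k) I.N).1) hRc.symm)
    funext i
    rw [outCfg, h4']
    rfl
  · refine (tvDist_triangle _ (I.dist A) _).trans_lt (lt_of_lt_of_le ?_ hmε)
    have h1 := I.tvDist_sample_le A hRc hprep.total_ne_zero
    have h2 := hprep.tvDist_le P.norm_state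
    have hm0 : (0 : ℝ) < m := by exact_mod_cast hm
    have hN : (0 : ℝ) ≤ P.N := Nat.cast_nonneg _
    have h3 : (2 : ℝ) ^ I.N * (1 / 2 ^ R) < 1 / (2 * m) := by
      have e1 : R = I.N + m + p := Polynomial.eval_X
      rw [e1, add_assoc, pow_add, one_div, mul_inv, ← mul_assoc, mul_inv_cancel₀ (by positivity), one_mul,
        ← one_div]
      refine one_div_lt_one_div_of_lt (by positivity) ?_
      have h4 : 2 * m < 2 ^ (m + p) := by
        calc 2 * m < 2 * 2 ^ m := by have := (Nat.lt_two_pow_self (n := m)); omega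
          _ = 2 ^ (m + 1) := by ring
          _ ≤ _ := Nat.pow_le_pow_right two_pos (by omega)
      exact_mod_cast h4
    have h5 : (1 : ℝ) / (4 * (P.N + m + 1)) ≤ 1 / (2 * m) :=
      one_div_le_one_div_of_le (by positivity) (by linarith)
    have h6 : (1 : ℝ) / (2 * m) + 1 / (2 * m) = 1 / m := by field_simp; norm_num
    rw [← h6]
    exact add_lt_add_of_lt_of_le (h1.trans_lt h3) (h2.trans h5)

theorem observablesEasy (r : ℕ) (K ξ q : ℝ) (τ : ℕ → ℝ)
    (hτ : Asymptotics.IsBigO Filter.atTop τ (fun N : ℕ => Real.log (N : ℝ))) :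
    ObservablesEasy r K ξ q τ := by
  obtain ⟨A, prec, e, h⟩ := exists_constants r K ξ q τ hτ
  obtain ⟨time, htime⟩ := (PolyBounded.observableWeight A).mul
    ((Input.polyBounded_wordLength A e).pow 2)
  refine ⟨RAM.observableProg A, prec, time, fun P ε hε p hp d O hO re im happ => ?_⟩
  obtain ⟨hm, hmε, h⟩ := h P ε hε
  obtain ⟨hp5, h⟩ := h p hp
  obtain ⟨hmod, hprep⟩ := h d
  set I := d.input ⌈1 / ε⌉₊ with hI
  set m := ⌈1 / ε⌉₊ with hmdef
  have hentry : ∀ i u v, ‖O i u v‖ ≤ 1 := fun i u v => (norm_apply_le_opNorm _ _ _).trans (hO i).2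
  have hre : ∀ l, |matArray re l| ≤ 2 ^ (p + 1) := abs_matArray_le (fun i u v => (happ i u v).1)
    fun i u v => (Complex.abs_re_le_norm _).trans (hentry i u v)
  have him : ∀ l, |matArray im l| ≤ 2 ^ (p + 1) := abs_matArray_le (fun i u v => (happ i u v).2)
    fun i u v => (Complex.abs_im_le_norm _).trans (hentry i u v)
  have hobs : ∀ i, |entryArray (matArray re) (matArray im) i| ≤ 2 ^ (I.p + 1) := by
    intro i
    rw [entryArray]
    split_ifs
    exacts [hre _, him _]
  obtain ⟨m', hrun, h0, h1⟩ := RAM.run_observableProg (A := A)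
    (d.holds_input m (matArray re) (matArray im)) (I.fits_wordLength A e)
    (Input.obsFits_wordLength hmod hobs) (Input.obsFits_diagArray hmod (by simp))
    (Input.bits_total_mul_le hmod)
  refine ⟨m', _, hrun.runsIn (d.bounded_inputMem _ A hmod hre him) (htime I),
    ⟨?_, rfl⟩, ?_⟩
  · rw [h1]
    exact mul_ne_zero hprep.total_ne_zero (by positivity)
  · rw [h0, h1]
    refine (hprep.observable_le P.norm_state hO happ).trans_lt (lt_of_lt_of_le ?_ hmε)
    have hm0 : (0 : ℝ) < m := by exact_mod_cast hm
    have hN : (0 : ℝ) ≤ P.N := Nat.cast_nonneg _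
    have hIN : I.N = P.N := rfl
    have hIp : I.p = p := rfl
    rw [hIN, hIp]
    have hbig : 8 * m * P.N * 4 ^ P.N ≤ 2 ^ p := by
      calc 8 * m * P.N * 4 ^ P.N ≤ 2 ^ 3 * 2 ^ m * 2 ^ P.N * (2 ^ 2) ^ P.N := by
            gcongr
            · norm_num
            · exact Nat.lt_two_pow_self.le
            · exact Nat.lt_two_pow_self.le
            · norm_num
        _ = 2 ^ (3 + m + P.N + 2 * P.N) := by rw [← pow_mul]; simp only [pow_add]
        _ ≤ _ := Nat.pow_le_pow_right two_pos (by omega)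
    have hbig' : (8 * m * P.N * 4 ^ P.N : ℝ) ≤ 2 ^ p := by exact_mod_cast hbig
    have hsmall : (P.N : ℝ) * (2 / 2 ^ p) ≤ 1 := by
      rw [← mul_div_assoc, div_le_one (by positivity)]
      refine le_trans ?_ hbig'
      have h4 : (1 : ℝ) ≤ 4 ^ P.N := one_le_pow₀ (by norm_num)
      have h5 : (1 : ℝ) ≤ m := by exact_mod_cast hm
      calc (P.N : ℝ) * 2 ≤ 8 * 1 * P.N * 1 := by linarith
        _ ≤ _ := by gcongr
    have h2 := one_add_pow_sub_one_le (show (0 : ℝ) ≤ 2 / 2 ^ p by positivity) P.N hsmall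
    have h3 : (4 : ℝ) ^ P.N * ((1 + 2 / 2 ^ p) ^ P.N - 1) ≤ 1 / (2 * m) := by
      calc _ ≤ (4 : ℝ) ^ P.N * (2 * (P.N * (2 / 2 ^ p))) := by gcongr
        _ = (8 * m * P.N * 4 ^ P.N) / 2 ^ p * (1 / (2 * m)) := by field_simp; ring
        _ ≤ 1 * (1 / (2 * m)) := by
          gcongr
          rw [div_le_one (by positivity)]
          exact hbig'
        _ = _ := one_mul _
    have h5 : 2 * ((1 : ℝ) / (4 * (P.N + m + 1))) < 1 / (2 * m) := by
      have : 2 * ((1 : ℝ) / (4 * (P.N + m + 1))) = 1 / (2 * (P.N + m + 1)) := by field_simp; norm_num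
      rw [this]
      exact one_div_lt_one_div_of_lt (by positivity) (by linarith)
    have h6 : (1 : ℝ) / (2 * m) + 1 / (2 * m) = 1 / m := by field_simp; norm_num
    rw [← h6]
    exact add_lt_add_of_lt_of_le h5 h3

end SpinChain

end

end

theorem corollaryS1 (r : ℕ) (K ξ q : ℝ) (hξ : 0 < ξ) (τ : ℕ → ℝ)
    (hτ : Asymptotics.IsBigO Filter.atTop τ (fun N : ℕ => Real.log (N : ℝ))) :
    SpinChain.SamplingEasy r K ξ q τ ∧
      SpinChain.ProbabilitiesEasy r K ξ q τ ∧
      SpinChain.ObservablesEasy r K ξ q τ := by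
  exact ⟨SpinChain.samplingEasy r K ξ q τ hτ, SpinChain.probabilitiesEasy r K ξ q τ hτ,
    SpinChain.observablesEasy r K ξ q τ hτ⟩
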